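/- **Setting.** For a matrix field $S$ on $\mathbb{R}^3$ write $\|S\|_{L^2}^2=\int_{\mathbb{R}^3}\sum_{i,j}|S_{ij}|^2\,dx$, $\hat S(\xi)=\int S(x)e^{-2\pi i x\cdot\xi}\,dx$, $\|S\|_{\dot H^1}^2=\int(2\pi|\xi|)^2|\hat S(\xi)|^2\,d\xi$ and $\|S\|_{H^1}^2=\|S\|_{L^2}^2+\|S\|_{\dot H^1}^2$. Let $L^2_{st}$ be the closed subspace of $L^2(\mathbb{R}^3;\mathbb{R}^{3\times3})$ of strain matrices, that is, of the symmetric trace-free matrix fields $S$ with $S=\nabla_{sym}(-\Delta)^{-1}(-2\,\mathrm{div}\,S)$ (equivalently $S=\nabla_{sym}u$ with $u\in\dot H^1$, $\nabla\cdot u=0$), let $H^1_{st}=H^1\cap L^2_{st}$, and let $P_{st}$ be the $L^2$-orthogonal projection onto $L^2_{st}$. For $0<T\le\infty$, a mild solution on $[0,T)$ of the strain self-amplification model equation $$\partial_tS-\Delta S+\tfrac23P_{st}(S^2)=0$$ is an $S\in C([0,T);L^2_{st})$ with $$S(t)=e^{t\Delta}S^0-\tfrac23\int_0^te^{\tau\Delta}P_{st}\big(S^2(t-\tau)\big)\,d\tau\qquad(0<t<T),\qquad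 S^0=S(0),$$ where $e^{t\Delta}$ is the heat semigroup and $e^{\tau\Delta}P_{st}(S^2)$ is understood as $P_{st}(e^{\tau\Delta}(S^2))$. The time $T$ is maximal for $S$ if $S$ does not extend to a mild solution on some $[0,T')$ with $T'>T$. Let $E(t)=\|S(t)\|_{L^2}^2$ and $E_0=E(0)$, let $\lambda_1(x,t)\le\lambda_2(x,t)\le\lambda_3(x,t)$ be the eigenvalues of $S(x,t)$, and let $\lambda_2^+=\max\{0,\lambda_2\}$. **Theorem.** Let $0<T\le\infty$ and let $S\in C([0,T);H^1_{st})$ be a mild solution of the strain self-amplification model equation on $[0,T)$ such that $$-3\|S^0\|_{\dot H^1}^2-4\int_{\mathbb{R}^3}\det(S^0)\,dx>0,$$ and set $$r_0=\frac{-3\|S^0\|_{\dot H^1}^2-4\int\det(S^0)}{2\|S^0\|_{L^2}^2}.$$ Then: 1. $E(t)>\dfrac{E_0}{(1-r_0t)^2}$ for all $0<t<T$; 2. $T<\dfrac1{r_0}=\dfrac{2\|S^0\|_{L^2}^2}{-3\|S^0\|_{\dot H^1}^2-4\int\det(S^0)}$; in particular the maximal time of existence of such a solution is finite; 3. if $T=T_{max}$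 is maximal for $S$, then for all $p,q$ with $\frac2p+\frac3q=2$ and $\frac32<q\le\infty$, $$\int_0^{T_{max}}\|\lambda_2^+(\cdot,t)\|_{L^q}^p\,dt=\infty.$$ -/

import Mathlib

open MeasureTheory Filter Topology
open scoped ENNReal

noncomputable section

namespace StrainModel

/-! ### Square-integrable matrix fields on three-dimensional space -/

/-- Physical (and frequency) space `ℝ³`. -/
abbrev R3 : Type := EuclideanSpace ℝ (Fin 3)

/-- Real `3 × 3` matrices with the Frobenius inner product. -/
abbrev Mat3 : Type := EuclideanSpace ℝ (Fin 3 × Fin 3)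

/-- Complex `3 × 3` matrices with the Frobenius inner product. -/
abbrev CMat3 : Type := EuclideanSpace ℂ (Fin 3 × Fin 3)

/-- `L²(ℝ³; ℝ^{3×3})`, with `‖S‖² = ∫ ∑ᵢⱼ |Sᵢⱼ(x)|² dx`. -/
abbrev MatL2 : Type := Lp Mat3 2 (volume : Measure R3)

/-- Regard a real matrix as a complex one. -/
def complexify : Mat3 →L[ℝ] CMat3 :=
  LinearMap.toContinuousLinearMap
    { toFun := fun A => WithLp.toLp 2 fun k => (A k : ℂ)
      map_add' := fun A B => by ext k; simp
      map_smul' := fun c A => by ext k; simp }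

/-- The Fourier transform `Ŝ(ξ) = ∫ S(x) e^{-2πi x·ξ} dx` of a real square-integrable matrix
field, extended to `L²` by Plancherel's theorem. -/
def ftL2 : MatL2 →L[ℝ] Lp CMat3 2 (volume : Measure R3) :=
  ((Lp.fourierTransformₗᵢ R3 CMat3).toContinuousLinearEquiv.toContinuousLinearMap.restrictScalars
    ℝ).comp (complexify.compLpL 2 volume)

/-! ### Strain matrices and the projection onto them -/

/-- The Fourier side of the identity `S = ∇_sym (-Δ)⁻¹ (-2 div S)` at the frequency `ξ`, with
`A = Ŝ(ξ)`: the operator `-2 ∂ᵢ ∂ₖ (-Δ)⁻¹` has the symbol `2 ξᵢ ξₖ / |ξ|²`, and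
`∇_sym v = (∂ᵢ vⱼ + ∂ⱼ vᵢ) / 2`. -/
def StrainSymbol (ξ : R3) (A : CMat3) : Prop :=
  ∀ i j : Fin 3, A (i, j) =
    (∑ k : Fin 3, ((ξ i : ℂ) * (ξ k : ℂ) * A (k, j) + (ξ j : ℂ) * (ξ k : ℂ) * A (k, i)))
      / ((‖ξ‖ : ℂ) ^ 2)

/-- `S ∈ L²` takes values in the symmetric matrices, `tr S = 0`, and
`S = ∇_sym (-Δ)⁻¹ (-2 div S)`. Equivalently, `S = ∇_sym u` with `u ∈ Ḣ¹` and `div u = 0`. -/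
def IsStrain (S : MatL2) : Prop :=
  (∀ᵐ x : R3, ∀ i j : Fin 3, S x (i, j) = S x (j, i)) ∧
  (∀ᵐ x : R3, ∑ i : Fin 3, S x (i, i) = 0) ∧
  (∀ᵐ ξ : R3, StrainSymbol ξ (ftL2 S ξ))

/-- The constraint space `L²_st`. -/
def L2st : Submodule ℝ MatL2 where
  carrier := {S | IsStrain S}
  zero_mem' := by
    refine ⟨?_, ?_, ?_⟩
    · filter_upwards [Lp.coeFn_zero Mat3 2 (volume : Measure R3)] with x hx
      rw [hx]
      simp
    · filter_upwards [Lp.coeFn_zero Mat3 2 (volume : Measure R3)] with x hx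
      rw [hx]
      simp
    · rw [map_zero]
      filter_upwards [Lp.coeFn_zero CMat3 2 (volume : Measure R3)] with x hx
      rw [hx]
      simp [StrainSymbol]
  add_mem' := by
    rintro S T ⟨hS1, hS2, hS3⟩ ⟨hT1, hT2, hT3⟩
    refine ⟨?_, ?_, ?_⟩
    · filter_upwards [Lp.coeFn_add S T, hS1, hT1] with x hx h1 h2 i j
      rw [hx, Pi.add_apply, PiLp.add_apply, PiLp.add_apply, h1 i j, h2 i j]
    · filter_upwards [Lp.coeFn_add S T, hS2, hT2] with x hx h1 h2
      simp only [hx, Pi.add_apply, PiLp.add_apply, Finset.sum_add_distrib, h1, h2, add_zero]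
    · rw [map_add]
      filter_upwards [Lp.coeFn_add (ftL2 S) (ftL2 T), hS3, hT3] with ξ hx h1 h2 i j
      rw [hx, Pi.add_apply, PiLp.add_apply, h1 i j, h2 i j, ← add_div, ← Finset.sum_add_distrib]
      congr 1
      refine Finset.sum_congr rfl fun k _ => ?_
      simp only [PiLp.add_apply]
      ring
  smul_mem' := by
    rintro c S ⟨hS1, hS2, hS3⟩
    refine ⟨?_, ?_, ?_⟩
    · filter_upwards [Lp.coeFn_smul c S, hS1] with x hx h1 i j
      rw [hx, Pi.smul_apply, PiLp.smul_apply, PiLp.smul_apply, h1 i j]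
    · filter_upwards [Lp.coeFn_smul c S, hS2] with x hx h1
      simp only [hx, Pi.smul_apply, PiLp.smul_apply, smul_eq_mul, ← Finset.mul_sum, h1, mul_zero]
    · rw [map_smul]
      filter_upwards [Lp.coeFn_smul c (ftL2 S), hS3] with ξ hx h1 i j
      rw [hx, Pi.smul_apply, PiLp.smul_apply, h1 i j, Complex.real_smul, ← mul_div_assoc,
        Finset.mul_sum]
      congr 1
      refine Finset.sum_congr rfl fun k _ => ?_
      simp only [PiLp.smul_apply, Complex.real_smul]
      ring

/-- A pointwise closed condition passes to limits in `L²`. -/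
lemma ae_of_tendsto_L2 {V : Type*} [NormedAddCommGroup V] {f : ℕ → Lp V 2 (volume : Measure R3)}
    {g : Lp V 2 (volume : Measure R3)} (hfg : Tendsto f atTop (𝓝 g)) {P : R3 → V → Prop}
    (hP : ∀ x, IsClosed {v | P x v}) (hf : ∀ n, ∀ᵐ x : R3, P x (f n x)) :
    ∀ᵐ x : R3, P x (g x) := by
  obtain ⟨ns, -, hns⟩ := (tendstoInMeasure_of_tendsto_Lp hfg).exists_seq_tendsto_ae
  filter_upwards [hns, ae_all_iff.2 hf] with x hx h
  exact (hP x).mem_of_tendsto hx (Eventually.of_forall fun n => h (ns n))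

lemma isClosed_L2st : IsClosed (L2st : Set MatL2) := by
  refine IsSeqClosed.isClosed fun f g hf hfg => ⟨?_, ?_, ?_⟩
  · refine ae_of_tendsto_L2 hfg (P := fun _ A => ∀ i j : Fin 3, A (i, j) = A (j, i))
      (fun x => ?_) fun n => (hf n).1
    simp only [Set.ofPred_forall]
    exact isClosed_iInter fun i => isClosed_iInter fun j => isClosed_eq (by fun_prop) (by fun_prop)
  · refine ae_of_tendsto_L2 hfg (P := fun _ A => ∑ i : Fin 3, A (i, i) = 0)
      (fun x => ?_) fun n => (hf n).2.1
    exact isClosed_eq (by fun_prop) (by fun_prop)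
  · refine ae_of_tendsto_L2 ((ftL2.continuous.tendsto g).comp hfg) (P := StrainSymbol)
      (fun ξ => ?_) fun n => (hf n).2.2
    simp only [StrainSymbol, Set.ofPred_forall]
    exact isClosed_iInter fun i => isClosed_iInter fun j =>
      isClosed_eq (by fun_prop) ((by fun_prop : Continuous _).div_const _)

instance : CompleteSpace L2st := isClosed_L2st.completeSpace_coe

/-- The orthogonal projection `P_st` of `L²` onto `L²_st`. -/
def Pst : MatL2 →L[ℝ] MatL2 := L2st.starProjection

/-! ### Sobolev norms -/

/-- `‖S‖²_{Ḣ¹} = ∫ (2π|ξ|)² |Ŝ(ξ)|² dξ`, possibly infinite. -/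
def hDotOneSq (S : MatL2) : ℝ≥0∞ :=
  ∫⁻ ξ : R3, ENNReal.ofReal ((2 * Real.pi * ‖ξ‖) ^ 2) * ‖ftL2 S ξ‖ₑ ^ 2

/-- `‖S‖²_{H¹} = ∫ (1 + (2π|ξ|)²) |Ŝ(ξ)|² dξ`, possibly infinite. -/
def hOneSq (S : MatL2) : ℝ≥0∞ :=
  ∫⁻ ξ : R3, ENNReal.ofReal (1 + (2 * Real.pi * ‖ξ‖) ^ 2) * ‖ftL2 S ξ‖ₑ ^ 2

/-- The time interval `[0, T)`, where `0 ≤ T ≤ ∞`. -/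
def timeInterval (T : ℝ≥0∞) : Set ℝ := {t | 0 ≤ t ∧ ENNReal.ofReal t < T}

/-- `S ∈ C([0, T); H¹_st)`, where `H¹_st = H¹ ∩ L²_st`. (A matrix field in `L²_st` is
`∇_sym (-Δ)^{-1/2} u` for exactly one divergence-free `u`, and `|û|² = 2 |Ŝ|²` pointwise, so
that `S` lies in `H¹` if and only if `u` does.) -/
def ContinuousInH1st (T : ℝ≥0∞) (S : ℝ → MatL2) : Prop :=
  ∀ t ∈ timeInterval T, S t ∈ L2st ∧ hOneSq (S t) < ∞ ∧
    Tendsto (fun s => hOneSq (S s - S t)) (𝓝[timeInterval T] t) (𝓝 0)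

/-! ### The strain self-amplification model equation -/

/-- The heat kernel `G(x, t) = (4πt)^{-3/2} exp(-|x|² / (4t))`. -/
def heatKernel (t : ℝ) (x : R3) : ℝ :=
  (4 * Real.pi * t) ^ (-(3 / 2) : ℝ) * Real.exp (-‖x‖ ^ 2 / (4 * t))

/-- The heat semigroup `e^{tΔ} f = G(·, t) * f`, for `t > 0`, as a function. -/
def heatFun (t : ℝ) (f : R3 → Mat3) (x : R3) : Mat3 :=
  ∫ y : R3, heatKernel t (x - y) • f y

open Classical in
/-- The heat semigroup `e^{tΔ} f`, for `t > 0`, as an element of `L²`. It is used for `f` in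
`L²` and for `f` in `L¹` only, and then `G(·, t) * f` is in `L²` by Young's inequality. -/
def heat (t : ℝ) (f : R3 → Mat3) : MatL2 :=
  if h : MemLp (heatFun t f) 2 (volume : Measure R3) then h.toLp (heatFun t f) else 0

/-- The pointwise matrix square `S(x)²`. -/
def sqField (S : MatL2) (x : R3) : Mat3 :=
  WithLp.toLp 2 fun p => ∑ k : Fin 3, S x (p.1, k) * S x (k, p.2)

/-- `S ∈ C([0, T); L²_st)` is a mild solution of `∂ₜ S - Δ S + (2/3) P_st(S²) = 0`: for all
`0 < t < T`, `S(t) = e^{tΔ} S(0) - (2/3) ∫₀ᵗ e^{τΔ} P_st(S(t - τ)²) dτ`. Since `S²` is in `L¹`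
but not necessarily in `L²`, the Fourier multipliers `e^{τΔ}` and `P_st`, which commute, are
applied in the order `P_st e^{τΔ}`. -/
structure IsMildSolution (T : ℝ≥0∞) (S : ℝ → MatL2) : Prop where
  continuousOn : ContinuousOn S (timeInterval T)
  mem_L2st : ∀ t ∈ timeInterval T, S t ∈ L2st
  duhamel : ∀ t ∈ timeInterval T, 0 < t →
    S t = heat t (S 0) - (2 / 3 : ℝ) • ∫ τ in (0 : ℝ)..t, Pst (heat τ (sqField (S (t - τ))))

/-- `T` is the maximal time of existence of the mild solution `S`: it is not the restriction
of a mild solution on a longer interval `[0, T')`. -/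
def IsMaximalTime (T : ℝ≥0∞) (S : ℝ → MatL2) : Prop :=
  ¬ ∃ (T' : ℝ≥0∞) (S' : ℝ → MatL2), T < T' ∧ IsMildSolution T' S' ∧
    ∀ t ∈ timeInterval T, S' t = S t

/-! ### Enstrophy, determinant, middle eigenvalue -/

/-- The matrix `S(x)`. -/
def matrixAt (S : MatL2) (x : R3) : Matrix (Fin 3) (Fin 3) ℝ := Matrix.of fun i j => S x (i, j)

/-- The enstrophy `E = ‖S‖²_{L²}`. -/
def enstrophy (S : MatL2) : ℝ := ‖S‖ ^ 2

/-- The quantity `-3 ‖S‖²_{Ḣ¹} - 4 ∫ det S`. -/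
def blowupQuantity (S : MatL2) : ℝ :=
  -3 * (hDotOneSq S).toReal - 4 * ∫ x : R3, (matrixAt S x).det

open Classical in
/-- The middle eigenvalue `λ₂` of a symmetric matrix with eigenvalues `λ₁ ≤ λ₂ ≤ λ₃`. (For a
Hermitian matrix, `eigenvalues₀` lists the eigenvalues in decreasing order, starting with the
index `0`. The value at matrices that are not symmetric is irrelevant.) -/
def midEigenvalue (A : Matrix (Fin 3) (Fin 3) ℝ) : ℝ :=
  if h : A.IsHermitian then h.eigenvalues₀ ⟨1, by simp⟩ else 0

/-- `‖λ₂⁺‖_{L^q}`, where `λ₂⁺(x) = max {0, λ₂(x)}` and `λ₂(x)` is the middle eigenvalue of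
`S(x)`; possibly infinite. -/
def lambdaTwoPlusNorm (q : ℝ≥0∞) (S : MatL2) : ℝ≥0∞ :=
  eLpNorm (fun x : R3 => max 0 (midEigenvalue (matrixAt S x))) q volume

end StrainModel

end

/-!
# Finite-time blowup for the strain self-amplification model equation

Write `E = ‖S‖²`, `J = ‖S‖²_{Ḣ¹}`, `C = ∫ tr S³ = 3 ∫ det S` and `K = -3 J - (4/3) C`, which is
`blowupQuantity`. The model equation `∂ₜS = ΔS - (2/3) P_st(S²)` is the gradient flow of `-K / 6` on
the constraint space: the `L²`-gradient of `K` is `6 ΔS - 4 P_st(S²) = 6 ∂ₜS`. Hence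
`K' = 6 ‖∂ₜS‖²`, while `E' = 2 ⟨S, ∂ₜS⟩ = -2 J - (4/3) C = J + K`. The Cauchy–Schwarz inequality
`(E')² ≤ 4 E ‖∂ₜS‖²` gives `K' ≥ (3/2) (E')² / E`. If `K₀ > 0`, then `K` stays positive,
`E' = J + K > K`, and comparison gives `K ≥ K₀ (E / E₀)^{3/2}` (`le_of_slope_bound`), so that
`(E^{-1/2})' < -K₀ / (2 E₀^{3/2})` (`strictAntiOn_of_slope_bound`). Integration yields the lower
bound for `E` (`enstrophy_lower_bound`), and since `E^{-1/2} > 0`, the bound for the existence time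
(`existence_time_lt`).

The solution is only a mild one in `C([0, T); H¹)`, so that `∂ₜS` and `K'` have no immediate
meaning. Since `H¹` embeds into `L⁴` (`exists_eLpNorm_four_le`), the forcing `-(2/3) P_st(S²)` is
continuous in time with values in `L²`. On the frequency side, a truncation to bounded frequencies
turns Duhamel's formula into an ordinary differential equation in a Hilbert space
(`exists_truncated_ode`). Removing the truncation gives the energy identity (`energy_identity`) and
a gradient-flow inequality for difference quotients (`gradient_flow_le`); together with Taylor's
formula for the cubic functional `C` (`cubic_expand`) the latter replaces the identity for `K'`
(`blowupQuantity_sub_ge`), and the comparison argument uses Dini derivatives only.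

For the integral of the middle eigenvalue, `-det S ≤ ½ |S|² λ₂⁺` (`neg_det_le`) bounds the
production of enstrophy: `E' ≤ -2 J + 2 ∫ λ₂⁺ |S|²`. Hölder's, Sobolev's and Young's inequalities
absorb the Dirichlet energy and leave `E' ≤ c ‖λ₂⁺‖_q^p E` (`deriv_enstrophy_le`). If the integral
in question is finite, then `E` is bounded by Grönwall's inequality. A mild solution that is bounded
in `L²` on a bounded time interval can be continued (`not_isMaximalTime_of_bounded`), by the
contraction principle and the smoothing bound `‖e^{tΔ} f‖₂ ≤ c t^{-3/4} ‖f‖₁`, whose singularity is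
integrable in time. As the maximal time is finite, this is a contradiction.
-/

noncomputable section

namespace StrainModel

open scoped BoundedContinuousFunction FourierTransform SchwartzMap NNReal LineDeriv

/-! ### Convolution with a scalar kernel -/

/-- Cauchy–Schwarz with respect to the measure with density `u`. -/
lemma lintegral_mul_sq_le {α : Type*} [MeasurableSpace α] {μ : Measure α} {u v : α → ℝ≥0∞}
    (hu : AEMeasurable u μ) (hv : AEMeasurable v μ) :
    (∫⁻ y, u y * v y ∂μ) ^ 2 ≤ (∫⁻ y, u y ∂μ) * ∫⁻ y, u y * v y ^ 2 ∂μ := by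
  have h := ENNReal.lintegral_mul_le_Lp_mul_Lq μ Real.HolderConjugate.two_two
    (f := fun y => u y ^ (1 / 2 : ℝ)) (g := fun y => u y ^ (1 / 2 : ℝ) * v y)
    (hu.pow_const _) ((hu.pow_const _).mul hv)
  have e1 : ∀ y, ((fun y => u y ^ (1 / 2 : ℝ)) * fun y => u y ^ (1 / 2 : ℝ) * v y) y
      = u y * v y := fun y => by
    simp only [Pi.mul_apply]
    rw [← mul_assoc, ← ENNReal.rpow_add_of_nonneg _ _ (by norm_num) (by norm_num)]
    norm_num
  have e2 : ∀ y, (u y ^ (1 / 2 : ℝ)) ^ (2 : ℝ) = u y := fun y => by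
    rw [← ENNReal.rpow_mul]; norm_num
  have e3 : ∀ y, (u y ^ (1 / 2 : ℝ) * v y) ^ (2 : ℝ) = u y * v y ^ 2 := fun y => by
    rw [ENNReal.mul_rpow_of_nonneg _ _ (by norm_num), e2]; norm_num
  simp only [e1, e2, e3] at h
  calc (∫⁻ y, u y * v y ∂μ) ^ 2
      ≤ ((∫⁻ y, u y ∂μ) ^ (1 / 2 : ℝ) * (∫⁻ y, u y * v y ^ 2 ∂μ) ^ (1 / 2 : ℝ)) ^ 2 := by gcongr
    _ = _ := by
      rw [mul_pow, ← ENNReal.rpow_natCast, ← ENNReal.rpow_natCast, ← ENNReal.rpow_mul,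
        ← ENNReal.rpow_mul]
      norm_num

lemma lintegral_sub_comm (a b : R3 → ℝ≥0∞) (x : R3) :
    ∫⁻ y, a (x - y) * b y = ∫⁻ y, b (x - y) * a y := by
  rw [← lintegral_sub_left_eq_self _ x]
  simp [mul_comm]

/-- Young's inequality `‖a * b‖₂ ≤ ‖a‖₁ ‖b‖₂` for nonnegative functions. -/
lemma lintegral_conv_sq_le {a b : R3 → ℝ≥0∞} (ha : AEMeasurable a) (hb : AEMeasurable b) :
    ∫⁻ x, (∫⁻ y, b (x - y) * a y) ^ 2 ≤ (∫⁻ y, a y) ^ 2 * ∫⁻ y, b y ^ 2 := by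
  have hb' : ∀ x : R3, AEMeasurable fun y => b (x - y) := fun x =>
    hb.comp_quasiMeasurePreserving (quasiMeasurePreserving_sub_left volume x)
  have hprod : AEMeasurable (Function.uncurry fun x y : R3 => a y * b (x - y) ^ 2)
      (volume.prod volume) :=
    ((ha.comp_quasiMeasurePreserving Measure.quasiMeasurePreserving_snd).mul
      ((hb.comp_quasiMeasurePreserving
        (quasiMeasurePreserving_sub_of_right_invariant volume volume)).pow_const 2))
  calc ∫⁻ x, (∫⁻ y, b (x - y) * a y) ^ 2
      ≤ ∫⁻ x, (∫⁻ y, a y) * ∫⁻ y, a y * b (x - y) ^ 2 := by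
        refine lintegral_mono fun x => ?_
        simp_rw [mul_comm (b _)]
        exact lintegral_mul_sq_le ha (hb' x)
    _ = (∫⁻ y, a y) * ∫⁻ y, ∫⁻ x, a y * b (x - y) ^ 2 := by
        rw [← lintegral_lintegral_swap hprod]
        exact lintegral_const_mul'' _ hprod.lintegral_prod_right'
    _ = (∫⁻ y, a y) * ∫⁻ y, a y * ∫⁻ x, b x ^ 2 := by
        congr 1
        refine lintegral_congr fun y => ?_
        rw [← lintegral_sub_right_eq_self (fun x => b x ^ 2) y, lintegral_const_mul'']
        exact ((hb.comp_quasiMeasurePreserving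
          (measurePreserving_sub_right volume y).quasiMeasurePreserving).pow_const 2)
    _ = _ := by
        rw [lintegral_mul_const'' _ ha]; ring

/-- The convolution of a scalar kernel with a matrix field. -/
def kconv (k : R3 → ℝ) (f : R3 → Mat3) (x : R3) : Mat3 := ∫ y : R3, k (x - y) • f y

lemma aestronglyMeasurable_kconv {k : R3 → ℝ} {f : R3 → Mat3} (hk : AEStronglyMeasurable k)
    (hf : AEStronglyMeasurable f) : AEStronglyMeasurable (kconv k f) := by
  have : AEStronglyMeasurable (fun p : R3 × R3 => k (p.1 - p.2) • f p.2)
      (volume.prod volume) :=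
    (hk.comp_quasiMeasurePreserving
        (quasiMeasurePreserving_sub_of_right_invariant volume volume)).smul
      (hf.comp_quasiMeasurePreserving Measure.quasiMeasurePreserving_snd)
  exact this.integral_prod_right'

lemma enorm_kconv_le (k : R3 → ℝ) (f : R3 → Mat3) (x : R3) :
    ‖kconv k f x‖ₑ ≤ ∫⁻ y, ‖k (x - y)‖ₑ * ‖f y‖ₑ := by
  refine (enorm_integral_le_lintegral_enorm _).trans (lintegral_mono fun y => ?_)
  rw [enorm_smul]

lemma eLpNorm_two_sq {V : Type*} [NormedAddCommGroup V] (f : R3 → V) :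
    eLpNorm f 2 volume ^ 2 = ∫⁻ x, ‖f x‖ₑ ^ 2 := by
  have := eLpNorm_nnreal_pow_eq_lintegral (μ := (volume : Measure R3)) (f := f)
    (p := 2) (by norm_num)
  simpa using this

lemma eLpNorm_kconv_le_two_one {k : R3 → ℝ} {f : R3 → Mat3} (hk : AEStronglyMeasurable k)
    (hf : AEStronglyMeasurable f) :
    eLpNorm (kconv k f) 2 volume ≤ eLpNorm k 2 volume * eLpNorm f 1 volume := by
  rw [← ENNReal.pow_le_pow_left_iff two_ne_zero, mul_pow, eLpNorm_two_sq, eLpNorm_two_sq,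
    eLpNorm_one_eq_lintegral_enorm, mul_comm]
  refine le_trans (lintegral_mono fun x => ?_) (lintegral_conv_sq_le hf.enorm hk.enorm)
  gcongr
  exact enorm_kconv_le k f x

lemma eLpNorm_kconv_le_one_two {k : R3 → ℝ} {f : R3 → Mat3} (hk : AEStronglyMeasurable k)
    (hf : AEStronglyMeasurable f) :
    eLpNorm (kconv k f) 2 volume ≤ eLpNorm k 1 volume * eLpNorm f 2 volume := by
  rw [← ENNReal.pow_le_pow_left_iff two_ne_zero, mul_pow, eLpNorm_two_sq, eLpNorm_two_sq,
    eLpNorm_one_eq_lintegral_enorm]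
  refine le_trans (lintegral_mono fun x => ?_) (lintegral_conv_sq_le hk.enorm hf.enorm)
  gcongr
  refine (enorm_kconv_le k f x).trans_eq ?_
  exact lintegral_sub_comm (fun y => ‖k y‖ₑ) (fun y => ‖f y‖ₑ) x

lemma kconv_congr {k : R3 → ℝ} {f g : R3 → Mat3} (h : f =ᵐ[volume] g) : kconv k f = kconv k g := by
  funext x
  refine integral_congr_ae ?_
  filter_upwards [h] with y hy
  rw [hy]

/-! ### The heat kernel -/

lemma heatKernel_nonneg {t : ℝ} (ht : 0 < t) (x : R3) : 0 ≤ heatKernel t x := by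
  unfold heatKernel; positivity

lemma continuous_heatKernel (t : ℝ) : Continuous (heatKernel t) := by
  unfold heatKernel; fun_prop

lemma heatKernel_le {t : ℝ} (ht : 0 < t) (x : R3) :
    heatKernel t x ≤ (4 * Real.pi * t) ^ (-(3 / 2) : ℝ) := by
  unfold heatKernel
  refine mul_le_of_le_one_right (by positivity) (Real.exp_le_one_iff.2 ?_)
  exact div_nonpos_of_nonpos_of_nonneg (by simp) (by positivity)

lemma integral_exp_neg_mul_sq {b : ℝ} (hb : 0 < b) :
    ∫ v : R3, Real.exp (-b * ‖v‖ ^ 2) = (Real.pi / b) ^ (3 / 2 : ℝ) := by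
  rw [GaussianFourier.integral_rexp_neg_mul_sq_norm hb]
  simp

lemma integrable_exp_neg_mul_sq {b : ℝ} (hb : 0 < b) :
    Integrable fun v : R3 => Real.exp (-b * ‖v‖ ^ 2) := by
  -- The integral of a function that is not integrable would be `0`.
  by_contra h
  have := integral_undef h
  rw [integral_exp_neg_mul_sq hb] at this
  exact absurd this (by positivity)

lemma heatKernel_mul_heatKernel (t s : ℝ) (x : R3) :
    heatKernel t x * heatKernel s x = (4 * Real.pi * t) ^ (-(3 / 2) : ℝ) *
      (4 * Real.pi * s) ^ (-(3 / 2) : ℝ) * Real.exp (-(1 / (4 * t) + 1 / (4 * s)) * ‖x‖ ^ 2) := by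
  unfold heatKernel
  rw [mul_mul_mul_comm, ← Real.exp_add]
  congr 2
  ring

lemma integrable_heatKernel_mul {t s : ℝ} (ht : 0 < t) (hs : 0 < s) :
    Integrable fun x => heatKernel t x * heatKernel s x := by
  simp_rw [heatKernel_mul_heatKernel]
  exact (integrable_exp_neg_mul_sq (by positivity)).const_mul _

lemma integral_heatKernel_mul {t s : ℝ} (ht : 0 < t) (hs : 0 < s) :
    ∫ x, heatKernel t x * heatKernel s x = (4 * Real.pi * (t + s)) ^ (-(3 / 2) : ℝ) := by
  simp_rw [heatKernel_mul_heatKernel]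
  rw [integral_const_mul, integral_exp_neg_mul_sq (by positivity)]
  rw [Real.rpow_neg (by positivity), Real.rpow_neg (by positivity), Real.rpow_neg (by positivity),
    ← mul_inv, ← Real.mul_rpow (by positivity) (by positivity), ← Real.inv_rpow (by positivity),
    ← Real.mul_rpow (by positivity) (by positivity), ← Real.inv_rpow (by positivity)]
  congr 1
  field_simp
  ring

lemma integrable_heatKernel {t : ℝ} (ht : 0 < t) : Integrable (heatKernel t) := by
  have : heatKernel t = fun x => (4 * Real.pi * t) ^ (-(3 / 2) : ℝ) *
      Real.exp (-(1 / (4 * t)) * ‖x‖ ^ 2) := by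
    funext x; unfold heatKernel; congr 2; ring
  rw [this]
  exact (integrable_exp_neg_mul_sq (by positivity)).const_mul _

lemma memLp_two_heatKernel {t : ℝ} (ht : 0 < t) : MemLp (heatKernel t) 2 volume := by
  rw [memLp_two_iff_integrable_sq (continuous_heatKernel t).aestronglyMeasurable]
  simpa [sq] using integrable_heatKernel_mul ht ht

/-- `‖G(·, t) - G(·, s)‖₂²`, computed exactly from the inner products of Gaussians. The right side
tends to `0` as `t → s`, which gives the continuity in time of the heat semigroup on `L¹`. -/
lemma lintegral_heatKernel_sub_sq {t s : ℝ} (ht : 0 < t) (hs : 0 < s) :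
    ∫⁻ x, ‖(heatKernel t - heatKernel s) x‖ₑ ^ 2 = ENNReal.ofReal
      ((4 * Real.pi * (t + t)) ^ (-(3 / 2) : ℝ) + (4 * Real.pi * (s + s)) ^ (-(3 / 2) : ℝ)
        - 2 * (4 * Real.pi * (t + s)) ^ (-(3 / 2) : ℝ)) := by
  have e : ∀ x, (heatKernel t - heatKernel s) x ^ 2 = heatKernel t x * heatKernel t x +
      heatKernel s x * heatKernel s x - 2 * (heatKernel t x * heatKernel s x) := fun x => by
    simp only [Pi.sub_apply]; ring
  have hi := ((integrable_heatKernel_mul ht ht).add (integrable_heatKernel_mul hs hs)).sub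
    ((integrable_heatKernel_mul ht hs).const_mul 2)
  have hi' := integral_sub ((integrable_heatKernel_mul ht ht).add
    (integrable_heatKernel_mul hs hs)) ((integrable_heatKernel_mul ht hs).const_mul 2)
  rw [integral_add' (integrable_heatKernel_mul ht ht) (integrable_heatKernel_mul hs hs),
    integral_const_mul] at hi'
  rw [← integral_heatKernel_mul ht ht, ← integral_heatKernel_mul hs hs,
    ← integral_heatKernel_mul ht hs, ← hi']
  refine Eq.trans ?_ (ofReal_integral_eq_lintegral_ofReal hi ?_).symm
  · refine lintegral_congr fun x => ?_
    rw [← ofReal_norm, ← ENNReal.ofReal_pow (norm_nonneg _), Real.norm_eq_abs, sq_abs, e]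
    rfl
  · refine Eventually.of_forall fun x => ?_
    have := e x ▸ sq_nonneg ((heatKernel t - heatKernel s) x)
    exact this

lemma lintegral_heatKernel_sq {t : ℝ} (ht : 0 < t) :
    ∫⁻ x, ‖heatKernel t x‖ₑ ^ 2 = ENNReal.ofReal ((8 * Real.pi * t) ^ (-(3 / 2) : ℝ)) := by
  rw [show 8 * Real.pi * t = 4 * Real.pi * (t + t) by ring, ← integral_heatKernel_mul ht ht,
    ofReal_integral_eq_lintegral_ofReal (integrable_heatKernel_mul ht ht)]
  · refine lintegral_congr fun x => ?_
    rw [← ofReal_norm, ← ENNReal.ofReal_pow (norm_nonneg _), Real.norm_eq_abs, sq_abs, sq]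
  · exact Eventually.of_forall fun x => mul_self_nonneg _

lemma eLpNorm_heatKernel {t : ℝ} (ht : 0 < t) :
    eLpNorm (heatKernel t) 2 volume = ENNReal.ofReal ((8 * Real.pi * t) ^ (-(3 / 4) : ℝ)) := by
  rw [← (ENNReal.pow_right_strictMono two_ne_zero).injective.eq_iff]
  rw [eLpNorm_two_sq, lintegral_heatKernel_sq ht, ← ENNReal.ofReal_pow (by positivity),
    ← Real.rpow_mul_natCast (by positivity)]
  norm_num

lemma integrable_heatKernel_smul_L1 {t : ℝ} (ht : 0 < t) {f : R3 → Mat3} (hf : Integrable f)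
    (x : R3) : Integrable fun y => heatKernel t (x - y) • f y := by
  refine hf.bdd_smul ((4 * Real.pi * t) ^ (-(3 / 2) : ℝ))
    ((continuous_heatKernel t).comp (continuous_const.sub continuous_id)).aestronglyMeasurable
    (Eventually.of_forall fun y => ?_)
  change ‖heatKernel t (x - y)‖ ≤ _
  rw [Real.norm_of_nonneg (heatKernel_nonneg ht _)]
  exact heatKernel_le ht _

lemma integrable_heatKernel_smul_L2 {t : ℝ} (ht : 0 < t) {f : R3 → Mat3} (hf : MemLp f 2 volume)
    (x : R3) : Integrable fun y => heatKernel t (x - y) • f y := by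
  have hk : MemLp (fun y => heatKernel t (x - y)) 2 volume :=
    (memLp_two_heatKernel ht).comp_measurePreserving (Measure.measurePreserving_sub_left volume x)
  rw [← memLp_one_iff_integrable]
  exact hf.smul hk

lemma memLp_heatFun_of_L1 {t : ℝ} (ht : 0 < t) {f : R3 → Mat3} (hf : Integrable f) :
    MemLp (heatFun t f) 2 volume :=
  ⟨aestronglyMeasurable_kconv (continuous_heatKernel t).aestronglyMeasurable hf.1,
    (eLpNorm_kconv_le_two_one (continuous_heatKernel t).aestronglyMeasurable hf.1).trans_lt
      (ENNReal.mul_lt_top (memLp_two_heatKernel ht).2 (memLp_one_iff_integrable.2 hf).2)⟩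

lemma memLp_heatFun_of_L2 {t : ℝ} (ht : 0 < t) {f : R3 → Mat3} (hf : MemLp f 2 volume) :
    MemLp (heatFun t f) 2 volume :=
  ⟨aestronglyMeasurable_kconv (continuous_heatKernel t).aestronglyMeasurable hf.1,
    (eLpNorm_kconv_le_one_two (continuous_heatKernel t).aestronglyMeasurable hf.1).trans_lt
      (ENNReal.mul_lt_top (memLp_one_iff_integrable.2 (integrable_heatKernel ht)).2 hf.2)⟩

lemma heat_of_memLp {t : ℝ} {f : R3 → Mat3} (h : MemLp (heatFun t f) 2 volume) :
    heat t f = h.toLp (heatFun t f) := dif_pos h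

/-- This also holds where `heat` takes its default value. -/
lemma heat_congr {t : ℝ} {f g : R3 → Mat3} (h : f =ᵐ[volume] g) : heat t f = heat t g := by
  have e : heatFun t f = heatFun t g := kconv_congr h
  by_cases hm : MemLp (heatFun t f) 2 volume
  · rw [heat_of_memLp hm, heat_of_memLp (e ▸ hm)]
    exact MemLp.toLp_congr _ _ (by rw [e])
  · have hm' : ¬ MemLp (heatFun t g) 2 volume := e ▸ hm
    simp only [heat, hm, hm', dif_neg, not_false_eq_true]

lemma heat_sub_L1 {t : ℝ} (ht : 0 < t) {f g : R3 → Mat3} (hf : Integrable f) (hg : Integrable g) :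
    heat t f - heat t g = heat t (f - g) := by
  rw [heat_of_memLp (memLp_heatFun_of_L1 ht hf), heat_of_memLp (memLp_heatFun_of_L1 ht hg),
    heat_of_memLp (memLp_heatFun_of_L1 ht (hf.sub hg)), ← MemLp.toLp_sub]
  congr 1
  funext x
  simp only [heatFun, Pi.sub_apply, smul_sub]
  rw [integral_sub (integrable_heatKernel_smul_L1 ht hf x) (integrable_heatKernel_smul_L1 ht hg x)]

lemma heat_sub_L2 {t : ℝ} (ht : 0 < t) {f g : R3 → Mat3} (hf : MemLp f 2 volume)
    (hg : MemLp g 2 volume) : heat t f - heat t g = heat t (f - g) := by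
  rw [heat_of_memLp (memLp_heatFun_of_L2 ht hf), heat_of_memLp (memLp_heatFun_of_L2 ht hg),
    heat_of_memLp (memLp_heatFun_of_L2 ht (hf.sub hg)), ← MemLp.toLp_sub]
  congr 1
  funext x
  simp only [heatFun, Pi.sub_apply, smul_sub]
  rw [integral_sub (integrable_heatKernel_smul_L2 ht hf x) (integrable_heatKernel_smul_L2 ht hg x)]

/-- The smoothing bound `‖e^{tΔ} f‖₂ ≤ (8πt)^{-3/4} ‖f‖₁`. -/
lemma norm_heat_le_L1 {t : ℝ} (ht : 0 < t) (f : Lp Mat3 1 (volume : Measure R3)) :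
    ‖heat t f‖ ≤ (8 * Real.pi * t) ^ (-(3 / 4) : ℝ) * ‖f‖ := by
  have hf : Integrable f := L1.integrable_coeFn f
  rw [heat_of_memLp (memLp_heatFun_of_L1 ht hf), Lp.norm_toLp, Lp.norm_def]
  refine ENNReal.toReal_le_of_le_ofReal (by positivity) ?_
  rw [ENNReal.ofReal_mul (by positivity), ENNReal.ofReal_toReal (Lp.eLpNorm_ne_top f),
    ← eLpNorm_heatKernel ht]
  exact eLpNorm_kconv_le_two_one (continuous_heatKernel t).aestronglyMeasurable hf.1

/-- A first bound on `L²`, with the constant left as the `L¹` norm of the kernel; it serves to pass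
to limits in the Fourier representation, which then gives the constant `1`. -/
lemma norm_heat_le_L2 {t : ℝ} (ht : 0 < t) (f : MatL2) :
    ‖heat t f‖ ≤ (eLpNorm (heatKernel t) 1 volume).toReal * ‖f‖ := by
  rw [heat_of_memLp (memLp_heatFun_of_L2 ht (Lp.memLp f)), Lp.norm_toLp, Lp.norm_def,
    ← ENNReal.toReal_mul]
  refine ENNReal.toReal_mono (ENNReal.mul_ne_top
    (memLp_one_iff_integrable.2 (integrable_heatKernel ht)).2.ne (Lp.eLpNorm_ne_top f)) ?_
  exact eLpNorm_kconv_le_one_two (continuous_heatKernel t).aestronglyMeasurable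
    (Lp.memLp f).1

lemma heat_sub_time {t s : ℝ} (ht : 0 < t) (hs : 0 < s) (f : Lp Mat3 1 (volume : Measure R3)) :
    ‖heat t f - heat s f‖ₑ ^ 2 ≤ ENNReal.ofReal
      ((4 * Real.pi * (t + t)) ^ (-(3 / 2) : ℝ) + (4 * Real.pi * (s + s)) ^ (-(3 / 2) : ℝ)
        - 2 * (4 * Real.pi * (t + s)) ^ (-(3 / 2) : ℝ)) * ‖f‖ₑ ^ 2 := by
  have hf : Integrable f := L1.integrable_coeFn f
  have e : heatFun t f - heatFun s f = kconv (heatKernel t - heatKernel s) f := by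
    funext x
    simp only [heatFun, kconv, Pi.sub_apply, sub_smul]
    rw [integral_sub (integrable_heatKernel_smul_L1 ht hf x)
      (integrable_heatKernel_smul_L1 hs hf x)]
  rw [heat_of_memLp (memLp_heatFun_of_L1 ht hf), heat_of_memLp (memLp_heatFun_of_L1 hs hf),
    ← MemLp.toLp_sub, Lp.enorm_toLp, Lp.enorm_def, ← lintegral_heatKernel_sub_sq ht hs,
    ← eLpNorm_two_sq, ← mul_pow, e]
  gcongr
  exact eLpNorm_kconv_le_two_one ((continuous_heatKernel t).sub
    (continuous_heatKernel s)).aestronglyMeasurable hf.1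

/-- Joint continuity of `(t, f) ↦ e^{tΔ} f` for `t > 0` and `f ∈ L¹`. -/
lemma tendsto_heat_L1 {ι : Type*} {l : Filter ι} {t : ι → ℝ} {s : ℝ} (hs : 0 < s)
    (ht : Tendsto t l (𝓝 s)) {f : ι → Lp Mat3 1 (volume : Measure R3)}
    {g : Lp Mat3 1 (volume : Measure R3)} (hf : Tendsto f l (𝓝 g)) :
    Tendsto (fun i => heat (t i) (f i)) l (𝓝 (heat s g)) := by
  have hpos : ∀ᶠ i in l, 0 < t i := ht.eventually (lt_mem_nhds hs)
  have h1 : Tendsto (fun i => heat (t i) g) l (𝓝 (heat s g)) := by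
    rw [tendsto_iff_edist_tendsto_0]
    have hlim : Tendsto (fun i => ENNReal.ofReal
        ((4 * Real.pi * (t i + t i)) ^ (-(3 / 2) : ℝ) + (4 * Real.pi * (s + s)) ^ (-(3 / 2) : ℝ)
        - 2 * (4 * Real.pi * (t i + s)) ^ (-(3 / 2) : ℝ)) * ‖g‖ₑ ^ 2) l (𝓝 0) := by
      have hc : ContinuousAt (fun u : ℝ => (4 * Real.pi * (u + u)) ^ (-(3 / 2) : ℝ) +
          (4 * Real.pi * (s + s)) ^ (-(3 / 2) : ℝ)
          - 2 * (4 * Real.pi * (u + s)) ^ (-(3 / 2) : ℝ)) s := by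
        have h2 : (4 * Real.pi * (s + s)) ≠ 0 := by positivity
        refine ContinuousAt.sub (ContinuousAt.add (ContinuousAt.rpow_const (by fun_prop)
          (Or.inl h2)) continuousAt_const) (ContinuousAt.mul continuousAt_const
          (ContinuousAt.rpow_const (by fun_prop) (Or.inl h2)))
      have h3 := (ENNReal.tendsto_ofReal (hc.tendsto.comp ht))
      have h4 := ENNReal.Tendsto.mul_const (b := ‖g‖ₑ ^ 2) h3 (Or.inr (by finiteness))
      refine h4.trans_eq ?_
      rw [show (4 * Real.pi * (s + s)) ^ (-(3 / 2) : ℝ) + (4 * Real.pi * (s + s)) ^ (-(3 / 2) : ℝ)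
          - 2 * (4 * Real.pi * (s + s)) ^ (-(3 / 2) : ℝ) = 0 by ring]
      simp
    have hsq : Tendsto (fun i => edist (heat (t i) g) (heat s g) ^ 2) l (𝓝 0) := by
      refine tendsto_of_tendsto_of_tendsto_of_le_of_le' tendsto_const_nhds hlim
        (Eventually.of_forall fun _ => bot_le) ?_
      filter_upwards [hpos] with i hi
      rw [edist_eq_enorm_sub]
      exact heat_sub_time hi hs g
    have := (ENNReal.continuous_rpow_const (y := (1 / 2 : ℝ))).tendsto 0 |>.comp hsq
    simp only [Function.comp_def] at this
    refine (this.congr fun i => ?_).trans_eq (by norm_num)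
    rw [← ENNReal.rpow_natCast, ← ENNReal.rpow_mul]
    norm_num
  have h2 : Tendsto (fun i => heat (t i) (f i) - heat (t i) g) l (𝓝 0) := by
    have hb : Tendsto (fun i => (8 * Real.pi * t i) ^ (-(3 / 4) : ℝ) * ‖f i - g‖) l
        (𝓝 ((8 * Real.pi * s) ^ (-(3 / 4) : ℝ) * ‖g - g‖)) := by
      refine Tendsto.mul ?_ (hf.sub_const g).norm
      exact (ht.const_mul _).rpow_const (Or.inl (by positivity))
    rw [sub_self, norm_zero, mul_zero] at hb
    refine squeeze_zero_norm' ?_ hb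
    filter_upwards [hpos] with i hi
    rw [heat_sub_L1 hi (L1.integrable_coeFn _) (L1.integrable_coeFn _),
      ← heat_congr (Lp.coeFn_sub (f i) g)]
    exact norm_heat_le_L1 hi _
  simpa using h2.add h1

/-! ### Multiplication by bounded functions on the frequency side -/

/-- Square-integrable complex matrix fields in the frequency variable. -/
abbrev FreqL2 : Type := Lp CMat3 2 (volume : Measure R3)

/-- Bounded continuous functions as elements of `L^∞`. -/
def bcfToLp : (R3 →ᵇ ℝ) →L[ℝ] Lp ℝ ∞ (volume : Measure R3) :=
  LinearMap.mkContinuous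
    { toFun := fun φ => φ.memLp_top.toLp φ
      map_add' := fun φ ψ => by rw [← MemLp.toLp_add]; rfl
      map_smul' := fun c φ => by
        rw [RingHom.id_apply, ← MemLp.toLp_const_smul]
        rfl } 1 fun φ => by
    simp only [LinearMap.coe_mk, AddHom.coe_mk, one_mul]
    rw [Lp.norm_toLp]
    refine ENNReal.toReal_le_of_le_ofReal (norm_nonneg _) ?_
    rw [eLpNorm_exponent_top]
    refine eLpNormEssSup_le_of_ae_bound (Eventually.of_forall fun x => φ.norm_coe_le_norm x)

/-- Multiplication of square-integrable fields by a bounded continuous real function, as a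
continuous bilinear map. -/
def mulOp : (R3 →ᵇ ℝ) →L[ℝ] FreqL2 →L[ℝ] FreqL2 :=
  ((ContinuousLinearMap.lsmul ℝ ℝ : ℝ →L[ℝ] CMat3 →L[ℝ] CMat3).holderL volume ∞ 2 2).comp bcfToLp

lemma coeFn_mulOp (φ : R3 →ᵇ ℝ) (y : FreqL2) : mulOp φ y =ᵐ[volume] fun ξ => φ ξ • y ξ := by
  have h1 := ContinuousLinearMap.coeFn_holder (r := 2)
    (ContinuousLinearMap.lsmul ℝ ℝ : ℝ →L[ℝ] CMat3 →L[ℝ] CMat3) (bcfToLp φ) y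
  have h2 : bcfToLp φ =ᵐ[volume] φ := MemLp.coeFn_toLp φ.memLp_top
  filter_upwards [h1, h2] with ξ e1 e2
  exact e1.trans (by rw [e2]; rfl)

lemma mulOp_mul (φ ψ : R3 →ᵇ ℝ) (y : FreqL2) : mulOp (φ * ψ) y = mulOp φ (mulOp ψ y) := by
  apply Lp.ext
  filter_upwards [coeFn_mulOp (φ * ψ) y, coeFn_mulOp φ (mulOp ψ y), coeFn_mulOp ψ y]
    with ξ h1 h2 h3
  rw [h1, h2, h3, BoundedContinuousFunction.mul_apply, mul_smul]

lemma mulOp_one (y : FreqL2) : mulOp 1 y = y := by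
  apply Lp.ext
  filter_upwards [coeFn_mulOp 1 y] with ξ h1
  rw [h1]; simp

lemma inner_mulOp (φ : R3 →ᵇ ℝ) (x y : FreqL2) :
    inner ℂ (mulOp φ x) y = inner ℂ x (mulOp φ y) := by
  rw [L2.inner_def, L2.inner_def]
  refine integral_congr_ae ?_
  filter_upwards [coeFn_mulOp φ x, coeFn_mulOp φ y] with ξ h1 h2
  rw [h1, h2, ← Complex.coe_smul, ← Complex.coe_smul, inner_smul_left, inner_smul_right]
  simp

lemma re_inner_mulOp_self (φ : R3 →ᵇ ℝ) (x : FreqL2) :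
    (inner ℂ (mulOp φ x) x).re = ∫ ξ, φ ξ * ‖x ξ‖ ^ 2 := by
  rw [L2.inner_def]
  have hi := L2.integrable_inner (𝕜 := ℂ) (mulOp φ x) x
  rw [← RCLike.re_eq_complex_re, ← integral_re hi]
  refine integral_congr_ae ?_
  filter_upwards [coeFn_mulOp φ x] with ξ h1
  rw [h1, ← Complex.coe_smul, inner_smul_left]
  simp [← Complex.ofReal_pow]

lemma norm_mulOp_le {φ : R3 →ᵇ ℝ} {c : ℝ} (h : ∀ ξ, |φ ξ| ≤ c) (y : FreqL2) :
    ‖mulOp φ y‖ ≤ c * ‖y‖ := by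
  refine Lp.norm_le_mul_norm_of_ae_le_mul ?_
  filter_upwards [coeFn_mulOp φ y] with ξ h1
  rw [h1, norm_smul]
  exact mul_le_mul_of_nonneg_right (h ξ) (norm_nonneg _)

/-! ### The Fourier transform of real square-integrable fields -/

lemma norm_complexify (A : Mat3) : ‖complexify A‖ = ‖A‖ := by
  rw [EuclideanSpace.norm_eq, EuclideanSpace.norm_eq]
  simp [complexify]

lemma norm_ftL2 (S : MatL2) : ‖ftL2 S‖ = ‖S‖ := by
  change ‖Lp.fourierTransformₗᵢ R3 CMat3 (complexify.compLpL 2 volume S)‖ = _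
  rw [LinearIsometryEquiv.norm_map, Lp.norm_def, Lp.norm_def]
  congr 1
  refine eLpNorm_congr_norm_ae ?_
  filter_upwards [complexify.coeFn_compLpL (p := 2) (μ := volume) S] with x hx
  rw [hx, norm_complexify]

lemma ftL2_injective : Function.Injective ftL2 := by
  refine (injective_iff_map_eq_zero ftL2).2 fun S h => ?_
  rw [← norm_eq_zero, ← norm_ftL2, h, norm_zero]

/-- Plancherel's identity for inner products. -/
lemma re_inner_ftL2 (S U : MatL2) : (inner ℂ (ftL2 S) (ftL2 U)).re = inner ℝ S U := by
  have h := re_inner_eq_norm_add_mul_self_sub_norm_sub_mul_self_div_four (𝕜 := ℂ)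
    (ftL2 S) (ftL2 U)
  rw [RCLike.re_eq_complex_re] at h
  have h' := re_inner_eq_norm_add_mul_self_sub_norm_sub_mul_self_div_four (𝕜 := ℝ) S U
  rw [RCLike.re_to_real] at h'
  rw [h, h', ← map_add, ← map_sub, norm_ftL2, norm_ftL2]

/-- On functions that are both integrable and square integrable, the Fourier transform on `L²` is
given by the Fourier integral. -/
lemma fourier_toLp_eq {u : R3 → CMat3} (h1 : Integrable u) (h2 : MemLp u 2 volume)
    (hF : MemLp (𝓕 u) 2 volume) : 𝓕 (h2.toLp u) = hF.toLp (𝓕 u) := by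
  have hinj : Function.Injective (Lp.toTemperedDistributionCLM CMat3 (volume : Measure R3) 2) :=
    LinearMap.ker_eq_bot.1 Lp.ker_toTemperedDistributionCLM_eq_bot
  apply hinj
  rw [Lp.toTemperedDistributionCLM_apply, Lp.toTemperedDistributionCLM_apply,
    ← Lp.fourier_toTemperedDistribution_eq]
  ext g : 1
  rw [TemperedDistribution.fourier_apply, Lp.toTemperedDistribution_apply,
    Lp.toTemperedDistribution_apply]
  have e1 : ∫ x, (𝓕 g) x • (h2.toLp u) x = ∫ x, (𝓕 g) x • u x := by
    refine integral_congr_ae ?_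
    filter_upwards [h2.coeFn_toLp] with x hx
    rw [hx]
  have e2 : ∫ x, g x • (hF.toLp (𝓕 u)) x = ∫ x, g x • (𝓕 u) x := by
    refine integral_congr_ae ?_
    filter_upwards [hF.coeFn_toLp] with x hx
    rw [hx]
  rw [e1, e2]
  have := VectorFourier.integral_fourierIntegral_smul_eq_flip (L := innerₗ R3) (μ := volume)
    (ν := volume) Real.continuous_fourierChar continuous_inner g.integrable h1
  simpa using! this

lemma ftL2_toLp {f : R3 → Mat3} (h1 : Integrable f) (h2 : MemLp f 2 volume)
    (hF : MemLp (𝓕 fun x => complexify (f x)) 2 volume) :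
    ftL2 (h2.toLp f) = hF.toLp _ := by
  change 𝓕 (complexify.compLpL 2 volume (h2.toLp f)) = _
  have h2' : MemLp (fun x => complexify (f x)) 2 volume := complexify.comp_memLp' h2
  rw [← fourier_toLp_eq (complexify.integrable_comp h1) h2' hF]
  congr 1

/-! ### The heat semigroup on the frequency side -/

/-- The symbol `(2π|ξ|)²` of `-Δ`. -/
def freqSq (ξ : R3) : ℝ := (2 * Real.pi * ‖ξ‖) ^ 2

lemma freqSq_nonneg (ξ : R3) : 0 ≤ freqSq ξ := sq_nonneg _

lemma continuous_freqSq : Continuous freqSq := by unfold freqSq; fun_prop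

/-- The symbol `e^{-t(2π|ξ|)²}` of the heat semigroup; negative times are replaced by `0`. -/
def heatSymbol (t : ℝ) : R3 →ᵇ ℝ :=
  BoundedContinuousFunction.ofNormedAddCommGroup (fun ξ => Real.exp (-(max t 0 * freqSq ξ)))
    (by have := continuous_freqSq; fun_prop) 1 fun ξ => by
      rw [Real.norm_of_nonneg (Real.exp_pos _).le, Real.exp_le_one_iff, neg_nonpos]
      exact mul_nonneg (le_max_right _ _) (freqSq_nonneg ξ)

lemma heatSymbol_apply {t : ℝ} (ht : 0 ≤ t) (ξ : R3) :
    heatSymbol t ξ = Real.exp (-(t * freqSq ξ)) := by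
  change Real.exp (-(max t 0 * freqSq ξ)) = _
  rw [max_eq_left ht]

lemma fourier_heatKernel {t : ℝ} (ht : 0 < t) (ξ : R3) :
    𝓕 (fun x : R3 => (heatKernel t x : ℂ)) ξ = (heatSymbol t ξ : ℂ) := by
  have hb : 0 < ((1 / (4 * t) : ℝ) : ℂ).re := by rw [Complex.ofReal_re]; positivity
  have e : (fun x : R3 => (heatKernel t x : ℂ)) = ((4 * Real.pi * t) ^ (-(3 / 2) : ℝ) : ℝ) •
      fun v : R3 => Complex.exp (-((1 / (4 * t) : ℝ) : ℂ) * ‖v‖ ^ 2) := by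
    funext x
    simp only [heatKernel, Pi.smul_apply, Complex.real_smul, Complex.ofReal_mul, Complex.ofReal_exp]
    congr 2
    push_cast
    ring
  have hc : 𝓕 (((4 * Real.pi * t) ^ (-(3 / 2) : ℝ) : ℝ) •
      fun v : R3 => Complex.exp (-((1 / (4 * t) : ℝ) : ℂ) * ‖v‖ ^ 2)) ξ =
      ((4 * Real.pi * t) ^ (-(3 / 2) : ℝ) : ℝ) •
      𝓕 (fun v : R3 => Complex.exp (-((1 / (4 * t) : ℝ) : ℂ) * ‖v‖ ^ 2)) ξ := by
    simp only [Real.fourier_eq', Pi.smul_apply]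
    rw [← integral_smul]
    congr 1
    funext v
    rw [smul_comm]
  rw [e, hc, fourier_gaussian_innerProductSpace hb, heatSymbol_apply ht.le]
  have e2 : ((Real.pi : ℂ) / ((1 / (4 * t) : ℝ) : ℂ)) ^ ((Module.finrank ℝ R3 : ℂ) / 2)
      = (((4 * Real.pi * t) ^ (3 / 2 : ℝ) : ℝ) : ℂ) := by
    rw [Complex.ofReal_cpow (by positivity)]
    simp only [finrank_euclideanSpace, Fintype.card_fin]
    congr 1
    · push_cast; field_simp
    · push_cast; ring
  rw [e2, Complex.real_smul, ← mul_assoc, ← Complex.ofReal_mul, ← Real.rpow_add (by positivity)]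
  simp only [neg_add_cancel, Real.rpow_zero, Complex.ofReal_one, one_mul, Complex.ofReal_exp]
  congr 1
  have : (t : ℂ) ≠ 0 := by exact_mod_cast ht.ne'
  simp only [freqSq]
  push_cast
  field_simp
  ring

/-- The Fourier transform turns the heat semigroup into multiplication by its symbol. -/
lemma ftL2_heat {t : ℝ} (ht : 0 < t) (S : MatL2) :
    ftL2 (heat t S) = mulOp (heatSymbol t) (ftL2 S) := by
  have hcont : Continuous fun S : MatL2 => heat t S := by
    refine (LipschitzWith.of_dist_le_mul
      (K := (eLpNorm (heatKernel t) 1 volume).toNNReal) fun S U => ?_).continuous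
    rw [dist_eq_norm, dist_eq_norm, heat_sub_L2 ht (Lp.memLp S) (Lp.memLp U),
      ← heat_congr (Lp.coeFn_sub S U)]
    exact norm_heat_le_L2 ht _
  -- Both sides are continuous in `S`; on Schwartz functions the convolution theorem applies.
  refine DenseRange.induction_on (p := fun S => ftL2 (heat t S) = mulOp (heatSymbol t) (ftL2 S))
    (SchwartzMap.denseRange_toLpCLM (F := Mat3) (p := 2) (μ := (volume : Measure R3))
      ENNReal.ofNat_ne_top) S
    (isClosed_eq (ftL2.continuous.comp hcont) ((mulOp (heatSymbol t)).continuous.comp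
      ftL2.continuous)) fun f => ?_
  rw [SchwartzMap.toLpCLM_apply]
  have hfi : Integrable f := f.integrable
  have hf2 : MemLp f 2 volume := f.memLp 2 volume
  have e0 : heat t (f.toLp 2) = heat t f := heat_congr (f.coeFn_toLp 2 volume)
  have hk : Integrable fun x : R3 => (heatKernel t x : ℂ) := (integrable_heatKernel ht).ofReal
  have hcf : Integrable fun x => complexify (f x) := complexify.integrable_comp hfi
  have econv : (fun x => complexify (heatFun t f x)) =
      convolution (fun x => complexify (f x)) (fun x : R3 => (heatKernel t x : ℂ))
        (ContinuousLinearMap.lsmul ℂ ℂ : ℂ →L[ℂ] CMat3 →L[ℂ] CMat3).flip volume := by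
    funext x
    simp only [heatFun, convolution]
    rw [← complexify.integral_comp_comm (integrable_heatKernel_smul_L1 ht hfi x)]
    congr 1
    funext y
    rw [map_smul]
    simp [Complex.coe_smul]
  have eF : 𝓕 (fun x => complexify (heatFun t f x)) =
      fun ξ => heatSymbol t ξ • 𝓕 (fun x => complexify (f x)) ξ := by
    rw [econv]
    funext ξ
    rw [Real.fourier_bilin_convolution_eq _ hcf hk, fourier_heatKernel ht]
    simp [Complex.coe_smul]
  have hint : Integrable (heatFun t f) := by
    have := (integrable_heatKernel ht).integrable_convolution
      (ContinuousLinearMap.lsmul ℝ ℝ : ℝ →L[ℝ] Mat3 →L[ℝ] Mat3) hfi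
    rw [← convolution_flip] at this
    exact this
  have hFf : MemLp (𝓕 fun x => complexify (f x)) 2 volume := by
    have : (𝓕 fun x => complexify (f x)) = 𝓕 (f.postcompCLM complexify) := by
      rw [SchwartzMap.fourier_coe]; rfl
    rw [this]
    exact (𝓕 (f.postcompCLM complexify)).memLp 2 volume
  have hFh : MemLp (𝓕 fun x => complexify (heatFun t f x)) 2 volume := by
    rw [eF]
    exact hFf.smul (r := 2) (heatSymbol t).memLp_top
  have e1 : ftL2 (f.toLp 2) = hFf.toLp _ := ftL2_toLp hfi hf2 hFf
  rw [e0, heat_of_memLp (memLp_heatFun_of_L1 ht hfi), ftL2_toLp hint _ hFh, e1]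
  apply Lp.ext
  filter_upwards [coeFn_mulOp (heatSymbol t) (hFf.toLp _), hFf.coeFn_toLp, hFh.coeFn_toLp]
    with ξ h1 h2 h3
  rw [h1, h2, h3, eF]

/-! ### The heat semigroup and the constraint space -/

lemma coeFn_heat_L2 {t : ℝ} (ht : 0 < t) (S : MatL2) : heat t S =ᵐ[volume] heatFun t S := by
  rw [heat_of_memLp (memLp_heatFun_of_L2 ht (Lp.memLp S))]
  exact MemLp.coeFn_toLp _

/-- The heat flow preserves pointwise linear constraints, such as symmetry and zero trace. -/
lemma clm_heatFun_eq_zero {t : ℝ} (ht : 0 < t) (S : MatL2) (ℓ : Mat3 →L[ℝ] ℝ)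
    (h : ∀ᵐ x, ℓ (S x) = 0) (x : R3) : ℓ (heatFun t S x) = 0 := by
  rw [heatFun, ← ℓ.integral_comp_comm (integrable_heatKernel_smul_L2 ht (Lp.memLp S) x)]
  rw [integral_eq_zero_of_ae]
  filter_upwards [h] with y hy
  rw [map_smul, hy, smul_zero, Pi.zero_apply]

lemma heat_mem_L2st {t : ℝ} (ht : 0 < t) {S : MatL2} (hS : S ∈ L2st) : heat t S ∈ L2st := by
  obtain ⟨h1, h2, h3⟩ := hS
  refine ⟨?_, ?_, ?_⟩
  · filter_upwards [coeFn_heat_L2 ht S] with x hx i j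
    rw [hx, ← sub_eq_zero]
    refine clm_heatFun_eq_zero ht S
      (EuclideanSpace.proj (𝕜 := ℝ) (i, j) - EuclideanSpace.proj (𝕜 := ℝ) (j, i)) ?_ x
    filter_upwards [h1] with y hy
    simp [hy i j]
  · filter_upwards [coeFn_heat_L2 ht S] with x hx
    rw [hx]
    have := clm_heatFun_eq_zero ht S
      (∑ i : Fin 3, EuclideanSpace.proj (𝕜 := ℝ) ((i, i) : Fin 3 × Fin 3)) ?_ x
    · simpa using this
    · filter_upwards [h2] with y hy
      simpa using hy
  · rw [ftL2_heat ht]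
    filter_upwards [h3, coeFn_mulOp (heatSymbol t) (ftL2 S)] with ξ hξ e i j
    rw [e]
    simp only [PiLp.smul_apply]
    rw [hξ i j, Complex.real_smul, ← mul_div_assoc, Finset.mul_sum]
    congr 1
    refine Finset.sum_congr rfl fun k _ => ?_
    simp only [Complex.real_smul]
    ring

lemma inner_heat_comm {t : ℝ} (ht : 0 < t) (S U : MatL2) :
    inner ℝ (heat t S) U = inner ℝ S (heat t U) := by
  rw [← re_inner_ftL2, ← re_inner_ftL2, ftL2_heat ht, ftL2_heat ht, inner_mulOp]

/-- The heat semigroup is self-adjoint and preserves the constraint space, so it commutes with the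
projection onto it. -/
lemma Pst_heat {t : ℝ} (ht : 0 < t) (S : MatL2) : Pst (heat t S) = heat t (Pst S) := by
  refine Submodule.eq_starProjection_of_mem_of_inner_eq_zero
    (heat_mem_L2st ht (Submodule.starProjection_apply_mem _ _)) fun w hw => ?_
  rw [heat_sub_L2 ht (Lp.memLp S) (Lp.memLp (Pst S)), ← heat_congr (Lp.coeFn_sub S (Pst S)),
    inner_heat_comm ht]
  exact Submodule.starProjection_inner_eq_zero _ _ (heat_mem_L2st ht hw)

lemma abs_exp_sub_exp_le {t s a : ℝ} (hs : 0 < s) (hst : s ≤ t) (ha : 0 ≤ a) :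
    |Real.exp (-(t * a)) - Real.exp (-(s * a))| ≤ (t - s) / s := by
  have h1 : Real.exp (-(t * a)) = Real.exp (-(s * a)) * Real.exp (-((t - s) * a)) := by
    rw [← Real.exp_add]; ring_nf
  have h2 : 1 - (t - s) * a ≤ Real.exp (-((t - s) * a)) := by
    have := Real.add_one_le_exp (-((t - s) * a)); linarith
  have h3 : Real.exp (-((t - s) * a)) ≤ 1 :=
    Real.exp_le_one_iff.2 (neg_nonpos.2 (mul_nonneg (by linarith) ha))
  have h4 : s * a * Real.exp (-(s * a)) ≤ 1 := by
    have := Real.add_one_le_exp (s * a)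
    rw [Real.exp_neg]
    rw [mul_inv_le_iff₀ (Real.exp_pos _)]
    linarith
  have h5 := (Real.exp_pos (-(s * a))).le
  rw [h1, abs_of_nonpos (by nlinarith), le_div_iff₀ hs]
  have : -(Real.exp (-(s * a)) * Real.exp (-((t - s) * a)) - Real.exp (-(s * a))) ≤
    Real.exp (-(s * a)) * ((t - s) * a) := by nlinarith
  calc _ ≤ Real.exp (-(s * a)) * ((t - s) * a) * s := by gcongr
    _ = (t - s) * (s * a * Real.exp (-(s * a))) := by ring
    _ ≤ (t - s) * 1 := by gcongr
    _ = t - s := mul_one _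

lemma norm_heat_sub_heat_le {t s : ℝ} (hs : 0 < s) (hst : s ≤ t) (S : MatL2) :
    ‖heat t S - heat s S‖ ≤ (t - s) / s * ‖S‖ := by
  have ht := hs.trans_le hst
  rw [← norm_ftL2, map_sub, ftL2_heat ht, ftL2_heat hs, ← sub_apply, ← map_sub,
    ← norm_ftL2 S]
  refine norm_mulOp_le (fun ξ => ?_) _
  rw [BoundedContinuousFunction.sub_apply, heatSymbol_apply ht.le, heatSymbol_apply hs.le]
  exact abs_exp_sub_exp_le hs hst (freqSq_nonneg ξ)

lemma continuousAt_heat_L2 {s : ℝ} (hs : 0 < s) (S : MatL2) :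
    ContinuousAt (fun t => heat t S) s := by
  rw [ContinuousAt, tendsto_iff_norm_sub_tendsto_zero]
  have hlim : Tendsto (fun t => |t - s| / (min t s) * ‖S‖) (𝓝 s) (𝓝 0) := by
    have : ContinuousAt (fun t => |t - s| / (min t s) * ‖S‖) s := by
      refine ContinuousAt.mul (ContinuousAt.div (by fun_prop) (by fun_prop) ?_) (by fun_prop)
      simp [hs.ne']
    simpa using this.tendsto
  refine squeeze_zero' (Eventually.of_forall fun _ => norm_nonneg _) ?_ hlim
  filter_upwards [lt_mem_nhds hs] with t ht
  rcases le_total s t with h | h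
  · rw [abs_of_nonneg (by linarith), min_eq_right h]
    exact norm_heat_sub_heat_le hs h S
  · rw [abs_of_nonpos (by linarith), min_eq_left h, norm_sub_rev, neg_sub]
    exact norm_heat_sub_heat_le ht h S

/-! ### Frequency truncation of Duhamel's formula -/

/-- A continuous cutoff to the frequencies with `(2π|ξ|)² ≤ n + 1`. -/
def cutoff (n : ℕ) : R3 →ᵇ ℝ :=
  BoundedContinuousFunction.ofNormedAddCommGroup (fun ξ => max 0 (1 - freqSq ξ / (n + 1)))
    (by have := continuous_freqSq; fun_prop) 1 fun ξ => by
      have : 0 ≤ freqSq ξ / (n + 1) := div_nonneg (freqSq_nonneg ξ) (by positivity)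
      rw [Real.norm_of_nonneg (le_max_left _ _)]
      exact max_le zero_le_one (by linarith)

lemma cutoff_apply (n : ℕ) (ξ : R3) : cutoff n ξ = max 0 (1 - freqSq ξ / (n + 1)) := rfl

lemma cutoff_nonneg (n : ℕ) (ξ : R3) : 0 ≤ cutoff n ξ := le_max_left _ _

lemma cutoff_le_one (n : ℕ) (ξ : R3) : cutoff n ξ ≤ 1 := by
  have : 0 ≤ freqSq ξ / (n + 1) := div_nonneg (freqSq_nonneg ξ) (by positivity)
  rw [cutoff_apply]
  exact max_le zero_le_one (by linarith)

lemma tendsto_cutoff (ξ : R3) : Tendsto (fun n => cutoff n ξ) atTop (𝓝 1) := by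
  have h : Tendsto (fun n : ℕ => max 0 (1 - freqSq ξ / ((n : ℝ) + 1))) atTop
      (𝓝 (max 0 (1 - 0))) := by
    refine tendsto_const_nhds.max (tendsto_const_nhds.sub ?_)
    exact tendsto_const_nhds.div_atTop
      (tendsto_atTop_add_const_right _ _ tendsto_natCast_atTop_atTop)
  rw [sub_zero, max_eq_right zero_le_one] at h
  exact h

/-- The symbol of `-Δ`, truncated at the height `n + 1`. -/
def truncSq (n : ℕ) : R3 →ᵇ ℝ :=
  BoundedContinuousFunction.ofNormedAddCommGroup (fun ξ => min (freqSq ξ) (n + 1))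
    (by have := continuous_freqSq; fun_prop) (n + 1) fun ξ => by
      rw [Real.norm_of_nonneg (le_min (freqSq_nonneg ξ) (by positivity))]
      exact min_le_right _ _

lemma truncSq_apply (n : ℕ) (ξ : R3) : truncSq n ξ = min (freqSq ξ) (n + 1) := rfl

/-- The cutoff vanishes where the truncated symbol differs from `(2π|ξ|)²`. -/
lemma cutoff_mul_truncSq (n : ℕ) (ξ : R3) : cutoff n ξ * truncSq n ξ = cutoff n ξ * freqSq ξ := by
  rw [truncSq_apply]
  rcases le_total (freqSq ξ) (n + 1) with h | h
  · rw [min_eq_left h]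
  · have : cutoff n ξ = 0 := by
      rw [cutoff_apply, max_eq_left]
      rw [sub_nonpos, le_div_iff₀ (by positivity)]
      linarith
    simp [this]

/-- The symbol `e^{-tb}` of the semigroup generated by the truncated Laplacian, for all real `t`. -/
def truncExp (n : ℕ) (t : ℝ) : R3 →ᵇ ℝ := NormedSpace.exp (t • (-truncSq n))

lemma bcf_exp_apply (φ : R3 →ᵇ ℝ) (ξ : R3) : NormedSpace.exp φ ξ = Real.exp (φ ξ) := by
  let ev : (R3 →ᵇ ℝ) →+* ℝ :=
    { toFun := fun φ => φ ξ
      map_one' := rfl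
      map_mul' := fun _ _ => rfl
      map_zero' := rfl
      map_add' := fun _ _ => rfl }
  have hev : Continuous ev := continuous_eval_const ξ
  have := NormedSpace.map_exp ev hev φ
  rw [Real.exp_eq_exp_ℝ]
  exact this

lemma truncExp_apply (n : ℕ) (t : ℝ) (ξ : R3) :
    truncExp n t ξ = Real.exp (-(t * truncSq n ξ)) := by
  rw [truncExp, bcf_exp_apply]
  simp

/-- On truncated fields the heat semigroup agrees with a uniformly continuous group, which makes
sense for negative times too. -/
lemma cutoff_mul_heatSymbol (n : ℕ) {t : ℝ} (ht : 0 ≤ t) :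
    cutoff n * heatSymbol t = truncExp n t * cutoff n := by
  ext ξ
  rw [BoundedContinuousFunction.mul_apply, BoundedContinuousFunction.mul_apply,
    heatSymbol_apply ht, truncExp_apply]
  rcases eq_or_ne (cutoff n ξ) 0 with h | h
  · simp [h]
  · rw [mul_left_cancel₀ h (cutoff_mul_truncSq n ξ), mul_comm]

lemma truncExp_add (n : ℕ) (s t : ℝ) : truncExp n (s + t) = truncExp n s * truncExp n t := by
  ext ξ
  rw [BoundedContinuousFunction.mul_apply, truncExp_apply, truncExp_apply, truncExp_apply,
    ← Real.exp_add]
  congr 1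
  ring

lemma truncExp_zero (n : ℕ) : truncExp n 0 = 1 := by
  ext ξ; simp [truncExp_apply]

lemma hasDerivAt_truncExp (n : ℕ) (t : ℝ) :
    HasDerivAt (truncExp n) (truncExp n t * (-truncSq n)) t :=
  hasDerivAt_exp_smul_const (𝕂 := ℝ) (-truncSq n) t

lemma continuous_truncExp (n : ℕ) : Continuous (truncExp n) :=
  continuous_iff_continuousAt.2 fun t => (hasDerivAt_truncExp n t).continuousAt

/-- After truncation to bounded frequencies, a solution of Duhamel's formula is differentiable in
time and solves a linear ordinary differential equation. -/
lemma exists_truncated_ode {t₁ : ℝ} (ht₁ : 0 ≤ t₁) {x f : ℝ → FreqL2}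
    (hf : ContinuousOn f (Set.Icc 0 t₁))
    (hint : ∀ t ∈ Set.Ioc 0 t₁,
      IntervalIntegrable (fun τ => mulOp (heatSymbol τ) (f (t - τ))) volume 0 t)
    (hx : ∀ t ∈ Set.Ioc 0 t₁, x t = mulOp (heatSymbol t) (x 0) +
      ∫ τ in (0 : ℝ)..t, mulOp (heatSymbol τ) (f (t - τ))) (n : ℕ) :
    ∃ y : ℝ → FreqL2, (∀ t ∈ Set.Icc 0 t₁, y t = mulOp (cutoff n) (x t)) ∧
      ∀ t ∈ Set.Icc 0 t₁,
        HasDerivAt y (-(mulOp (truncSq n) (y t)) + mulOp (cutoff n) (f t)) t := by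
  set g : ℝ → FreqL2 := fun t => f (Set.projIcc 0 t₁ ht₁ t) with hg
  have hgc : Continuous g :=
    hf.comp_continuous (continuous_subtype_val.comp continuous_projIcc) fun t => Subtype.mem _
  have hgf : ∀ t ∈ Set.Icc 0 t₁, g t = f t := fun t ht => by
    simp only [hg, Set.projIcc_of_mem ht₁ ht]
  have hEc : Continuous fun t => mulOp (truncExp n t) :=
    mulOp.continuous.comp (continuous_truncExp n)
  have hc : Continuous fun s => mulOp (truncExp n (-s)) (mulOp (cutoff n) (g s)) :=
    (hEc.comp continuous_neg).clm_apply ((mulOp (cutoff n)).continuous.comp hgc)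
  -- `y(t) = e^{-tb} z(t)` is the variation of constants, with the group inverted inside `z`.
  set z : ℝ → FreqL2 := fun t => mulOp (cutoff n) (x 0) +
    ∫ s in (0 : ℝ)..t, mulOp (truncExp n (-s)) (mulOp (cutoff n) (g s)) with hz
  have hzd : ∀ t, HasDerivAt z (mulOp (truncExp n (-t)) (mulOp (cutoff n) (g t))) t := fun t =>
    (hc.integral_hasStrictDerivAt 0 t).hasDerivAt.const_add _
  refine ⟨fun t => mulOp (truncExp n t) (z t), fun t ht => ?_, fun t ht => ?_⟩
  · rcases ht.1.eq_or_lt with h0 | h0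
    · subst h0
      simp [hz, truncExp_zero, mulOp_one]
    · rw [hx t ⟨h0, ht.2⟩, map_add, ← mulOp_mul, cutoff_mul_heatSymbol n ht.1, mulOp_mul]
      simp only [hz, map_add]
      congr 1
      rw [← ContinuousLinearMap.intervalIntegral_comp_comm _ (hint t ⟨h0, ht.2⟩),
        ← ContinuousLinearMap.intervalIntegral_comp_comm _ (hc.intervalIntegrable 0 t)]
      have e1 : ∀ s, mulOp (truncExp n t) (mulOp (truncExp n (-s)) (mulOp (cutoff n) (g s))) =
          mulOp (truncExp n (t - s)) (mulOp (cutoff n) (g (t - (t - s)))) := fun s => by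
        rw [← mulOp_mul, ← truncExp_add, sub_sub_cancel, sub_eq_add_neg]
      simp_rw [e1]
      rw [intervalIntegral.integral_comp_sub_left
        (fun τ => mulOp (truncExp n τ) (mulOp (cutoff n) (g (t - τ)))) t, sub_self, sub_zero]
      refine intervalIntegral.integral_congr fun τ hτ => ?_
      rw [Set.uIcc_of_le h0.le] at hτ
      rw [← mulOp_mul, ← mulOp_mul, cutoff_mul_heatSymbol n hτ.1,
        hgf _ ⟨by linarith [hτ.2], by linarith [hτ.1, ht.2]⟩]
  · have h0 : HasDerivAt (fun t => mulOp (truncExp n t))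
        (mulOp (truncExp n t * (-truncSq n))) t :=
      mulOp.hasFDerivAt.comp_hasDerivAt t (hasDerivAt_truncExp n t)
    refine (h0.clm_apply (hzd t)).congr_deriv ?_
    have e : truncExp n t * -truncSq n = -(truncExp n t * truncSq n) := by ext ξ; simp
    beta_reduce
    rw [← mulOp_mul, ← mulOp_mul, ← truncExp_add, add_neg_cancel, truncExp_zero, one_mul, hgf t ht,
      ← mulOp_mul, mul_comm (truncSq n), e, map_neg, neg_apply]

/-! ### Energy identities for the linear flow -/

/-- The real inner product of square-integrable complex fields. -/
def rip (x y : FreqL2) : ℝ := (inner ℂ x y).re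

lemma rip_self (x : FreqL2) : rip x x = ‖x‖ ^ 2 := by
  rw [rip, ← RCLike.re_eq_complex_re, inner_self_eq_norm_sq]

lemma rip_comm (x y : FreqL2) : rip x y = rip y x := by
  rw [rip, rip, ← inner_conj_symm, Complex.conj_re]

lemma rip_add_left (x y z : FreqL2) : rip (x + y) z = rip x z + rip y z := by
  simp [rip, inner_add_left]

lemma rip_sub_left (x y z : FreqL2) : rip (x - y) z = rip x z - rip y z := by
  simp [rip, inner_sub_left]

lemma rip_sub_right (x y z : FreqL2) : rip x (y - z) = rip x y - rip x z := by
  simp [rip, inner_sub_right]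

lemma rip_smul_right (c : ℝ) (x y : FreqL2) : rip x (c • y) = c * rip x y := by
  rw [rip, rip, ← algebraMap_smul ℂ c y, inner_smul_right]
  exact Complex.re_ofReal_mul _ _

lemma rip_mulOp (φ : R3 →ᵇ ℝ) (x y : FreqL2) : rip (mulOp φ x) y = rip x (mulOp φ y) := by
  rw [rip, inner_mulOp, rip]

lemma rip_le (x y : FreqL2) : rip x y ≤ ‖x‖ * ‖y‖ :=
  (Complex.re_le_norm _).trans (norm_inner_le_norm x y)

lemma continuous_rip : Continuous fun p : FreqL2 × FreqL2 => rip p.1 p.2 :=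
  Complex.continuous_re.comp continuous_inner

lemma hasDerivAt_rip {x y : ℝ → FreqL2} {x' y' : FreqL2} {t : ℝ} (hx : HasDerivAt x x' t)
    (hy : HasDerivAt y y' t) :
    HasDerivAt (fun s => rip (x s) (y s)) (rip (x t) y' + rip x' (y t)) t := by
  have := Complex.reCLM.hasFDerivAt.comp_hasDerivAt t (hx.inner ℂ hy)
  refine this.congr_deriv ?_
  simp [rip]

lemma norm_mulOp_sq (φ : R3 →ᵇ ℝ) (x : FreqL2) :
    ‖mulOp φ x‖ ^ 2 = ∫ ξ, φ ξ ^ 2 * ‖x ξ‖ ^ 2 := by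
  rw [← rip_self, rip_mulOp, rip_comm, ← mulOp_mul, rip, re_inner_mulOp_self]
  simp [sq]

lemma integrable_norm_sq_freq (x : FreqL2) : Integrable fun ξ => ‖x ξ‖ ^ 2 :=
  (memLp_two_iff_integrable_sq_norm (Lp.memLp x).1).1 (Lp.memLp x)

lemma tendsto_mulOp_cutoff (x : FreqL2) :
    Tendsto (fun n => mulOp (cutoff n) x) atTop (𝓝 x) := by
  rw [tendsto_iff_norm_sub_tendsto_zero]
  have h : Tendsto (fun n => ∫ ξ, (cutoff n - 1) ξ ^ 2 * ‖x ξ‖ ^ 2) atTop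
      (𝓝 (∫ _ : R3, (0 : ℝ))) := by
    refine tendsto_integral_of_dominated_convergence (fun ξ => ‖x ξ‖ ^ 2) (fun n => ?_)
      (integrable_norm_sq_freq x) (fun n => Eventually.of_forall fun ξ => ?_)
      (Eventually.of_forall fun ξ => ?_)
    · exact ((cutoff n - 1).continuous.pow 2).aestronglyMeasurable.mul
        (integrable_norm_sq_freq x).1
    · rw [norm_mul, norm_pow, norm_pow, norm_norm]
      refine mul_le_of_le_one_left (by positivity) ?_
      rw [sq_le_one_iff₀ (norm_nonneg _), Real.norm_eq_abs, abs_le,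
        BoundedContinuousFunction.sub_apply, show (1 : R3 →ᵇ ℝ) ξ = 1 from rfl]
      have h1 := cutoff_nonneg n ξ
      have h2 := cutoff_le_one n ξ
      constructor <;> linarith
    · have := (((tendsto_cutoff ξ).sub_const 1).pow 2).mul_const (‖x ξ‖ ^ 2)
      simpa using this
  have h2 : Tendsto (fun n => ‖mulOp (cutoff n) x - x‖ ^ 2) atTop (𝓝 0) := by
    rw [integral_zero] at h
    refine h.congr fun n => ?_
    rw [← norm_mulOp_sq, map_sub, sub_apply, mulOp_one]
  have h3 := (Real.continuous_sqrt.tendsto 0).comp h2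
  simpa [Function.comp_def, Real.sqrt_sq] using h3

/-- The Dirichlet integral `∫ (2π|ξ|)² |x(ξ)|² dξ`. -/
def dirichlet (x : FreqL2) : ℝ≥0∞ := ∫⁻ ξ : R3, ENNReal.ofReal (freqSq ξ) * ‖x ξ‖ₑ ^ 2

lemma hDotOneSq_eq (S : MatL2) : hDotOneSq S = dirichlet (ftL2 S) := rfl

lemma ofReal_freqSq_mul (x : FreqL2) (ξ : R3) :
    ENNReal.ofReal (freqSq ξ) * ‖x ξ‖ₑ ^ 2 = ENNReal.ofReal (freqSq ξ * ‖x ξ‖ ^ 2) := by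
  rw [ENNReal.ofReal_mul (freqSq_nonneg ξ), ENNReal.ofReal_pow (norm_nonneg _), ofReal_norm]

lemma integrable_freqSq_mul {x : FreqL2} (hx : dirichlet x < ∞) :
    Integrable fun ξ => freqSq ξ * ‖x ξ‖ ^ 2 := by
  refine ⟨continuous_freqSq.aestronglyMeasurable.mul (integrable_norm_sq_freq x).1, ?_⟩
  rw [hasFiniteIntegral_iff_ofReal (Eventually.of_forall fun ξ =>
    mul_nonneg (freqSq_nonneg ξ) (sq_nonneg _))]
  simp only [← ofReal_freqSq_mul]
  exact hx

lemma dirichlet_toReal (x : FreqL2) :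
    (dirichlet x).toReal = ∫ ξ, freqSq ξ * ‖x ξ‖ ^ 2 := by
  rw [integral_eq_lintegral_of_nonneg_ae (Eventually.of_forall fun ξ =>
    mul_nonneg (freqSq_nonneg ξ) (sq_nonneg _))
    (continuous_freqSq.aestronglyMeasurable.mul (integrable_norm_sq_freq x).1)]
  simp only [← ofReal_freqSq_mul]
  rfl

/-- The truncated Dirichlet form. -/
def truncDirichlet (n : ℕ) (x : FreqL2) : ℝ :=
  rip (mulOp (truncSq n) (mulOp (cutoff n) x)) (mulOp (cutoff n) x)

lemma truncDirichlet_eq (n : ℕ) (x : FreqL2) :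
    truncDirichlet n x = ∫ ξ, cutoff n ξ ^ 2 * (freqSq ξ * ‖x ξ‖ ^ 2) := by
  rw [truncDirichlet, rip_mulOp, rip_comm, ← mulOp_mul, rip_comm, rip_mulOp, rip_comm, ← mulOp_mul,
    rip, re_inner_mulOp_self]
  refine integral_congr_ae (Eventually.of_forall fun ξ => ?_)
  have := cutoff_mul_truncSq n ξ
  simp only [BoundedContinuousFunction.mul_apply]
  rw [mul_comm (truncSq n ξ), this]
  ring

lemma cutoff_sq_mul_le (n : ℕ) (x : FreqL2) (ξ : R3) :
    cutoff n ξ ^ 2 * (freqSq ξ * ‖x ξ‖ ^ 2) ≤ freqSq ξ * ‖x ξ‖ ^ 2 :=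
  mul_le_of_le_one_left (mul_nonneg (freqSq_nonneg ξ) (sq_nonneg _))
    (pow_le_one₀ (cutoff_nonneg n ξ) (cutoff_le_one n ξ))

lemma truncDirichlet_nonneg (n : ℕ) (x : FreqL2) : 0 ≤ truncDirichlet n x := by
  rw [truncDirichlet_eq]
  exact integral_nonneg fun ξ => mul_nonneg (sq_nonneg _)
    (mul_nonneg (freqSq_nonneg ξ) (sq_nonneg _))

lemma truncDirichlet_le (n : ℕ) {x : FreqL2} (hx : dirichlet x < ∞) :
    truncDirichlet n x ≤ (dirichlet x).toReal := by
  rw [truncDirichlet_eq, dirichlet_toReal]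
  exact integral_mono_of_nonneg (Eventually.of_forall fun ξ => mul_nonneg (sq_nonneg _)
    (mul_nonneg (freqSq_nonneg ξ) (sq_nonneg _))) (integrable_freqSq_mul hx)
    (Eventually.of_forall fun ξ => cutoff_sq_mul_le n x ξ)

lemma tendsto_truncDirichlet {x : FreqL2} (hx : dirichlet x < ∞) :
    Tendsto (fun n => truncDirichlet n x) atTop (𝓝 (dirichlet x).toReal) := by
  simp_rw [truncDirichlet_eq, dirichlet_toReal]
  refine tendsto_integral_of_dominated_convergence (fun ξ => freqSq ξ * ‖x ξ‖ ^ 2) (fun n => ?_)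
    (integrable_freqSq_mul hx) (fun n => Eventually.of_forall fun ξ => ?_)
    (Eventually.of_forall fun ξ => ?_)
  · exact ((cutoff n).continuous.pow 2).aestronglyMeasurable.mul (integrable_freqSq_mul hx).1
  · rw [Real.norm_of_nonneg (mul_nonneg (sq_nonneg _)
      (mul_nonneg (freqSq_nonneg ξ) (sq_nonneg _)))]
    exact cutoff_sq_mul_le n x ξ
  · simpa using ((tendsto_cutoff ξ).pow 2).mul_const (freqSq ξ * ‖x ξ‖ ^ 2)

/-- Along the flow `y' = -b y + f`, the functional `⟨b y, y⟩ - 2 ⟨f₀, y⟩` decreases at least at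
the rate `2 ‖y'‖²`, up to the error made by freezing `f` at `f₀`. -/
lemma trunc_gradient_flow {b : R3 →ᵇ ℝ} {y f : ℝ → FreqL2} {f₀ : FreqL2} {r h ε η : ℝ}
    (hh : 0 < h) (hη : 0 < η) (hη2 : η ≤ 2)
    (hy : ∀ t ∈ Set.Icc r (r + h), HasDerivAt y (-(mulOp b (y t)) + f t) t)
    (hf : ∀ t ∈ Set.Icc r (r + h), ‖f t - f₀‖ ≤ ε) :
    rip (mulOp b (y (r + h))) (y (r + h)) - rip (mulOp b (y r)) (y r)
      - 2 * rip f₀ (y (r + h) - y r) ≤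
      -(2 - η) * (‖y (r + h) - y r‖ ^ 2 / h) + h * ε ^ 2 / η := by
  -- The mean velocity `a` linearizes the dissipation: `‖y'‖² ≥ 2 ⟨a, y'⟩ - ‖a‖²`, and the right
  -- side is a total derivative.
  set a : FreqL2 := h⁻¹ • (y (r + h) - y r) with ha
  set G : ℝ → ℝ := fun t => rip (mulOp b (y t)) (y t) - 2 * rip f₀ (y t) +
    (2 - η) * (2 * rip a (y t) - t * ‖a‖ ^ 2) - t * (ε ^ 2 / η) with hG
  have hGd : ∀ t ∈ Set.Icc r (r + h), HasDerivAt G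
      (rip (mulOp b (y t)) (-(mulOp b (y t)) + f t) + rip (mulOp b (-(mulOp b (y t)) + f t)) (y t)
      - 2 * rip f₀ (-(mulOp b (y t)) + f t) + (2 - η) * (2 * rip a (-(mulOp b (y t)) + f t)
      - 1 * ‖a‖ ^ 2) - 1 * (ε ^ 2 / η)) t := by
    intro t ht
    have h1 := hy t ht
    have h2 : HasDerivAt (fun s => mulOp b (y s)) (mulOp b (-(mulOp b (y t)) + f t)) t :=
      (mulOp b).hasFDerivAt.comp_hasDerivAt t h1
    have h3 : ∀ c : FreqL2, HasDerivAt (fun s => rip c (y s))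
        (rip c (-(mulOp b (y t)) + f t)) t := fun c => by
      have := hasDerivAt_rip (hasDerivAt_const t c) h1
      simpa [rip] using this
    exact ((((hasDerivAt_rip h2 h1).sub ((h3 f₀).const_mul 2)).add ((((h3 a).const_mul 2).sub
      ((hasDerivAt_id t).mul_const _)).const_mul _)).sub ((hasDerivAt_id t).mul_const _))
  have hanti : AntitoneOn G (Set.Icc r (r + h)) := by
    refine antitoneOn_of_deriv_nonpos (convex_Icc _ _)
      (fun t ht => (hGd t ht).continuousAt.continuousWithinAt)
      (fun t ht => (hGd t (interior_subset ht)).differentiableAt.differentiableWithinAt)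
      fun t ht => ?_
    have ht' := interior_subset ht
    rw [(hGd t ht').deriv]
    set v := -(mulOp b (y t)) + f t with hv
    have e1 : mulOp b (y t) = f t - v := by rw [hv]; abel
    have e2 : rip (mulOp b v) (y t) = rip (mulOp b (y t)) v := by rw [rip_mulOp, rip_comm]
    have e3 : rip (f t) v - rip f₀ v ≤ ε * ‖v‖ := by
      rw [← rip_sub_left]
      exact (rip_le _ _).trans (mul_le_mul_of_nonneg_right (hf t ht') (norm_nonneg _))
    have e4 : 0 ≤ ‖v - a‖ ^ 2 := sq_nonneg _
    rw [← rip_self, rip_sub_left, rip_sub_right, rip_sub_right, rip_self, rip_self,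
      rip_comm v a] at e4
    have e5 : 2 * (ε * ‖v‖) ≤ ε ^ 2 / η + η * ‖v‖ ^ 2 := by
      have h0 : 0 ≤ (ε - η * ‖v‖) ^ 2 / η := by positivity
      have h1 : (ε - η * ‖v‖) ^ 2 / η = ε ^ 2 / η - 2 * (ε * ‖v‖) + η * ‖v‖ ^ 2 := by
        field_simp; ring
      linarith
    rw [e2, e1, rip_sub_left, rip_self]
    nlinarith [mul_nonneg (sub_nonneg.2 hη2) e4]
  have key := hanti (Set.left_mem_Icc.2 (by linarith)) (Set.right_mem_Icc.2 (by linarith))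
    (by linarith)
  simp only [hG] at key
  have e6 : rip a (y (r + h)) - rip a (y r) = ‖y (r + h) - y r‖ ^ 2 / h := by
    rw [← rip_sub_right, rip_comm, ha, rip_smul_right, rip_self]; ring
  have e7 : h * ‖a‖ ^ 2 = ‖y (r + h) - y r‖ ^ 2 / h := by
    rw [ha, norm_smul, norm_inv, Real.norm_of_nonneg hh.le, mul_pow]
    field_simp
  have e8 : h * ε ^ 2 / η = h * (ε ^ 2 / η) := by ring
  rw [rip_sub_right, e8]
  have e9 : (2 - η) * (2 * (rip a (y (r + h)) - rip a (y r)) - h * ‖a‖ ^ 2) =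
      (2 - η) * (‖y (r + h) - y r‖ ^ 2 / h) := by rw [e6, e7]; ring
  nlinarith

section Flow

variable {t₁ : ℝ} {x f : ℝ → FreqL2}

/-- The gradient-flow inequality for solutions of Duhamel's formula with finite Dirichlet
integral. -/
lemma gradient_flow_le (ht₁ : 0 ≤ t₁) (hf : ContinuousOn f (Set.Icc 0 t₁))
    (hint : ∀ t ∈ Set.Ioc 0 t₁,
      IntervalIntegrable (fun τ => mulOp (heatSymbol τ) (f (t - τ))) volume 0 t)
    (hx : ∀ t ∈ Set.Ioc 0 t₁, x t = mulOp (heatSymbol t) (x 0) +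
      ∫ τ in (0 : ℝ)..t, mulOp (heatSymbol τ) (f (t - τ)))
    (hJ : ∀ t ∈ Set.Icc 0 t₁, dirichlet (x t) < ∞) {r h ε η : ℝ} (hr : 0 ≤ r) (hh : 0 < h)
    (hrh : r + h ≤ t₁) (hη : 0 < η) (hη2 : η ≤ 2)
    (hε : ∀ t ∈ Set.Icc r (r + h), ‖f t - f r‖ ≤ ε) :
    (dirichlet (x (r + h))).toReal - (dirichlet (x r)).toReal
      - 2 * rip (f r) (x (r + h) - x r) ≤
      -(2 - η) * (‖x (r + h) - x r‖ ^ 2 / h) + h * ε ^ 2 / η := by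
  have hr1 : r ∈ Set.Icc 0 t₁ := ⟨hr, by linarith⟩
  have hr2 : r + h ∈ Set.Icc 0 t₁ := ⟨by linarith, hrh⟩
  have hn : ∀ n, truncDirichlet n (x (r + h)) - truncDirichlet n (x r)
      - 2 * rip (mulOp (cutoff n) (f r)) (mulOp (cutoff n) (x (r + h)) - mulOp (cutoff n) (x r)) ≤
      -(2 - η) * (‖mulOp (cutoff n) (x (r + h)) - mulOp (cutoff n) (x r)‖ ^ 2 / h)
        + h * ε ^ 2 / η := by
    intro n
    obtain ⟨y, hy, hyd⟩ := exists_truncated_ode ht₁ hf hint hx n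
    rw [truncDirichlet, truncDirichlet, ← hy _ hr1, ← hy _ hr2]
    refine trunc_gradient_flow (f := fun t => mulOp (cutoff n) (f t)) hh hη hη2
      (fun t ht => hyd t ⟨hr.trans ht.1, ht.2.trans hrh⟩) fun t ht => ?_
    rw [← map_sub]
    refine (norm_mulOp_le (c := 1) (fun ξ => ?_) _).trans ?_
    · rw [abs_of_nonneg (cutoff_nonneg n ξ)]; exact cutoff_le_one n ξ
    · rw [one_mul]; exact hε t ht
  have hd := (tendsto_mulOp_cutoff (x (r + h))).sub (tendsto_mulOp_cutoff (x r))
  refine le_of_tendsto_of_tendsto' (((tendsto_truncDirichlet (hJ _ hr2)).sub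
    (tendsto_truncDirichlet (hJ _ hr1))).sub (((continuous_rip.tendsto _).comp
      ((tendsto_mulOp_cutoff (f r)).prodMk_nhds hd)).const_mul 2))
    ((((hd.norm.pow 2).div_const h).const_mul _).add_const _) hn

/-- The energy identity for solutions of Duhamel's formula. -/
lemma energy_identity (ht₁ : 0 ≤ t₁) (hf : ContinuousOn f (Set.Icc 0 t₁))
    (hint : ∀ t ∈ Set.Ioc 0 t₁,
      IntervalIntegrable (fun τ => mulOp (heatSymbol τ) (f (t - τ))) volume 0 t)
    (hx : ∀ t ∈ Set.Ioc 0 t₁, x t = mulOp (heatSymbol t) (x 0) +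
      ∫ τ in (0 : ℝ)..t, mulOp (heatSymbol τ) (f (t - τ)))
    (hxc : ContinuousOn x (Set.Icc 0 t₁))
    (hJ : ∀ t ∈ Set.Icc 0 t₁, dirichlet (x t) < ∞)
    (hJc : ContinuousOn (fun t => (dirichlet (x t)).toReal) (Set.Icc 0 t₁)) {r s : ℝ}
    (hr : 0 ≤ r) (hrs : r ≤ s) (hs : s ≤ t₁) :
    ‖x s‖ ^ 2 - ‖x r‖ ^ 2 =
      ∫ t in r..s, (-2 * (dirichlet (x t)).toReal + 2 * rip (f t) (x t)) := by
  have hsub : Set.uIcc r s ⊆ Set.Icc 0 t₁ := by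
    rw [Set.uIcc_of_le hrs]; exact Set.Icc_subset_Icc hr hs
  have hr1 : r ∈ Set.Icc 0 t₁ := ⟨hr, hrs.trans hs⟩
  have hs1 : s ∈ Set.Icc 0 t₁ := ⟨hr.trans hrs, hs⟩
  have hcn : ∀ n, ContinuousOn (fun t => -2 * truncDirichlet n (x t) +
      2 * rip (mulOp (cutoff n) (f t)) (mulOp (cutoff n) (x t))) (Set.uIcc r s) := fun n => by
    have c1 : ContinuousOn (fun t => mulOp (cutoff n) (x t)) (Set.uIcc r s) :=
      (mulOp (cutoff n)).continuous.comp_continuousOn (hxc.mono hsub)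
    have c2 : ContinuousOn (fun t => mulOp (cutoff n) (f t)) (Set.uIcc r s) :=
      (mulOp (cutoff n)).continuous.comp_continuousOn (hf.mono hsub)
    have c3 : ContinuousOn (fun t => mulOp (truncSq n) (mulOp (cutoff n) (x t)))
      (Set.uIcc r s) := (mulOp (truncSq n)).continuous.comp_continuousOn c1
    exact ((continuous_rip.comp_continuousOn (c3.prodMk c1)).const_mul _).add
      ((continuous_rip.comp_continuousOn (c2.prodMk c1)).const_mul _)
  have hn : ∀ n, ‖mulOp (cutoff n) (x s)‖ ^ 2 - ‖mulOp (cutoff n) (x r)‖ ^ 2 =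
      ∫ t in r..s, (-2 * truncDirichlet n (x t) +
        2 * rip (mulOp (cutoff n) (f t)) (mulOp (cutoff n) (x t))) := by
    intro n
    obtain ⟨y, hy, hyd⟩ := exists_truncated_ode ht₁ hf hint hx n
    rw [intervalIntegral.integral_eq_sub_of_hasDerivAt (f := fun t => ‖y t‖ ^ 2) (fun t ht => ?_)
      (hcn n).intervalIntegrable, hy _ hr1, hy _ hs1]
    have h1 := hyd t (hsub ht)
    have h2 := hasDerivAt_rip h1 h1
    simp_rw [rip_self] at h2
    refine h2.congr_deriv ?_
    rw [rip_comm, truncDirichlet, ← hy _ (hsub ht), rip_add_left]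
    have : rip (-(mulOp (truncSq n) (y t))) (y t) = -rip (mulOp (truncSq n) (y t)) (y t) := by
      simp [rip]
    rw [this]
    ring
  refine tendsto_nhds_unique (((tendsto_mulOp_cutoff (x s)).norm.pow 2).sub
    ((tendsto_mulOp_cutoff (x r)).norm.pow 2)) ?_
  simp_rw [hn]
  refine intervalIntegral.tendsto_integral_filter_of_dominated_convergence
    (fun t => 2 * (dirichlet (x t)).toReal + 2 * (‖f t‖ * ‖x t‖)) (Eventually.of_forall fun n => ?_)
    (Eventually.of_forall fun n => Eventually.of_forall fun t ht => ?_) ?_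
    (Eventually.of_forall fun t ht => ?_)
  · exact ((hcn n).mono Set.uIoc_subset_uIcc).aestronglyMeasurable measurableSet_uIoc
  · have ht' := hsub (Set.uIoc_subset_uIcc ht)
    have h1 := truncDirichlet_nonneg n (x t)
    have h2 := truncDirichlet_le n (hJ t ht')
    have hle : ∀ z : FreqL2, ‖mulOp (cutoff n) z‖ ≤ ‖z‖ := fun z => by
      refine (norm_mulOp_le (c := 1) (fun ξ => ?_) _).trans (one_mul _).le
      rw [abs_of_nonneg (cutoff_nonneg n ξ)]; exact cutoff_le_one n ξ
    have h3 : |rip (mulOp (cutoff n) (f t)) (mulOp (cutoff n) (x t))| ≤ ‖f t‖ * ‖x t‖ :=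
      ((Complex.abs_re_le_norm _).trans (norm_inner_le_norm _ _)).trans
        (mul_le_mul (hle _) (hle _) (norm_nonneg _) (norm_nonneg _))
    rw [Real.norm_eq_abs]
    rw [abs_le] at h3 ⊢
    constructor <;> linarith
  · exact (((hJc.mono hsub).const_mul _).add (((hf.mono hsub).norm.mul
      (hxc.mono hsub).norm).const_mul _)).intervalIntegrable
  · have ht' := hsub (Set.uIoc_subset_uIcc ht)
    exact ((tendsto_truncDirichlet (hJ t ht')).const_mul _).add
      (((continuous_rip.tendsto _).comp ((tendsto_mulOp_cutoff (f t)).prodMk_nhds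
        (tendsto_mulOp_cutoff (x t)))).const_mul 2)

end Flow

/-! ### The Sobolev inequality -/

/-- The Gagliardo–Nirenberg–Sobolev inequality for square-integrable functions, by cutting off. -/
lemma eLpNorm_six_le_fderiv {F : Type*} [NormedAddCommGroup F] [NormedSpace ℝ F]
    [FiniteDimensional ℝ F] {u : R3 → F} (hu : ContDiff ℝ 1 u) (hu2 : MemLp u 2 volume) :
    eLpNorm u 6 volume ≤ (SNormLESNormFDerivOfEqConst F (volume : Measure R3) 2 : ℝ≥0∞) *
      eLpNorm (fderiv ℝ u) 2 volume := by
  -- The inequality holds for `v n`, the product of `u` with a cutoff at the distance `n + 1`, whose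
  -- derivative contributes `O(1 / n) ‖u‖₂`.
  let ψ : ContDiffBump (0 : R3) := ⟨1, 2, one_pos, one_lt_two⟩
  have hψ : ContDiff ℝ 1 ψ := ψ.contDiff
  obtain ⟨D, hD⟩ := (hψ.continuous_fderiv one_ne_zero).bounded_above_of_compact_support
    (ψ.hasCompactSupport.fderiv (𝕜 := ℝ))
  have hD0 : 0 ≤ D := (norm_nonneg _).trans (hD 0)
  let c : ℕ → ℝ := fun n => (n + 1 : ℝ)⁻¹
  have hc : ∀ n, 0 < c n := fun n => by positivity
  have hclim : Tendsto c atTop (𝓝 0) := by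
    simpa [c, one_div] using tendsto_one_div_add_atTop_nhds_zero_nat (𝕜 := ℝ)
  let χ : ℕ → R3 → ℝ := fun n x => ψ (c n • x)
  let v : ℕ → R3 → F := fun n x => χ n x • u x
  have hχ : ∀ n, ContDiff ℝ 1 (χ n) := fun n => hψ.comp (contDiff_const_smul _)
  have hχd : ∀ n x, ‖fderiv ℝ (χ n) x‖ ≤ c n * D := fun n x => by
    have : HasFDerivAt (χ n) ((fderiv ℝ ψ (c n • x)).comp (c n • ContinuousLinearMap.id ℝ R3)) x :=
      ((hψ.differentiable one_ne_zero) _).hasFDerivAt.comp x ((hasFDerivAt_id x).const_smul (c n))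
    rw [this.fderiv, ContinuousLinearMap.comp_smul, ContinuousLinearMap.comp_id, norm_smul,
      Real.norm_of_nonneg (hc n).le]
    exact mul_le_mul_of_nonneg_left (hD _) (hc n).le
  have hv : ∀ n, ContDiff ℝ 1 (v n) := fun n => (hχ n).smul hu
  have hvs : ∀ n, HasCompactSupport (v n) := fun n => by
    refine HasCompactSupport.smul_right ?_
    exact ψ.hasCompactSupport.comp_homeomorph (Homeomorph.smulOfNeZero (c n) (hc n).ne')
  have hvd : ∀ n x, ‖fderiv ℝ (v n) x‖ ≤ ‖fderiv ℝ u x‖ + c n * D * ‖u x‖ := fun n x => by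
    have h1 := ((hχ n).differentiable one_ne_zero x).hasFDerivAt.smul
      ((hu.differentiable one_ne_zero x)).hasFDerivAt
    rw [show v n = χ n • u from rfl, h1.fderiv]
    refine (norm_add_le _ _).trans (add_le_add ?_ ?_)
    · rw [norm_smul]
      refine mul_le_of_le_one_left (norm_nonneg _) ?_
      rw [Real.norm_of_nonneg ψ.nonneg]
      exact ψ.le_one
    · rw [ContinuousLinearMap.norm_smulRight_apply]
      exact mul_le_mul_of_nonneg_right (hχd n x) (norm_nonneg _)
  have hvn : ∀ n, eLpNorm (v n) 6 volume ≤
      (SNormLESNormFDerivOfEqConst F (volume : Measure R3) 2 : ℝ≥0∞) *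
      (eLpNorm (fderiv ℝ u) 2 volume + ENNReal.ofReal (c n * D) * eLpNorm u 2 volume) := fun n => by
    have h1 : eLpNorm (v n) 6 volume ≤ (SNormLESNormFDerivOfEqConst F (volume : Measure R3) 2 :
        ℝ≥0∞) * eLpNorm (fderiv ℝ (v n)) 2 volume := by
      exact_mod_cast eLpNorm_le_eLpNorm_fderiv_of_eq (volume : Measure R3) (hv n) (hvs n)
        (p := 2) (p' := 6) one_le_two (by simp) (by norm_num)
    refine h1.trans (mul_le_mul_right ?_ _)
    have h2 : eLpNorm (fderiv ℝ (v n)) 2 volume ≤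
        eLpNorm ((fun x => ‖fderiv ℝ u x‖) + fun x => (c n * D) * ‖u x‖) 2 volume :=
      eLpNorm_mono_real (hvd n)
    refine h2.trans ((eLpNorm_add_le ?_ ?_ one_le_two).trans ?_)
    · exact (hu.continuous_fderiv one_ne_zero).norm.aestronglyMeasurable
    · exact (hu.continuous.norm.const_mul _).aestronglyMeasurable
    · rw [eLpNorm_norm]
      gcongr
      have := eLpNorm_const_smul (c n * D) (fun x => ‖u x‖) 2 (volume : Measure R3)
      rw [eLpNorm_norm, Real.enorm_of_nonneg (mul_nonneg (hc n).le hD0)] at this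
      exact this.le
  have hlim : ∀ x, Tendsto (fun n => v n x) atTop (𝓝 (u x)) := fun x => by
    have h1 : Tendsto (fun n => c n • x) atTop (𝓝 0) := by
      simpa using hclim.smul_const x
    have h2 : Tendsto (fun n => χ n x) atTop (𝓝 1) := by
      have := (ψ.continuous.tendsto 0).comp h1
      rwa [ψ.one_of_mem_closedBall (Metric.mem_closedBall_self ψ.rIn_pos.le)] at this
    simpa using h2.smul_const (u x)
  refine (Lp.eLpNorm_lim_le_liminf_eLpNorm (fun n => (hv n).continuous.aestronglyMeasurable) u
    (Eventually.of_forall hlim)).trans ?_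
  have hub : Tendsto (fun n => (SNormLESNormFDerivOfEqConst F (volume : Measure R3) 2 : ℝ≥0∞) *
      (eLpNorm (fderiv ℝ u) 2 volume + ENNReal.ofReal (c n * D) * eLpNorm u 2 volume)) atTop
      (𝓝 ((SNormLESNormFDerivOfEqConst F (volume : Measure R3) 2 : ℝ≥0∞) *
      (eLpNorm (fderiv ℝ u) 2 volume + ENNReal.ofReal (0 * D) * eLpNorm u 2 volume))) := by
    refine ENNReal.Tendsto.const_mul (tendsto_const_nhds.add (ENNReal.Tendsto.mul_const
      (ENNReal.tendsto_ofReal (hclim.mul_const D)) (Or.inr hu2.2.ne)))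
      (Or.inr ENNReal.coe_ne_top)
  refine (liminf_le_liminf (Eventually.of_forall hvn)).trans ?_
  rw [hub.liminf_eq]
  simp

/-- The operator norm is bounded by the Hilbert–Schmidt norm. -/
lemma norm_sq_le_sum_apply (L : R3 →L[ℝ] CMat3) :
    ‖L‖ ^ 2 ≤ ∑ i : Fin 3, ‖L (EuclideanSpace.single i 1)‖ ^ 2 := by
  have h0 : 0 ≤ ∑ i : Fin 3, ‖L (EuclideanSpace.single i 1)‖ ^ 2 :=
    Finset.sum_nonneg fun i _ => sq_nonneg _
  rw [← Real.le_sqrt (norm_nonneg _) h0]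
  refine L.opNorm_le_bound (Real.sqrt_nonneg _) fun x => ?_
  have hx : x = ∑ i : Fin 3, x i • EuclideanSpace.single i (1 : ℝ) := by
    have := (EuclideanSpace.basisFun (Fin 3) ℝ).sum_repr x
    simpa using this.symm
  have e : L x = ∑ i : Fin 3, x i • L (EuclideanSpace.single i (1 : ℝ)) := by
    conv_lhs => rw [hx]
    simp
  rw [e, mul_comm, EuclideanSpace.norm_eq x,
    ← Real.sqrt_mul (Finset.sum_nonneg fun i _ => sq_nonneg _)]
  refine Real.le_sqrt_of_sq_le ?_
  calc ‖∑ i : Fin 3, x i • L (EuclideanSpace.single i (1 : ℝ))‖ ^ 2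
      ≤ (∑ i : Fin 3, ‖x i‖ * ‖L (EuclideanSpace.single i (1 : ℝ))‖) ^ 2 := by
        gcongr
        refine (norm_sum_le _ _).trans (Finset.sum_le_sum fun i _ => (norm_smul _ _).le)
    _ ≤ _ := Finset.sum_mul_sq_le_sq_mul_sq _ _ _

lemma lintegral_enorm_sq_le_sum {D : R3 → R3 →L[ℝ] CMat3} (hD : Continuous D) :
    ∫⁻ x, ‖D x‖ₑ ^ 2 ≤ ∑ i : Fin 3, ∫⁻ x, ‖D x (EuclideanSpace.single i 1)‖ₑ ^ 2 := by
  rw [← lintegral_finsetSum _ fun i _ =>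
    (hD.clm_apply continuous_const).measurable.enorm.pow_const 2]
  refine lintegral_mono fun x => ?_
  have := norm_sq_le_sum_apply (D x)
  simp only [← ofReal_norm, ← ENNReal.ofReal_pow (norm_nonneg _)]
  rw [← ENNReal.ofReal_sum_of_nonneg fun i _ => sq_nonneg _]
  exact ENNReal.ofReal_le_ofReal this

lemma sum_lintegral_coord_sq {g : R3 → CMat3} (hg : Continuous g) :
    ∑ i : Fin 3, ∫⁻ ξ : R3, ENNReal.ofReal ((2 * Real.pi * ξ i) ^ 2) * ‖g ξ‖ₑ ^ 2 =
      ∫⁻ ξ : R3, ENNReal.ofReal (freqSq ξ) * ‖g ξ‖ₑ ^ 2 := by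
  rw [← lintegral_finsetSum]
  · refine lintegral_congr fun ξ => ?_
    rw [← Finset.sum_mul, ← ENNReal.ofReal_sum_of_nonneg fun i _ => sq_nonneg _]
    congr 2
    simp only [mul_pow, ← Finset.mul_sum, freqSq]
    rw [EuclideanSpace.norm_sq_eq]
    simp
  · intro i _
    refine Measurable.mul ?_ (hg.measurable.enorm.pow_const 2)
    exact ENNReal.measurable_ofReal.comp
      (by fun_prop : Continuous fun ξ : R3 => (2 * Real.pi * ξ i) ^ 2).measurable

/-- Plancherel's theorem for the gradient. It is an inequality because the operator norm is used on
the left side. -/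
lemma eLpNorm_fderiv_sq_le (u : 𝓢(R3, CMat3)) :
    eLpNorm (fderiv ℝ u) 2 volume ^ 2 ≤ dirichlet ((𝓕 u).toLp 2) := by
  have e1 : ∀ (w : 𝓢(R3, CMat3)), ∫⁻ x, ‖w x‖ₑ ^ 2 = ∫⁻ ξ, ‖(𝓕 w) ξ‖ₑ ^ 2 := fun w => by
    have h := SchwartzMap.norm_fourier_toL2_eq w
    rw [SchwartzMap.norm_toLp, SchwartzMap.norm_toLp,
      ENNReal.toReal_eq_toReal_iff' ((𝓕 w).memLp 2 volume).2.ne (w.memLp 2 volume).2.ne] at h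
    rw [← eLpNorm_two_sq, ← eLpNorm_two_sq, h]
  have e2 : ∀ i : Fin 3, ∫⁻ x, ‖fderiv ℝ u x (EuclideanSpace.single i 1)‖ₑ ^ 2 =
      ∫⁻ ξ, ENNReal.ofReal ((2 * Real.pi * ξ i) ^ 2) * ‖(𝓕 u) ξ‖ₑ ^ 2 := fun i => by
    have h1 := e1 (∂_{EuclideanSpace.single i (1 : ℝ)} u)
    have ht : (fun x : R3 => inner ℝ x (EuclideanSpace.single i (1 : ℝ))).HasTemperateGrowth := by
      fun_prop
    refine (Eq.trans ?_ h1).trans ?_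
    · rfl
    · refine lintegral_congr fun ξ => ?_
      rw [SchwartzMap.fourier_lineDerivOp_eq, smul_apply,
        SchwartzMap.smulLeftCLM_apply_apply ht, enorm_smul, enorm_smul, mul_pow, mul_pow,
        ← mul_assoc, ← mul_pow]
      congr 1
      rw [← ofReal_norm, ← ofReal_norm, ← ENNReal.ofReal_mul (norm_nonneg _),
        ← ENNReal.ofReal_pow (by positivity)]
      congr 1
      simp [abs_of_pos Real.pi_pos, mul_pow, EuclideanSpace.inner_single_right]
  have hu : ContDiff ℝ 1 u := u.smooth 1
  rw [eLpNorm_two_sq]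
  refine (lintegral_enorm_sq_le_sum (hu.continuous_fderiv one_ne_zero)).trans ?_
  rw [Finset.sum_congr rfl fun i _ => e2 i, sum_lintegral_coord_sq (𝓕 u).continuous]
  refine le_of_eq (lintegral_congr_ae ?_)
  filter_upwards [(𝓕 u).coeFn_toLp 2 volume] with ξ hξ
  rw [hξ]

lemma dirichlet_eq_eLpNorm_sq (x : FreqL2) :
    dirichlet x = eLpNorm (fun ξ => (2 * Real.pi * ‖ξ‖) • x ξ) 2 volume ^ 2 := by
  rw [eLpNorm_two_sq]
  refine lintegral_congr fun ξ => ?_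
  rw [enorm_smul, mul_pow, freqSq, Real.enorm_of_nonneg (by positivity),
    ENNReal.ofReal_pow (by positivity)]

lemma hOneSq_eq (S : MatL2) : hOneSq S = ‖S‖ₑ ^ 2 + hDotOneSq S := by
  have e : ‖S‖ₑ ^ 2 = ∫⁻ ξ, ‖ftL2 S ξ‖ₑ ^ 2 := by
    rw [← eLpNorm_two_sq, ← Lp.enorm_def, ← ofReal_norm, ← ofReal_norm, norm_ftL2]
  rw [e, hOneSq, hDotOneSq, ← lintegral_add_left']
  · refine lintegral_congr fun ξ => ?_
    rw [ENNReal.ofReal_add zero_le_one (sq_nonneg _), add_mul, ENNReal.ofReal_one, one_mul]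
  · exact (Lp.memLp (ftL2 S)).1.enorm.pow_const 2

/-- The Sobolev inequality `‖S‖_{L⁶} ≤ C ‖S‖_{Ḣ¹}` for square-integrable fields in `H¹`. Schwartz
functions are dense in `H¹`, since those are dense in `L²` on the frequency side. -/
lemma eLpNorm_six_le (S : MatL2) (hS : hOneSq S < ∞) :
    eLpNorm S 6 volume ≤ (SNormLESNormFDerivOfEqConst CMat3 (volume : Measure R3) 2 : ℝ≥0∞) *
      hDotOneSq S ^ (1 / 2 : ℝ) := by
  set C := (SNormLESNormFDerivOfEqConst CMat3 (volume : Measure R3) 2 : ℝ≥0∞) with hC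
  have hroot : ∀ x : FreqL2, dirichlet x ^ (1 / 2 : ℝ) =
      eLpNorm (fun ξ => (2 * Real.pi * ‖ξ‖) • x ξ) 2 volume := fun x => by
    rw [dirichlet_eq_eLpNorm_sq, ← ENNReal.rpow_natCast, ← ENNReal.rpow_mul]; norm_num
  set x := ftL2 S with hx
  -- `W x` is square integrable since `S ∈ H¹`. Schwartz approximations `φ n` of `W x` give Schwartz
  -- approximations `ψ n = V φ n` of `x` in the norm of `H¹`.
  let W : R3 → ℝ := fun ξ => (1 + ‖ξ‖ ^ 2) ^ (1 / 2 : ℝ)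
  let V : R3 → ℝ := fun ξ => (1 + ‖ξ‖ ^ 2) ^ (-(1 / 2) : ℝ)
  have hWc : Continuous W := by
    refine Continuous.rpow_const (by fun_prop) fun ξ => Or.inr (by norm_num)
  have hVt : V.HasTemperateGrowth := Function.hasTemperateGrowth_one_add_norm_sq_rpow R3 _
  have hVW : ∀ ξ, V ξ * W ξ = 1 := fun ξ => by
    simp only [V, W]
    rw [← Real.rpow_add (by positivity)]; norm_num
  have hV0 : ∀ ξ, 0 ≤ V ξ := fun ξ => by positivity
  have hWsq : ∀ ξ, W ξ ^ 2 = 1 + ‖ξ‖ ^ 2 := fun ξ => by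
    simp only [W]
    rw [← Real.rpow_mul_natCast (by positivity)]; norm_num
  have hVle : ∀ ξ, V ξ ≤ 1 := fun ξ =>
    Real.rpow_le_one_of_one_le_of_nonpos (by simp) (by norm_num)
  have hVle2 : ∀ ξ, ‖ξ‖ * V ξ ≤ 1 := fun ξ => by
    have h1 : ‖ξ‖ ≤ W ξ := by
      refine le_of_sq_le_sq ?_ (by positivity)
      rw [hWsq]; linarith
    calc ‖ξ‖ * V ξ ≤ W ξ * V ξ := by gcongr
      _ = 1 := by rw [mul_comm, hVW]
  have hg : MemLp (fun ξ => W ξ • x ξ) 2 volume := by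
    refine ⟨hWc.aestronglyMeasurable.smul (Lp.memLp x).1, ?_⟩
    refine (ENNReal.pow_lt_top_iff (n := 2)).1 ?_ |>.resolve_right two_ne_zero
    rw [eLpNorm_two_sq]
    refine lt_of_le_of_lt (lintegral_mono fun ξ => ?_) hS
    rw [enorm_smul, mul_pow]
    gcongr
    rw [← ofReal_norm, ← ENNReal.ofReal_pow (norm_nonneg _), Real.norm_eq_abs, sq_abs, hWsq]
    refine ENNReal.ofReal_le_ofReal ?_
    have : 1 ≤ (2 * Real.pi) ^ 2 := by nlinarith [Real.pi_gt_three]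
    rw [mul_pow]
    nlinarith [sq_nonneg ‖ξ‖]
  obtain ⟨φ', hφ', hφlim'⟩ := mem_closure_iff_seq_limit.1
    (SchwartzMap.denseRange_toLpCLM (F := CMat3) (p := 2) (μ := (volume : Measure R3))
      ENNReal.ofNat_ne_top (hg.toLp _))
  choose φ hφ using hφ'
  have hφlim : Tendsto (fun n => eLpNorm (fun ξ => φ n ξ - W ξ • x ξ) 2 volume) atTop (𝓝 0) := by
    rw [tendsto_iff_edist_tendsto_0] at hφlim'
    refine hφlim'.congr fun n => ?_
    rw [← hφ, SchwartzMap.toLpCLM_apply, Lp.edist_def]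
    refine eLpNorm_congr_ae ?_
    filter_upwards [(φ n).coeFn_toLp 2 volume, hg.coeFn_toLp] with ξ h1 h2
    rw [Pi.sub_apply, h1, h2]
  let ψ : ℕ → 𝓢(R3, CMat3) := fun n => SchwartzMap.smulLeftCLM CMat3 V (φ n)
  have hψ : ∀ n ξ, ψ n ξ = V ξ • φ n ξ := fun n ξ => SchwartzMap.smulLeftCLM_apply_apply hVt _ _
  have hdiff : ∀ n ξ, ψ n ξ - x ξ = V ξ • (φ n ξ - W ξ • x ξ) := fun n ξ => by
    rw [hψ, smul_sub, smul_smul, hVW, one_smul]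
  have hψlim : Tendsto (fun n => (ψ n).toLp 2 volume) atTop (𝓝 x) := by
    rw [tendsto_iff_edist_tendsto_0]
    refine tendsto_of_tendsto_of_tendsto_of_le_of_le tendsto_const_nhds hφlim
      (fun _ => bot_le) fun n => ?_
    rw [Lp.edist_def]
    refine eLpNorm_mono_ae ?_
    filter_upwards [(ψ n).coeFn_toLp 2 volume] with ξ h1
    rw [Pi.sub_apply, h1, hdiff, norm_smul, Real.norm_of_nonneg (hV0 ξ)]
    exact mul_le_of_le_one_left (norm_nonneg _) (hVle ξ)
  have hgrad : ∀ n, dirichlet ((ψ n).toLp 2 volume) ^ (1 / 2 : ℝ) ≤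
      dirichlet x ^ (1 / 2 : ℝ) + ENNReal.ofReal (2 * Real.pi) *
        eLpNorm (fun ξ => φ n ξ - W ξ • x ξ) 2 volume := fun n => by
    rw [hroot, hroot]
    have hm : AEStronglyMeasurable (fun ξ : R3 => 2 * Real.pi * ‖ξ‖) volume :=
      (by fun_prop : Continuous fun ξ : R3 => 2 * Real.pi * ‖ξ‖).aestronglyMeasurable
    have h1 : (fun ξ => (2 * Real.pi * ‖ξ‖) • (ψ n).toLp 2 volume ξ) =ᵐ[volume]
        (fun ξ => (2 * Real.pi * ‖ξ‖) • x ξ) +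
        fun ξ => (2 * Real.pi * ‖ξ‖) • (ψ n ξ - x ξ) := by
      filter_upwards [(ψ n).coeFn_toLp 2 volume] with ξ h1
      rw [h1, Pi.add_apply, ← smul_add, add_sub_cancel]
    rw [eLpNorm_congr_ae h1]
    refine (eLpNorm_add_le (hm.smul (Lp.memLp x).1)
      (hm.smul ((ψ n).continuous.aestronglyMeasurable.sub (Lp.memLp x).1)) one_le_two).trans ?_
    refine add_le_add le_rfl ?_
    have h2 := eLpNorm_const_smul (2 * Real.pi) (fun ξ => φ n ξ - W ξ • x ξ) 2
      (volume : Measure R3)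
    rw [Real.enorm_of_nonneg (by positivity)] at h2
    rw [← h2]
    refine eLpNorm_mono fun ξ => ?_
    change ‖(2 * Real.pi * ‖ξ‖) • (ψ n ξ - x ξ)‖ ≤ ‖(2 * Real.pi) • (φ n ξ - W ξ • x ξ)‖
    rw [hdiff, smul_smul, norm_smul, norm_smul, mul_assoc, norm_mul]
    gcongr
    refine mul_le_of_le_one_right (norm_nonneg _) ?_
    rw [Real.norm_of_nonneg (mul_nonneg (norm_nonneg _) (hV0 ξ))]
    exact hVle2 ξ
  let u : ℕ → 𝓢(R3, CMat3) := fun n => 𝓕⁻ (ψ n)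
  have hFu : ∀ n, 𝓕 (u n) = ψ n := fun n => FourierTransform.fourier_fourierInv_eq (ψ n)
  have hulim : Tendsto (fun n => (u n).toLp 2 volume) atTop
      (𝓝 (complexify.compLpL 2 volume S)) := by
    have h1 := ((Lp.fourierTransformₗᵢ R3 CMat3).symm.continuous.tendsto x).comp hψlim
    have h2 : (Lp.fourierTransformₗᵢ R3 CMat3).symm x = complexify.compLpL 2 volume S :=
      (Lp.fourierTransformₗᵢ R3 CMat3).symm_apply_apply _
    rw [h2] at h1
    refine h1.congr fun n => ?_
    exact SchwartzMap.toLp_fourierInv_eq (ψ n)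
  obtain ⟨ns, hns, hae⟩ := (tendstoInMeasure_of_tendsto_Lp hulim).exists_seq_tendsto_ae
  have hS6 : eLpNorm S 6 volume = eLpNorm (complexify.compLpL 2 volume S) 6 volume := by
    refine eLpNorm_congr_norm_ae ?_
    filter_upwards [complexify.coeFn_compLpL (p := 2) (μ := volume) S] with y hy
    rw [hy, norm_complexify]
  rw [hS6]
  refine (Lp.eLpNorm_lim_le_liminf_eLpNorm (fun n => (Lp.memLp ((u (ns n)).toLp 2 volume)).1) _
    hae).trans ?_
  have hub : Tendsto (fun n => C * (dirichlet x ^ (1 / 2 : ℝ) + ENNReal.ofReal (2 * Real.pi) *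
        eLpNorm (fun ξ => φ (ns n) ξ - W ξ • x ξ) 2 volume)) atTop
      (𝓝 (C * (dirichlet x ^ (1 / 2 : ℝ) + ENNReal.ofReal (2 * Real.pi) * 0))) := by
    refine ENNReal.Tendsto.const_mul (tendsto_const_nhds.add (ENNReal.Tendsto.const_mul
      (hφlim.comp hns.tendsto_atTop) (Or.inr ENNReal.ofReal_ne_top))) (Or.inr ENNReal.coe_ne_top)
  refine (liminf_le_liminf (Eventually.of_forall fun n => ?_)).trans
    (hub.liminf_eq.trans_le (by rw [mul_zero, add_zero]; rfl))
  rw [eLpNorm_congr_ae ((u (ns n)).coeFn_toLp 2 volume)]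
  refine (eLpNorm_six_le_fderiv ((u (ns n)).smooth 1) ((u (ns n)).memLp 2 volume)).trans ?_
  refine mul_le_mul_right (le_trans ?_ (hgrad (ns n))) C
  have h3 := eLpNorm_fderiv_sq_le (u (ns n))
  rw [hFu] at h3
  have h4 := ENNReal.rpow_le_rpow h3 (by norm_num : (0 : ℝ) ≤ 1 / 2)
  rwa [← ENNReal.rpow_natCast, ← ENNReal.rpow_mul, show ((2 : ℕ) : ℝ) * (1 / 2) = 1 by norm_num,
    ENNReal.rpow_one] at h4

/-- The embedding of `H¹` into `L⁴`, from `‖S‖₄⁸ ≤ ‖S‖₂² ‖S‖₆⁶`. -/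
lemma exists_eLpNorm_four_le : ∃ C : ℝ≥0, ∀ S : MatL2, hOneSq S < ∞ →
    eLpNorm S 4 volume ≤ C * hOneSq S ^ (1 / 2 : ℝ) := by
  set C := SNormLESNormFDerivOfEqConst CMat3 (volume : Measure R3) 2 with hC
  refine ⟨C ^ (3 / 4 : ℝ), fun S hS => ?_⟩
  have h6 := eLpNorm_six_le S hS
  have hm : AEMeasurable (fun x => ‖S x‖ₑ) volume := (Lp.memLp S).1.enorm
  have e4 : ∫⁻ x, ‖S x‖ₑ ^ 4 = eLpNorm S 4 volume ^ 4 := by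
    have := eLpNorm_nnreal_pow_eq_lintegral (μ := (volume : Measure R3)) (f := S)
      (p := 4) (by norm_num)
    simpa using this.symm
  have e6 : ∫⁻ x, ‖S x‖ₑ ^ 6 = eLpNorm S 6 volume ^ 6 := by
    have := eLpNorm_nnreal_pow_eq_lintegral (μ := (volume : Measure R3)) (f := S)
      (p := 6) (by norm_num)
    simpa using this.symm
  have hle : hDotOneSq S ≤ hOneSq S := by rw [hOneSq_eq]; exact le_add_self
  have hle2 : ‖S‖ₑ ^ 2 ≤ hOneSq S := by rw [hOneSq_eq]; exact le_self_add
  have hcs := lintegral_mul_sq_le (μ := (volume : Measure R3)) (u := fun x => ‖S x‖ₑ ^ 2)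
    (v := fun x => ‖S x‖ₑ ^ 2) (hm.pow_const 2) (hm.pow_const 2)
  have ea : ∀ x, ‖S x‖ₑ ^ 2 * ‖S x‖ₑ ^ 2 = ‖S x‖ₑ ^ 4 := fun x => by ring
  have eb : ∀ x, ‖S x‖ₑ ^ 2 * (‖S x‖ₑ ^ 2) ^ 2 = ‖S x‖ₑ ^ 6 := fun x => by ring
  simp only [ea, eb] at hcs
  rw [e4, e6, ← eLpNorm_two_sq, ← Lp.enorm_def] at hcs
  have h8 : eLpNorm S 4 volume ^ 8 ≤ (C : ℝ≥0∞) ^ 6 * hOneSq S ^ 4 := by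
    calc eLpNorm S 4 volume ^ 8 = (eLpNorm S 4 volume ^ 4) ^ 2 := by ring
      _ ≤ ‖S‖ₑ ^ 2 * eLpNorm S 6 volume ^ 6 := hcs
      _ ≤ hOneSq S * (C * hOneSq S ^ (1 / 2 : ℝ)) ^ 6 := by
          gcongr
          exact h6.trans (by gcongr)
      _ = (C : ℝ≥0∞) ^ 6 * hOneSq S ^ 4 := by
          rw [mul_pow, ← ENNReal.rpow_mul_natCast]
          norm_num
          ring
  rw [← ENNReal.pow_le_pow_left_iff (n := 8) (by norm_num), mul_pow, ← ENNReal.rpow_mul_natCast,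
    ENNReal.coe_rpow_of_nonneg _ (by norm_num), ← ENNReal.rpow_mul_natCast]
  norm_num
  exact h8

/-! ### The matrix square and the determinant -/

/-- The matrix product, as a continuous bilinear map. -/
def matMul : Mat3 →L[ℝ] Mat3 →L[ℝ] Mat3 :=
  LinearMap.toContinuousLinearMap
    ((LinearMap.toContinuousLinearMap : (Mat3 →ₗ[ℝ] Mat3) ≃ₗ[ℝ] (Mat3 →L[ℝ] Mat3)).toLinearMap ∘ₗ
      LinearMap.mk₂ ℝ
        (fun A B : Mat3 => (WithLp.toLp 2 fun p => ∑ k : Fin 3, A (p.1, k) * B (k, p.2) : Mat3))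
        (fun A A' B => by ext p; simp [add_mul, Finset.sum_add_distrib])
        (fun c A B => by ext p; simp [Finset.mul_sum, mul_assoc])
        (fun A B B' => by ext p; simp [mul_add, Finset.sum_add_distrib])
        (fun c A B => by ext p; simp [Finset.mul_sum, mul_left_comm]))

lemma matMul_apply (A B : Mat3) (p : Fin 3 × Fin 3) :
    matMul A B p = ∑ k : Fin 3, A (p.1, k) * B (k, p.2) := rfl

lemma sqField_eq (S : MatL2) (x : R3) : sqField S x = matMul (S x) (S x) := rfl

/-- Symmetric matrices. -/
def IsSymm3 (A : Mat3) : Prop := ∀ i j : Fin 3, A (i, j) = A (j, i)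

lemma inner_matMul_eq (A B D : Mat3) :
    inner ℝ (matMul A B) D = ∑ i : Fin 3, ∑ j : Fin 3, (∑ k : Fin 3, A (i, k) * B (k, j)) *
      D (i, j) := by
  rw [PiLp.inner_apply, Fintype.sum_prod_type]
  refine Finset.sum_congr rfl fun i _ => Finset.sum_congr rfl fun j _ => ?_
  rw [matMul_apply, real_inner_comm]
  rfl

lemma inner_matMul_comm {A B D : Mat3} (hA : IsSymm3 A) (hB : IsSymm3 B) (hD : IsSymm3 D) :
    inner ℝ (matMul A B) D = inner ℝ (matMul B A) D := by
  simp only [inner_matMul_eq, Fin.sum_univ_three]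
  rw [hA 1 0, hA 2 0, hA 2 1, hB 1 0, hB 2 0, hB 2 1, hD 1 0, hD 2 0, hD 2 1]
  ring

lemma inner_matMul_right_comm {A B D : Mat3} (hA : IsSymm3 A) (hB : IsSymm3 B) (hD : IsSymm3 D) :
    inner ℝ (matMul A B) D = inner ℝ (matMul A D) B := by
  simp only [inner_matMul_eq, Fin.sum_univ_three]
  rw [hA 1 0, hA 2 0, hA 2 1, hB 1 0, hB 2 0, hB 2 1, hD 1 0, hD 2 0, hD 2 1]
  ring

/-- Taylor's formula for the cubic form `tr A³` on symmetric matrices. -/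
lemma inner_matMul_expand {A B : Mat3} (hA : IsSymm3 A) (hB : IsSymm3 B) :
    inner ℝ (matMul B B) B - inner ℝ (matMul A A) A - 3 * inner ℝ (matMul A A) (B - A) =
      inner ℝ (matMul ((2 : ℝ) • A + B) (B - A)) (B - A) := by
  have h1 := inner_matMul_right_comm hA hB hA
  have h2 := inner_matMul_comm hB hA hB
  have h3 := inner_matMul_right_comm hB hA hB
  have h4 := inner_matMul_comm hB hA hA
  simp only [map_add, map_smul, map_sub, add_apply, smul_apply, inner_add_left,
    inner_sub_left, inner_sub_right, inner_smul_left, conj_trivial] at *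
  linarith

lemma det_eq_inner_matMul {A : Mat3} (hA : IsSymm3 A) (htr : ∑ i : Fin 3, A (i, i) = 0) :
    (Matrix.of fun i j => A (i, j)).det = 1 / 3 * inner ℝ (matMul A A) A := by
  simp only [Fin.sum_univ_three] at htr
  have h : A (2, 2) = -A (0, 0) - A (1, 1) := by linarith
  simp only [inner_matMul_eq, Fin.sum_univ_three, Matrix.det_fin_three, Matrix.of_apply]
  rw [hA 1 0, hA 2 0, hA 2 1, h]
  ring

/-- The determinant bound `-det A ≤ ½ |A|² λ₂⁺` for symmetric trace-free matrices: a negative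
determinant requires `λ₂ > 0`, and then `-λ₁ λ₃ ≤ ½ (λ₁² + λ₃²)`. -/
lemma neg_det_le {A : Mat3} (hA : IsSymm3 A) (htr : ∑ i : Fin 3, A (i, i) = 0) :
    -(Matrix.of fun i j => A (i, j)).det ≤
      1 / 2 * ‖A‖ ^ 2 * max 0 (midEigenvalue (Matrix.of fun i j => A (i, j))) := by
  set M : Matrix (Fin 3) (Fin 3) ℝ := Matrix.of fun i j => A (i, j) with hM
  have hH : M.IsHermitian := by
    ext i j
    simp [hM, hA i j]
  have hmid : midEigenvalue M = hH.eigenvalues₀ ⟨1, by simp⟩ := by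
    rw [midEigenvalue, dif_pos hH]
  -- In the decreasing order of `eigenvalues₀`, `l 1` is the middle eigenvalue.
  set l : Fin 3 → ℝ := fun i => hH.eigenvalues₀ (finCongr (Fintype.card_fin 3).symm i) with hl
  have hmid' : midEigenvalue M = l 1 := hmid
  have h01 : l 1 ≤ l 0 := hH.eigenvalues₀_antitone (by simp)
  have h12 : l 2 ≤ l 1 := hH.eigenvalues₀_antitone (by simp)
  let e : Fin 3 ≃ Fin 3 := (Fintype.equivOfCardEq (Fintype.card_fin _)).symm.trans
    (finCongr (Fintype.card_fin 3))
  have hprod : ∀ c : ℝ, ∏ i, (c - hH.eigenvalues i) = (c - l 0) * (c - l 1) * (c - l 2) := by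
    intro c
    rw [← Fin.prod_univ_three (fun i => c - l i)]
    exact Fintype.prod_equiv e _ _ fun i => rfl
  have hchar : ∀ c : ℝ, (Matrix.scalar (Fin 3) c - M).det = (c - l 0) * (c - l 1) * (c - l 2) := by
    intro c
    rw [← hprod, ← Matrix.eval_charpoly, hH.charpoly_eq]
    simp [Polynomial.eval_prod]
  -- The values of the characteristic polynomial at `0, 1, -1` determine its coefficients.
  have c0 := hchar 0
  have c1 := hchar 1
  have c2 := hchar (-1)
  have hn : ‖A‖ ^ 2 = ∑ i : Fin 3, ∑ j : Fin 3, A (i, j) ^ 2 := by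
    rw [EuclideanSpace.norm_sq_eq, Fintype.sum_prod_type]
    simp
  simp only [Fin.sum_univ_three] at htr hn
  have h : A (2, 2) = -A (0, 0) - A (1, 1) := by linarith
  have hN : ‖A‖ ^ 2 = l 0 ^ 2 + l 1 ^ 2 + l 2 ^ 2 ∧ M.det = l 0 * l 1 * l 2 := by
    rw [hn]
    simp only [Matrix.det_fin_three, hM, Matrix.of_apply, Matrix.sub_apply, Matrix.scalar_apply,
      Matrix.diagonal_apply] at c0 c1 c2 ⊢
    simp only [Fin.isValue, ↓reduceIte, Fin.reduceEq, one_ne_zero, zero_ne_one, zero_sub]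
      at c0 c1 c2
    rw [hA 1 0, hA 2 0, hA 2 1, h] at *
    have t0 : l 0 + l 1 + l 2 = 0 := by linarith
    have t1 : l 2 = -l 0 - l 1 := by linarith
    rw [t1] at c0 c1 c2 ⊢
    constructor <;> linarith
  rw [hmid', hN.1, hN.2]
  rcases le_total (l 1) 0 with h1 | h1
  · have h2 : l 2 ≤ 0 := h12.trans h1
    have t0 : 0 ≤ l 0 := by
      have := hchar 0
      by_contra h0
      push Not at h0
      have hlt : l 0 + l 1 + l 2 < 0 := by linarith
      have htr' := hH.trace_eq_sum_eigenvalues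
      have : ∑ i, hH.eigenvalues i = l 0 + l 1 + l 2 := by
        rw [← Fin.sum_univ_three]
        exact Fintype.sum_equiv e _ _ fun i => rfl
      simp only [RCLike.ofReal_real_eq_id, id_eq, this, Matrix.trace_fin_three, hM,
        Matrix.of_apply] at htr'
      linarith
    rw [max_eq_left h1, mul_zero, neg_nonpos, mul_assoc]
    exact mul_nonneg t0 (mul_nonneg_of_nonpos_of_nonpos h1 h2)
  · rw [max_eq_right h1]
    nlinarith [mul_nonneg h1 (sq_nonneg (l 0 + l 2)), mul_nonneg h1 (sq_nonneg (l 1))]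

/-! ### The quadratic nonlinearity -/

/-- `S²` as an integrable field. -/
def sqL1 (S : MatL2) : Lp Mat3 1 (volume : Measure R3) := matMul.holder 1 S S

lemma coeFn_sqL1 (S : MatL2) : sqL1 S =ᵐ[volume] sqField S := matMul.coeFn_holder S S

lemma heat_sqField (t : ℝ) (S : MatL2) : heat t (sqField S) = heat t (sqL1 S) :=
  (heat_congr (coeFn_sqL1 S)).symm

lemma norm_sqL1_le (S : MatL2) : ‖sqL1 S‖ ≤ ‖matMul‖ * ‖S‖ ^ 2 := by
  rw [sq, ← mul_assoc]
  exact matMul.norm_holder_apply_apply_le S S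

lemma norm_sqL1_sub_le (S U : MatL2) :
    ‖sqL1 S - sqL1 U‖ ≤ ‖matMul‖ * (‖S‖ + ‖U‖) * ‖S - U‖ := by
  have e : sqL1 S - sqL1 U = matMul.holderL volume 2 2 1 S (S - U) +
      matMul.holderL volume 2 2 1 (S - U) U := by
    rw [map_sub, map_sub, sub_apply, sub_add_sub_cancel]
    rfl
  rw [e]
  calc _ ≤ ‖matMul‖ * ‖S‖ * ‖S - U‖ + ‖matMul‖ * ‖S - U‖ * ‖U‖ :=
        (norm_add_le _ _).trans (add_le_add (matMul.norm_holder_apply_apply_le _ _)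
          (matMul.norm_holder_apply_apply_le _ _))
    _ = _ := by ring

lemma continuous_sqL1 : Continuous sqL1 := by
  have : sqL1 = fun S => matMul.holderL volume 2 2 1 S S := rfl
  rw [this]
  fun_prop

instance : ENNReal.HolderTriple 4 4 2 := ⟨by
  rw [← two_mul, show (4 : ℝ≥0∞) = 2 * 2 by norm_num, ENNReal.mul_inv (by simp) (by simp),
    ← mul_assoc, ENNReal.mul_inv_cancel (by simp) (by simp), one_mul]⟩

instance : Fact ((1 : ℝ≥0∞) ≤ 4) := ⟨by norm_num⟩

open Classical in
/-- A square-integrable field as an element of `L⁴`; the value is `0` if it does not belong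
to `L⁴`. -/
def toL4 (S : MatL2) : Lp Mat3 4 (volume : Measure R3) :=
  if h : MemLp S 4 (volume : Measure R3) then h.toLp S else 0

lemma memLp_four {S : MatL2} (hS : hOneSq S < ∞) : MemLp S 4 (volume : Measure R3) := by
  obtain ⟨C, hC⟩ := exists_eLpNorm_four_le
  exact ⟨(Lp.memLp S).1, (hC S hS).trans_lt (ENNReal.mul_lt_top ENNReal.coe_lt_top
    (ENNReal.rpow_lt_top_of_nonneg (by norm_num) hS.ne))⟩

lemma coeFn_toL4 {S : MatL2} (hS : hOneSq S < ∞) : toL4 S =ᵐ[volume] S := by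
  rw [toL4, dif_pos (memLp_four hS)]
  exact MemLp.coeFn_toLp _

/-- `S²` as a square-integrable field, for `S` in `L²` and `L⁴`; the value for other `S` is `0`. -/
def sqL2 (S : MatL2) : MatL2 := matMul.holder 2 (toL4 S) (toL4 S)

lemma coeFn_sqL2 {S : MatL2} (hS : hOneSq S < ∞) : sqL2 S =ᵐ[volume] sqField S := by
  filter_upwards [matMul.coeFn_holder (r := 2) (toL4 S) (toL4 S), coeFn_toL4 hS] with x h1 h2
  rw [sqL2, h1, h2, sqField_eq]

lemma enorm_toL4_sub {S U : MatL2} (hS : hOneSq S < ∞) (hU : hOneSq U < ∞) :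
    ‖toL4 S - toL4 U‖ₑ = eLpNorm (S - U : MatL2) 4 volume := by
  rw [Lp.enorm_def]
  refine eLpNorm_congr_ae ?_
  filter_upwards [Lp.coeFn_sub (toL4 S) (toL4 U), Lp.coeFn_sub S U, coeFn_toL4 hS, coeFn_toL4 hU]
    with x h1 h2 h3 h4
  rw [h1, h2, Pi.sub_apply, Pi.sub_apply, h3, h4]

/-- The cubic functional `∫ tr S³ = ⟨S², S⟩`, for `S` in `H¹`. -/
def cubic (S : MatL2) : ℝ := inner ℝ (sqL2 S) S

lemma ae_isSymm3 {S : MatL2} (hS : S ∈ L2st) : ∀ᵐ x, IsSymm3 (S x) := hS.1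

/-- `det A = (1/3) tr A³` for trace-free matrices. -/
lemma integral_det {S : MatL2} (hS : S ∈ L2st) (h1 : hOneSq S < ∞) :
    ∫ x, (matrixAt S x).det = 1 / 3 * cubic S := by
  rw [cubic, L2.inner_def, ← integral_const_mul]
  refine integral_congr_ae ?_
  filter_upwards [ae_isSymm3 hS, hS.2.1, coeFn_sqL2 h1] with x h2 h3 h4
  rw [h4, sqField_eq, ← det_eq_inner_matMul h2 h3]
  rfl

/-- Taylor's formula for the cubic functional; the remainder is quadratic in the increment. -/
lemma cubic_expand {S U : MatL2} (hS : S ∈ L2st) (hU : U ∈ L2st) (h1 : hOneSq S < ∞)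
    (h2 : hOneSq U < ∞) :
    cubic U - cubic S - 3 * inner ℝ (sqL2 S) (U - S) =
      inner ℝ (matMul.holder 2 ((2 : ℝ) • toL4 S + toL4 U) (toL4 U - toL4 S)) (U - S) := by
  simp only [cubic, L2.inner_def]
  have hi : Integrable fun x => (inner ℝ (sqL2 U x) (U x) - inner ℝ (sqL2 S x) (S x) : ℝ) :=
    (L2.integrable_inner (𝕜 := ℝ) _ _).sub (L2.integrable_inner _ _)
  rw [← integral_const_mul, ← integral_sub (L2.integrable_inner _ _) (L2.integrable_inner _ _),
    ← integral_sub hi ((L2.integrable_inner _ _).const_mul _)]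
  refine integral_congr_ae ?_
  filter_upwards [ae_isSymm3 hS, ae_isSymm3 hU, coeFn_sqL2 h1, coeFn_sqL2 h2, Lp.coeFn_sub U S,
    matMul.coeFn_holder (r := 2) ((2 : ℝ) • toL4 S + toL4 U) (toL4 U - toL4 S),
    Lp.coeFn_add ((2 : ℝ) • toL4 S) (toL4 U), Lp.coeFn_smul (2 : ℝ) (toL4 S),
    Lp.coeFn_sub (toL4 U) (toL4 S), coeFn_toL4 h1, coeFn_toL4 h2]
    with x a1 a2 a3 a4 a5 a6 a7 a8 a9 a10 a11
  rw [a3, a4, a5, a6, a7, a9, Pi.add_apply, a8, Pi.sub_apply, Pi.sub_apply, Pi.smul_apply, a10, a11,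
    sqField_eq, sqField_eq, inner_matMul_expand a1 a2]

lemma abs_cubic_expand_le {S U : MatL2} (hS : S ∈ L2st) (hU : U ∈ L2st) (h1 : hOneSq S < ∞)
    (h2 : hOneSq U < ∞) :
    |cubic U - cubic S - 3 * inner ℝ (sqL2 S) (U - S)| ≤
      ‖matMul‖ * ‖(2 : ℝ) • toL4 S + toL4 U‖ * ‖toL4 U - toL4 S‖ * ‖U - S‖ := by
  rw [cubic_expand hS hU h1 h2]
  exact (abs_real_inner_le_norm _ _).trans (mul_le_mul_of_nonneg_right
    (matMul.norm_holder_apply_apply_le _ _) (norm_nonneg _))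

/-! ### Continuity in `H¹` -/

lemma dirichlet_le_hOneSq (S : MatL2) : dirichlet (ftL2 S) ≤ hOneSq S := by
  rw [hOneSq_eq, ← hDotOneSq_eq]; exact le_add_self

section Continuity

variable {T : ℝ≥0∞} {S : ℝ → MatL2}

lemma ContinuousInH1st.dirichlet_lt_top (h : ContinuousInH1st T S) {t : ℝ}
    (ht : t ∈ timeInterval T) : dirichlet (ftL2 (S t)) < ∞ :=
  (dirichlet_le_hOneSq _).trans_lt (h t ht).2.1

lemma ContinuousInH1st.continuousOn_toL4 (h : ContinuousInH1st T S) :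
    ContinuousOn (fun t => toL4 (S t)) (timeInterval T) := by
  obtain ⟨C, hC⟩ := exists_eLpNorm_four_le
  intro t ht
  have hlim := (h t ht).2.2
  rw [ContinuousWithinAt, tendsto_iff_edist_tendsto_0]
  have h1 : Tendsto (fun s => (C : ℝ≥0∞) * hOneSq (S s - S t) ^ (1 / 2 : ℝ))
      (𝓝[timeInterval T] t) (𝓝 (C * 0 ^ (1 / 2 : ℝ))) :=
    ENNReal.Tendsto.const_mul ((ENNReal.continuous_rpow_const.tendsto 0).comp hlim)
      (Or.inr ENNReal.coe_ne_top)
  rw [ENNReal.zero_rpow_of_pos (by norm_num), mul_zero] at h1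
  refine tendsto_of_tendsto_of_tendsto_of_le_of_le' tendsto_const_nhds h1
    (Eventually.of_forall fun _ => bot_le) ?_
  filter_upwards [hlim.eventually (gt_mem_nhds ENNReal.zero_lt_top), self_mem_nhdsWithin]
    with s hs hsT
  rw [edist_eq_enorm_sub, enorm_toL4_sub (h s hsT).2.1 (h t ht).2.1]
  exact hC _ hs

lemma ContinuousInH1st.continuousOn_sqL2 (h : ContinuousInH1st T S) :
    ContinuousOn (fun t => sqL2 (S t)) (timeInterval T) := by
  have : (fun t => sqL2 (S t)) = fun t => matMul.holderL volume 4 4 2 (toL4 (S t)) (toL4 (S t)) :=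
    rfl
  rw [this]
  have := h.continuousOn_toL4
  fun_prop

lemma ContinuousInH1st.continuousOn_dirichlet (h : ContinuousInH1st T S) :
    ContinuousOn (fun t => (dirichlet (ftL2 (S t))).toReal) (timeInterval T) := by
  intro t ht
  have hroot : ∀ x : FreqL2, dirichlet x ^ (1 / 2 : ℝ) =
      eLpNorm (fun ξ => (2 * Real.pi * ‖ξ‖) • x ξ) 2 volume := fun x => by
    rw [dirichlet_eq_eLpNorm_sq, ← ENNReal.rpow_natCast, ← ENNReal.rpow_mul]; norm_num
  have hm : AEStronglyMeasurable (fun ξ : R3 => 2 * Real.pi * ‖ξ‖) volume :=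
    (by fun_prop : Continuous fun ξ : R3 => 2 * Real.pi * ‖ξ‖).aestronglyMeasurable
  -- The square root of the Dirichlet integral is a seminorm.
  have htri : ∀ x y : FreqL2, dirichlet (x + y) ^ (1 / 2 : ℝ) ≤
      dirichlet x ^ (1 / 2 : ℝ) + dirichlet y ^ (1 / 2 : ℝ) := fun x y => by
    rw [hroot, hroot, hroot]
    have : (fun ξ => (2 * Real.pi * ‖ξ‖) • (x + y) ξ) =ᵐ[volume]
        (fun ξ => (2 * Real.pi * ‖ξ‖) • x ξ) + fun ξ => (2 * Real.pi * ‖ξ‖) • y ξ := by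
      filter_upwards [Lp.coeFn_add x y] with ξ hξ
      rw [hξ, Pi.add_apply, Pi.add_apply, smul_add]
    rw [eLpNorm_congr_ae this]
    exact eLpNorm_add_le (hm.smul (Lp.memLp x).1) (hm.smul (Lp.memLp y).1) one_le_two
  have hneg : ∀ x : FreqL2, dirichlet (-x) = dirichlet x := fun x => by
    refine lintegral_congr_ae ?_
    filter_upwards [Lp.coeFn_neg x] with ξ hξ
    rw [hξ, Pi.neg_apply, enorm_neg]
  set g : ℝ → ℝ≥0∞ := fun s => dirichlet (ftL2 (S s)) ^ (1 / 2 : ℝ) with hg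
  have hdlim : Tendsto (fun s => dirichlet (ftL2 (S s - S t)) ^ (1 / 2 : ℝ))
      (𝓝[timeInterval T] t) (𝓝 0) := by
    have h1 : Tendsto (fun s => hOneSq (S s - S t) ^ (1 / 2 : ℝ)) (𝓝[timeInterval T] t)
        (𝓝 (0 ^ (1 / 2 : ℝ))) := (ENNReal.continuous_rpow_const.tendsto 0).comp (h t ht).2.2
    rw [ENNReal.zero_rpow_of_pos (by norm_num)] at h1
    exact tendsto_of_tendsto_of_tendsto_of_le_of_le tendsto_const_nhds h1 (fun _ => bot_le)
      fun s => ENNReal.rpow_le_rpow (dirichlet_le_hOneSq _) (by norm_num)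
  have hgfin : g t ≠ ∞ := (ENNReal.rpow_lt_top_of_nonneg (by norm_num)
    (h.dirichlet_lt_top ht).ne).ne
  have hglim : Tendsto g (𝓝[timeInterval T] t) (𝓝 (g t)) := by
    have hup : Tendsto (fun s => g t + dirichlet (ftL2 (S s - S t)) ^ (1 / 2 : ℝ))
        (𝓝[timeInterval T] t) (𝓝 (g t)) := by
      simpa using tendsto_const_nhds.add hdlim
    have hlo : Tendsto (fun s => g t - dirichlet (ftL2 (S s - S t)) ^ (1 / 2 : ℝ))
        (𝓝[timeInterval T] t) (𝓝 (g t)) := by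
      simpa using ENNReal.Tendsto.sub tendsto_const_nhds hdlim (Or.inl hgfin)
    refine tendsto_of_tendsto_of_tendsto_of_le_of_le hlo hup (fun s => ?_) fun s => ?_
    · rw [tsub_le_iff_right]
      have := htri (ftL2 (S s)) (-ftL2 (S s - S t))
      rw [hneg, ← map_neg, ← map_add, neg_sub, add_sub_cancel] at this
      exact this
    · have := htri (ftL2 (S t)) (ftL2 (S s - S t))
      rwa [← map_add, add_sub_cancel] at this
  have hsq : ∀ s, dirichlet (ftL2 (S s)) = g s ^ (2 : ℝ) := fun s => by
    rw [hg, ← ENNReal.rpow_mul]; norm_num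
  have h3 : Tendsto (fun s => dirichlet (ftL2 (S s))) (𝓝[timeInterval T] t)
      (𝓝 (dirichlet (ftL2 (S t)))) := by
    simp only [hsq]
    exact (ENNReal.continuous_rpow_const.tendsto _).comp hglim
  exact (ENNReal.tendsto_toReal (h.dirichlet_lt_top ht).ne).comp h3

end Continuity

/-! ### The Duhamel integral in `L²` -/

lemma norm_Pst_le (S : MatL2) : ‖Pst S‖ ≤ ‖S‖ := L2st.norm_starProjection_apply_le S

lemma Pst_mem (S : MatL2) : Pst S ∈ L2st := Submodule.starProjection_apply_mem _ _

/-- The integrand `P_st e^{τΔ} (w(t - τ)²)` of the Duhamel integral at time `t`. -/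
def duhamelTerm (w : ℝ → MatL2) (t τ : ℝ) : MatL2 := Pst (heat τ (sqL1 (w (t - τ))))

/-- The constant in `‖P_st e^{τΔ} (S²)‖₂ ≤ κ τ^{-3/4} ‖S‖₂²`. -/
def kappa : ℝ := (8 * Real.pi) ^ (-(3 / 4) : ℝ) * ‖matMul‖

lemma kappa_nonneg : 0 ≤ kappa := by unfold kappa; positivity

lemma norm_heat_le_kappa {τ b : ℝ} (hτ : 0 < τ) {g : Lp Mat3 1 (volume : Measure R3)}
    (hg : ‖g‖ ≤ ‖matMul‖ * b) : ‖Pst (heat τ g)‖ ≤ kappa * b * τ ^ (-(3 / 4) : ℝ) := by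
  refine (norm_Pst_le _).trans ((norm_heat_le_L1 hτ g).trans ?_)
  rw [Real.mul_rpow (by positivity) hτ.le, kappa]
  calc _ ≤ (8 * Real.pi) ^ (-(3 / 4) : ℝ) * τ ^ (-(3 / 4) : ℝ) * (‖matMul‖ * b) := by gcongr
    _ = _ := by ring

lemma norm_duhamelTerm_le {w : ℝ → MatL2} {t τ N : ℝ} (hτ : 0 < τ) (hN : ‖w (t - τ)‖ ≤ N) :
    ‖duhamelTerm w t τ‖ ≤ kappa * N ^ 2 * τ ^ (-(3 / 4) : ℝ) := by
  refine norm_heat_le_kappa hτ ((norm_sqL1_le _).trans ?_)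
  gcongr

lemma norm_duhamelTerm_sub_le {w v : ℝ → MatL2} {t τ N d : ℝ} (hτ : 0 < τ)
    (hw : ‖w (t - τ)‖ ≤ N) (hv : ‖v (t - τ)‖ ≤ N) (hd : ‖w (t - τ) - v (t - τ)‖ ≤ d) :
    ‖duhamelTerm w t τ - duhamelTerm v t τ‖ ≤ kappa * (2 * N * d) * τ ^ (-(3 / 4) : ℝ) := by
  rw [duhamelTerm, duhamelTerm, ← map_sub, heat_sub_L1 hτ (L1.integrable_coeFn _)
    (L1.integrable_coeFn _), heat_congr (Lp.coeFn_sub _ _).symm]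
  refine norm_heat_le_kappa hτ ((norm_sqL1_sub_le _ _).trans ?_)
  rw [mul_assoc]
  have hN : 0 ≤ N := (norm_nonneg _).trans hw
  have : ‖w (t - τ)‖ + ‖v (t - τ)‖ ≤ 2 * N := by linarith
  gcongr

lemma tendsto_duhamelTerm {ι : Type*} {l : Filter ι} {w : ℝ → MatL2} {t τ : ι → ℝ} {t₀ τ₀ : ℝ}
    (hτ₀ : 0 < τ₀) (hw : ContinuousAt w (t₀ - τ₀)) (ht : Tendsto t l (𝓝 t₀))
    (hτ : Tendsto τ l (𝓝 τ₀)) :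
    Tendsto (fun i => duhamelTerm w (t i) (τ i)) l (𝓝 (duhamelTerm w t₀ τ₀)) :=
  (Pst.continuous.tendsto _).comp (tendsto_heat_L1 hτ₀ hτ
    ((continuous_sqL1.tendsto _).comp (hw.tendsto.comp (ht.sub hτ))))

section

variable {w : ℝ → MatL2} {a N : ℝ}

/-- A jump of `w` at one time `a` is allowed, as it occurs when a solution is glued to
another field. -/
lemma aestronglyMeasurable_duhamelTerm (hw : ∀ s, s ≠ a → ContinuousAt w s) (t : ℝ) :
    AEStronglyMeasurable (duhamelTerm w t) (volume.restrict (Set.Ioi 0)) := by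
  have h1 : ContinuousOn (duhamelTerm w t) (Set.Ioi 0 \ {t - a}) := fun τ hτ =>
    (tendsto_duhamelTerm hτ.1 (hw _ fun h => hτ.2 (by rw [Set.mem_singleton_iff, ← h]; ring))
      tendsto_const_nhds tendsto_id).mono_left nhdsWithin_le_nhds
  have h2 := h1.aestronglyMeasurable (μ := volume)
    (measurableSet_Ioi.diff (measurableSet_singleton _))
  rwa [Measure.restrict_congr_set (sdiff_null_ae_eq_self (measure_singleton _))] at h2

lemma intervalIntegrable_rpow_kernel {b c d : ℝ} :
    IntervalIntegrable (fun τ : ℝ => b * τ ^ (-(3 / 4) : ℝ)) volume c d :=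
  (intervalIntegral.intervalIntegrable_rpow' (by norm_num)).const_mul _

lemma intervalIntegrable_duhamelTerm (hw : ∀ s, s ≠ a → ContinuousAt w s)
    (hN : ∀ s, ‖w s‖ ≤ N) (t : ℝ) {c d : ℝ} (hc : 0 ≤ c) (hcd : c ≤ d) :
    IntervalIntegrable (duhamelTerm w t) volume c d := by
  have hsub : Set.uIoc c d ⊆ Set.Ioi 0 := by
    rw [Set.uIoc_of_le hcd]; exact fun τ hτ => hc.trans_lt hτ.1
  refine (intervalIntegrable_rpow_kernel (b := kappa * N ^ 2)).mono_fun
    ((aestronglyMeasurable_duhamelTerm hw t).mono_set hsub) ?_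
  refine (ae_restrict_iff' measurableSet_uIoc).2 (Eventually.of_forall fun τ hτ => ?_)
  exact (norm_duhamelTerm_le (hsub hτ) (hN _)).trans (le_abs_self _)

lemma norm_integral_le_kernel {g : ℝ → MatL2} {b c d : ℝ} (hb : 0 ≤ b) (hc : 0 ≤ c) (hcd : c ≤ d)
    (hg : ∀ τ ∈ Set.Ioo c d, ‖g τ‖ ≤ b * τ ^ (-(3 / 4) : ℝ)) :
    ‖∫ τ in c..d, g τ‖ ≤ 4 * b * d ^ (1 / 4 : ℝ) := by
  have hae : ∀ᵐ τ : ℝ, τ ∈ Set.Ioc c d → ‖g τ‖ ≤ b * τ ^ (-(3 / 4) : ℝ) := by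
    filter_upwards [Measure.ae_ne volume d] with τ hτ h
    exact hg τ ⟨h.1, lt_of_le_of_ne h.2 hτ⟩
  refine (intervalIntegral.norm_integral_le_of_norm_le hcd hae
    intervalIntegrable_rpow_kernel).trans ?_
  rw [intervalIntegral.integral_const_mul, integral_rpow (Or.inl (by norm_num))]
  norm_num
  have : 0 ≤ c ^ (1 / 4 : ℝ) := by positivity
  nlinarith

/-- Continuity of the Duhamel integral at positive and zero times, by dominated convergence after
extending the integrand by `0` to a fixed interval. -/
lemma continuousOn_duhamel (hw : ∀ s, s ≠ a → ContinuousAt w s) (hN : ∀ s, ‖w s‖ ≤ N) (t₁ : ℝ) :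
    ContinuousOn (fun t => ∫ τ in (0 : ℝ)..t, duhamelTerm w t τ) (Set.Icc 0 t₁) := by
  have e : ∀ t ∈ Set.Icc 0 t₁, ∫ τ in (0 : ℝ)..t, duhamelTerm w t τ =
      ∫ τ in (0 : ℝ)..t₁, (Set.Iic t).indicator (duhamelTerm w t) τ := fun t ht => by
    rw [intervalIntegral.integral_of_le ht.1, intervalIntegral.integral_of_le (ht.1.trans ht.2),
      setIntegral_indicator measurableSet_Iic]
    congr 2
    ext τ
    simp only [Set.mem_Ioc, Set.mem_inter_iff, Set.mem_Iic]
    exact ⟨fun h => ⟨⟨h.1, h.2.trans ht.2⟩, h.2⟩, fun h => ⟨h.1.1, h.2⟩⟩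
  refine ContinuousOn.congr (fun t₀ ht₀ => ?_) e
  have hsub : Set.uIoc 0 t₁ ⊆ Set.Ioi 0 := by
    rw [Set.uIoc_of_le (ht₀.1.trans ht₀.2)]; exact fun τ hτ => hτ.1
  refine intervalIntegral.continuousWithinAt_of_dominated_interval
    (bound := fun τ => kappa * N ^ 2 * τ ^ (-(3 / 4) : ℝ)) (Eventually.of_forall fun t => ?_)
    (Eventually.of_forall fun t => Eventually.of_forall fun τ hτ => ?_)
    intervalIntegrable_rpow_kernel ?_
  · exact ((aestronglyMeasurable_duhamelTerm hw t).mono_set hsub).indicator measurableSet_Iic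
  · refine (norm_indicator_le_norm_self _ _).trans (norm_duhamelTerm_le (hsub hτ) (hN _))
  · filter_upwards [Measure.ae_ne volume t₀, Measure.ae_ne volume (t₀ - a)] with τ h1 h2 hτ
    rcases lt_or_gt_of_ne h1 with h | h
    · have h3 : Tendsto (fun t => duhamelTerm w t τ) (𝓝[Set.Icc 0 t₁] t₀)
          (𝓝 (duhamelTerm w t₀ τ)) :=
        tendsto_duhamelTerm (hsub hτ) (hw _ fun h => h2 (by rw [← h]; ring))
          nhdsWithin_le_nhds tendsto_const_nhds
      rw [ContinuousWithinAt, Set.indicator_of_mem (by exact h.le)]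
      refine h3.congr' ?_
      filter_upwards [nhdsWithin_le_nhds (lt_mem_nhds h)] with t ht
      rw [Set.indicator_of_mem (by exact le_of_lt ht)]
    · rw [ContinuousWithinAt, Set.indicator_of_notMem (by exact not_le.2 h)]
      refine tendsto_const_nhds.congr' ?_
      filter_upwards [nhdsWithin_le_nhds (gt_mem_nhds h)] with t ht
      rw [Set.indicator_of_notMem (by exact not_le.2 ht)]

end

/-! ### Mild solutions in `H¹` as forced heat flows -/

lemma timeInterval_mono_mem {T : ℝ≥0∞} {s t : ℝ} (ht : t ∈ timeInterval T) (hs : 0 ≤ s)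
    (hst : s ≤ t) : s ∈ timeInterval T :=
  ⟨hs, (ENNReal.ofReal_le_ofReal hst).trans_lt ht.2⟩

lemma Icc_subset_timeInterval {T : ℝ≥0∞} {t : ℝ} (ht : t ∈ timeInterval T) :
    Set.Icc 0 t ⊆ timeInterval T := fun _ hs => timeInterval_mono_mem ht hs.1 hs.2

/-- The forcing `-(2/3) P_st(S²)` of the heat equation, on the frequency side. -/
def forcing (S : MatL2) : FreqL2 := -(2 / 3 : ℝ) • ftL2 (Pst (sqL2 S))

/-- For `S` in `H¹`, the heat semigroup and `P_st` can be exchanged in the Duhamel integrand. -/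
lemma mulOp_forcing {τ : ℝ} (hτ : 0 < τ) {S : MatL2} (hS : hOneSq S < ∞) :
    mulOp (heatSymbol τ) (forcing S) = -(2 / 3 : ℝ) • ftL2 (Pst (heat τ (sqL1 S))) := by
  rw [forcing, map_smul, ← ftL2_heat hτ, ← Pst_heat hτ, ← heat_sqField,
    heat_congr (coeFn_sqL2 hS)]

section

variable {T : ℝ≥0∞} {S : ℝ → MatL2}

lemma ContinuousInH1st.continuousOn_forcing (h : ContinuousInH1st T S) :
    ContinuousOn (fun t => forcing (S t)) (timeInterval T) :=
  ((ftL2.comp Pst).continuous.comp_continuousOn h.continuousOn_sqL2).const_smul (-(2 / 3 : ℝ))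

/-- A continuous and bounded extension to all times of the solution on `[0, t₁]`. -/
lemma exists_clamp (hS : ContinuousOn S (timeInterval T)) {t₁ : ℝ} (ht₁ : t₁ ∈ timeInterval T) :
    ∃ w : ℝ → MatL2, Continuous w ∧ (∃ N, ∀ s, ‖w s‖ ≤ N) ∧ ∀ s ∈ Set.Icc 0 t₁, w s = S s := by
  have hc : ContinuousOn S (Set.Icc 0 t₁) := hS.mono (Icc_subset_timeInterval ht₁)
  refine ⟨Set.IccExtend ht₁.1 ((Set.Icc 0 t₁).domRestrict S), hc.domRestrict.Icc_extend', ?_,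
    fun s hs => Set.IccExtend_of_mem _ _ hs⟩
  obtain ⟨N, hN⟩ := isCompact_Icc.exists_bound_of_continuousOn hc
  exact ⟨N, fun s => hN _ (Subtype.coe_prop _)⟩

/-- On the frequency side, a mild solution in `H¹` solves Duhamel's formula for the heat equation
with a square-integrable forcing. -/
lemma IsMildSolution.forced_heat (hm : IsMildSolution T S) (h : ContinuousInH1st T S) {t₁ : ℝ}
    (ht₁ : t₁ ∈ timeInterval T) : ∀ t ∈ Set.Ioc 0 t₁,
      IntervalIntegrable (fun τ => mulOp (heatSymbol τ) (forcing (S (t - τ)))) volume 0 t ∧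
      ftL2 (S t) = mulOp (heatSymbol t) (ftL2 (S 0)) +
        ∫ τ in (0 : ℝ)..t, mulOp (heatSymbol τ) (forcing (S (t - τ))) := by
  obtain ⟨w, hw, ⟨N, hN⟩, hwS⟩ := exists_clamp hm.continuousOn ht₁
  intro t ht
  have hmem : ∀ τ ∈ Set.Icc 0 t, t - τ ∈ Set.Icc 0 t₁ := fun τ hτ =>
    ⟨by linarith [hτ.2], by linarith [hτ.1, ht.2]⟩
  have hi := intervalIntegrable_duhamelTerm (a := 0) (fun s _ => hw.continuousAt) hN t le_rfl
    ht.1.le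
  have e : Set.EqOn (fun τ => -(2 / 3 : ℝ) • ftL2 (duhamelTerm w t τ))
      (fun τ => mulOp (heatSymbol τ) (forcing (S (t - τ)))) (Set.uIoc 0 t) := fun τ hτ => by
    rw [Set.uIoc_of_le ht.1.le] at hτ
    have hτ' := hmem τ ⟨hτ.1.le, hτ.2⟩
    simp only
    rw [mulOp_forcing hτ.1 (h _ (Icc_subset_timeInterval ht₁ hτ')).2.1, duhamelTerm, hwS _ hτ']
  refine ⟨?_, ?_⟩
  · refine (IntervalIntegrable.congr e ?_)
    have hi' : IntervalIntegrable (fun τ => ftL2 (duhamelTerm w t τ)) volume 0 t :=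
      ⟨ftL2.integrable_comp hi.1, ftL2.integrable_comp hi.2⟩
    exact hi'.smul (-(2 / 3 : ℝ))
  · rw [← intervalIntegral.integral_congr_ae (Eventually.of_forall fun τ hτ => e hτ),
      intervalIntegral.integral_smul, ftL2.intervalIntegral_comp_comm hi,
      hm.duhamel t (timeInterval_mono_mem ht₁ ht.1.le ht.2) ht.1, map_sub, map_smul,
      ftL2_heat ht.1, neg_smul, ← sub_eq_add_neg]
    congr 3
    refine intervalIntegral.integral_congr fun τ hτ => ?_
    rw [Set.uIcc_of_le ht.1.le] at hτ
    rw [duhamelTerm, heat_sqField, hwS _ (hmem τ hτ)]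

end

/-! ### A differential inequality for the enstrophy -/

section RealODE

variable {E J K : ℝ → ℝ} {b : ℝ}

/-- The inequality `K' ≥ (3/2) (E')² / E`, with `E' = J + K`, propagates `K ≥ K₀ (E / E₀)^{3/2}`:
at a contact point `K' ≥ (3/2) (E' / E) E' > (3/2) (K / E) E'`, the derivative of the right side. -/
lemma le_of_slope_bound (hEc : ContinuousOn E (Set.Icc 0 b)) (hKc : ContinuousOn K (Set.Icc 0 b))
    (hE' : ∀ x ∈ Set.Ico 0 b, HasDerivWithinAt E (J x + K x) (Set.Ici x) x)
    (hE : ∀ x ∈ Set.Icc 0 b, 0 < E x) (hJ : ∀ x ∈ Set.Icc 0 b, 0 < J x)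
    (hslope : ∀ x ∈ Set.Ico 0 b, ∀ c < 3 / 2 * (J x + K x) ^ 2 / E x,
      ∀ᶠ z in 𝓝[>] x, c < slope K x z)
    (hK0 : 0 < K 0) : ∀ x ∈ Set.Icc 0 b, K 0 * E 0 ^ (-(3 / 2) : ℝ) * E x ^ (3 / 2 : ℝ) ≤ K x := by
  intro x hx
  have h0 : (0 : ℝ) ∈ Set.Icc 0 b := ⟨le_rfl, hx.1.trans hx.2⟩
  set k := K 0 * E 0 ^ (-(3 / 2) : ℝ) with hk
  have hkpos : 0 < k := mul_pos hK0 (Real.rpow_pos_of_pos (hE 0 h0) _)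
  have key := image_le_of_liminf_slope_right_lt_deriv_boundary' (a := 0) (b := b)
    (f := fun y => -K y) (f' := fun y => -(3 / 2 * (J y + K y) ^ 2 / E y))
    (B := fun y => -(k * E y ^ (3 / 2 : ℝ)))
    (B' := fun y => -(k * ((J y + K y) * (3 / 2) * E y ^ ((3 / 2 : ℝ) - 1)))) hKc.neg ?_ ?_ ?_ ?_ ?_
  · have := key hx
    linarith
  · intro y hy c hc
    refine Eventually.frequently ?_
    filter_upwards [hslope y hy (-c) (by linarith)] with z hz
    have : slope (fun y => -K y) y z = -slope K y z := by
      simp only [slope, vsub_eq_sub, smul_eq_mul]; ring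
    linarith
  · simp only [hk]
    rw [mul_assoc, ← Real.rpow_add (hE 0 h0)]
    norm_num
  · exact ((hEc.rpow_const fun y hy => Or.inl (hE y hy).ne').const_mul _).neg |>.congr
      fun y _ => rfl
  · intro y hy
    exact (((hE' y hy).rpow_const (p := 3 / 2)
      (Or.inl (hE y (Set.Ico_subset_Icc_self hy)).ne')).const_mul k).neg
  · intro y hy hcontact
    have hEy := hE y (Set.Ico_subset_Icc_self hy)
    have hJy := hJ y (Set.Ico_subset_Icc_self hy)
    have hKy : K y = k * E y ^ (3 / 2 : ℝ) := neg_injective hcontact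
    have hKpos : 0 < K y := by rw [hKy]; positivity
    have e : k * E y ^ ((3 / 2 : ℝ) - 1) = K y / E y := by
      rw [hKy, Real.rpow_sub_one hEy.ne', mul_div_assoc]
    rw [neg_lt_neg_iff]
    calc k * ((J y + K y) * (3 / 2) * E y ^ ((3 / 2 : ℝ) - 1))
        = 3 / 2 * (J y + K y) * (k * E y ^ ((3 / 2 : ℝ) - 1)) := by ring
      _ = 3 / 2 * ((J y + K y) * K y) / E y := by rw [e]; ring
      _ < 3 / 2 * (J y + K y) ^ 2 / E y := by
          rw [sq]
          gcongr
          linarith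

/-- `(E^{-1/2})' = -½ E^{-3/2} (J + K) < -½ K₀ E₀^{-3/2}`, since `J + K > K ≥ K₀ (E / E₀)^{3/2}`. -/
lemma strictAntiOn_of_slope_bound (hEc : ContinuousOn E (Set.Icc 0 b))
    (hKc : ContinuousOn K (Set.Icc 0 b))
    (hE' : ∀ x ∈ Set.Ico 0 b, HasDerivWithinAt E (J x + K x) (Set.Ici x) x)
    (hE'' : ∀ x ∈ Set.Ioo 0 b, HasDerivAt E (J x + K x) x)
    (hE : ∀ x ∈ Set.Icc 0 b, 0 < E x) (hJ : ∀ x ∈ Set.Icc 0 b, 0 < J x)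
    (hslope : ∀ x ∈ Set.Ico 0 b, ∀ c < 3 / 2 * (J x + K x) ^ 2 / E x,
      ∀ᶠ z in 𝓝[>] x, c < slope K x z)
    (hK0 : 0 < K 0) :
    StrictAntiOn (fun t => E t ^ (-(1 / 2) : ℝ) + K 0 * E 0 ^ (-(3 / 2) : ℝ) / 2 * t)
      (Set.Icc 0 b) := by
  have hlow := le_of_slope_bound hEc hKc hE' hE hJ hslope hK0
  set k := K 0 * E 0 ^ (-(3 / 2) : ℝ) with hk
  refine strictAntiOn_of_deriv_neg (convex_Icc 0 b) ?_ fun x hx => ?_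
  · exact (hEc.rpow_const fun y hy => Or.inl (hE y hy).ne').add (by fun_prop)
  · rw [interior_Icc] at hx
    have hx' := Set.Ioo_subset_Icc_self hx
    have hEx := hE x hx'
    have hd : HasDerivAt (fun t => E t ^ (-(1 / 2) : ℝ) + k / 2 * t)
        ((J x + K x) * (-(1 / 2)) * E x ^ ((-(1 / 2) : ℝ) - 1) + k / 2 * 1) x :=
      ((hE'' x hx).rpow_const (Or.inl hEx.ne')).add ((hasDerivAt_id x).const_mul (k / 2))
    rw [hd.deriv]
    have h1 : k * (E x ^ (3 / 2 : ℝ) * E x ^ ((-(1 / 2) : ℝ) - 1)) = k := by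
      rw [← Real.rpow_add hEx]; norm_num
    have h2 : 0 < E x ^ ((-(1 / 2) : ℝ) - 1) := Real.rpow_pos_of_pos hEx _
    have h3 : k * E x ^ (3 / 2 : ℝ) < J x + K x := by linarith [hlow x hx', hJ x hx']
    nlinarith [mul_lt_mul_of_pos_right h3 h2]

end RealODE

/-! ### The blowup quantity along the flow -/

/-- The Dirichlet energy `‖S‖²_{Ḣ¹}` as a real number. -/
def dirichletReal (S : MatL2) : ℝ := (hDotOneSq S).toReal

lemma blowupQuantity_eq {S : MatL2} (hS : S ∈ L2st) (h1 : hOneSq S < ∞) :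
    blowupQuantity S = -3 * dirichletReal S - 4 / 3 * cubic S := by
  rw [blowupQuantity, integral_det hS h1, dirichletReal]; ring

/-- The projection drops out when the forcing is tested with elements of the constraint space. -/
lemma rip_forcing (S : MatL2) {U : MatL2} (hU : U ∈ L2st) :
    rip (forcing S) (ftL2 U) = -(2 / 3) * inner ℝ (sqL2 S) U := by
  rw [forcing, rip_comm, rip_smul_right, rip_comm, rip, re_inner_ftL2]
  congr 1
  have := Submodule.starProjection_inner_eq_zero (K := L2st) (sqL2 S) U hU
  rw [inner_sub_left, sub_eq_zero] at this
  exact this.symm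

lemma eq_zero_of_dirichlet_eq_zero {x : FreqL2} (h : dirichlet x = 0) : x = 0 := by
  rw [dirichlet, lintegral_eq_zero_iff'] at h
  · refine Lp.ext ?_
    filter_upwards [h, Lp.coeFn_zero CMat3 2 (volume : Measure R3), Measure.ae_ne volume (0 : R3)]
      with ξ h1 h2 h3
    rw [h2]
    have hpos : 0 < freqSq ξ := by
      have := norm_pos_iff.2 h3
      unfold freqSq; positivity
    simpa [hpos, not_le.2 hpos] using h1
  · exact (ENNReal.measurable_ofReal.comp continuous_freqSq.measurable).aemeasurable.mul
      ((Lp.memLp x).1.enorm.pow_const 2)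

section Flow

variable {T : ℝ≥0∞} {S : ℝ → MatL2}

lemma exists_gt_mem_timeInterval {t : ℝ} (ht : t ∈ timeInterval T) :
    ∃ t₁ ∈ timeInterval T, t < t₁ := by
  obtain ⟨c, hc1, hc2⟩ := exists_between ht.2
  have hc : c ≠ ∞ := (hc2.trans_le le_top).ne
  refine ⟨c.toReal, ⟨ENNReal.toReal_nonneg, by rwa [ENNReal.ofReal_toReal hc]⟩, ?_⟩
  exact (ENNReal.ofReal_lt_iff_lt_toReal ht.1 hc).1 hc1

lemma ContinuousInH1st.continuousOn_blowupQuantity (h : ContinuousInH1st T S)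
    (hm : IsMildSolution T S) :
    ContinuousOn (fun t => blowupQuantity (S t)) (timeInterval T) := by
  have h1 : ContinuousOn (fun t => -3 * dirichletReal (S t) - 4 / 3 * cubic (S t))
      (timeInterval T) :=
    (h.continuousOn_dirichlet.const_mul (-3)).sub
      ((h.continuousOn_sqL2.inner hm.continuousOn).const_mul (4 / 3))
  exact h1.congr fun t ht => blowupQuantity_eq (h t ht).1 (h t ht).2.1

/-- The integrated form of `E' = -2 J - (4/3) ∫ tr S³ = J + K`. -/
lemma enstrophy_sub_eq (h : ContinuousInH1st T S) (hm : IsMildSolution T S) {r s : ℝ} (hr : 0 ≤ r)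
    (hrs : r ≤ s) (hs : s ∈ timeInterval T) :
    enstrophy (S s) - enstrophy (S r) =
      ∫ t in r..s, (dirichletReal (S t) + blowupQuantity (S t)) := by
  have hsub := Icc_subset_timeInterval hs
  have hfl := hm.forced_heat h hs
  have := energy_identity (x := fun t => ftL2 (S t)) (f := fun t => forcing (S t)) hs.1
    (h.continuousOn_forcing.mono hsub) (fun t ht => (hfl t ht).1) (fun t ht => (hfl t ht).2)
    (ftL2.continuous.comp_continuousOn (hm.continuousOn.mono hsub))
    (fun t ht => h.dirichlet_lt_top (hsub ht)) (h.continuousOn_dirichlet.mono hsub)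
    hr hrs le_rfl
  simp only [norm_ftL2] at this
  rw [enstrophy, enstrophy, this]
  refine intervalIntegral.integral_congr fun t ht => ?_
  rw [Set.uIcc_of_le hrs] at ht
  have htT := hsub ⟨hr.trans ht.1, ht.2⟩
  rw [rip_forcing _ (h t htT).1, blowupQuantity_eq (h t htT).1 (h t htT).2.1, cubic, dirichletReal,
    hDotOneSq_eq]
  ring

/-- The equation is the gradient flow of `-K / 6`, where `K = blowupQuantity`, so that `K` increases
at the rate `6 ‖∂ₜS‖²`; in the form of difference quotients. -/
lemma blowupQuantity_sub_ge (h : ContinuousInH1st T S) (hm : IsMildSolution T S) {r η ε : ℝ}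
    (hr : r ∈ timeInterval T) (hη : 0 < η) (hη1 : η ≤ 1) (hε : 0 < ε) :
    ∀ᶠ z in 𝓝[>] r, (6 - 4 * η) * (‖S z - S r‖ / (z - r)) ^ 2 - ε ≤
      slope (fun t => blowupQuantity (S t)) r z := by
  obtain ⟨t₁, ht₁, hrt₁⟩ := exists_gt_mem_timeInterval hr
  have hsub := Icc_subset_timeInterval ht₁
  have hfl := hm.forced_heat h ht₁
  -- The error `3 ε'² / η` of freezing the forcing is half of `ε`; the other half is for the cubic
  -- remainder `ω ‖δ‖`, where `ω → 0`.
  set ε' := Real.sqrt (η * ε / 6) with hε'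
  have hε'pos : 0 < ε' := Real.sqrt_pos.2 (by positivity)
  have hε'sq : ε' ^ 2 = η * ε / 6 := Real.sq_sqrt (by positivity)
  have hnhds : 𝓝[>] r ≤ 𝓝[timeInterval T] r := by
    refine le_inf nhdsWithin_le_nhds ?_
    rw [le_principal_iff]
    filter_upwards [Ioo_mem_nhdsGT hrt₁] with z hz
    exact hsub ⟨hr.1.trans hz.1.le, hz.2.le⟩
  obtain ⟨d, hd, hfd⟩ := Metric.continuousWithinAt_iff.1 (h.continuousOn_forcing r hr) ε' hε'pos
  have hω : Tendsto (fun z => 4 / 3 * (‖matMul‖ * ‖(2 : ℝ) • toL4 (S r) + toL4 (S z)‖ *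
      ‖toL4 (S z) - toL4 (S r)‖)) (𝓝[>] r) (𝓝 0) := by
    have h4 : Tendsto (fun z => toL4 (S z)) (𝓝[>] r) (𝓝 (toL4 (S r))) :=
      (h.continuousOn_toL4 r hr).mono_left hnhds
    have := ((tendsto_const_nhds (x := ‖matMul‖)).mul
      ((tendsto_const_nhds (x := (2 : ℝ) • toL4 (S r))).add h4).norm).mul
      (h4.sub_const (toL4 (S r))).norm
    simpa using this.const_mul (4 / 3)
  have hω2 := (hω.pow 2).eventually (gt_mem_nhds
    (show (0 : ℝ) ^ 2 < 2 * η * ε by rw [zero_pow two_ne_zero]; positivity))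
  filter_upwards [Ioo_mem_nhdsGT hrt₁, Ioo_mem_nhdsGT (show r < r + d by linarith), hω2]
    with z hz hzd hzω
  have hzT : z ∈ timeInterval T := hsub ⟨hr.1.trans hz.1.le, hz.2.le⟩
  set ω := 4 / 3 * (‖matMul‖ * ‖(2 : ℝ) • toL4 (S r) + toL4 (S z)‖ *
      ‖toL4 (S z) - toL4 (S r)‖) with hωdef
  have hh : 0 < z - r := sub_pos.2 hz.1
  have hgrad := gradient_flow_le (x := fun t => ftL2 (S t)) (f := fun t => forcing (S t)) ht₁.1
    (h.continuousOn_forcing.mono hsub) (fun t ht => (hfl t ht).1) (fun t ht => (hfl t ht).2)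
    (fun t ht => h.dirichlet_lt_top (hsub ht)) hr.1 hh (by linarith [hz.2]) hη (by linarith)
    (ε := ε') (fun t ht => by
      rw [← dist_eq_norm]
      refine (hfd (hsub ⟨hr.1.trans ht.1, by linarith [ht.2, hz.2]⟩) ?_).le
      rw [Real.dist_eq, abs_of_nonneg (by linarith [ht.1])]
      linarith [ht.2, hzd.2])
  simp only [add_sub_cancel, ← map_sub, norm_ftL2] at hgrad
  rw [rip_forcing _ (L2st.sub_mem (h z hzT).1 (h r hr).1)] at hgrad
  have hcub := (abs_le.1 (abs_cubic_expand_le (h r hr).1 (h z hzT).1 (h r hr).2.1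
    (h z hzT).2.1)).2
  rw [slope_def_field, le_div_iff₀ hh, blowupQuantity_eq (h z hzT).1 (h z hzT).2.1,
    blowupQuantity_eq (h r hr).1 (h r hr).2.1]
  have e1 : dirichletReal (S z) = (dirichlet (ftL2 (S z))).toReal := rfl
  have e2 : dirichletReal (S r) = (dirichlet (ftL2 (S r))).toReal := rfl
  rw [← e1, ← e2] at hgrad
  set v := ‖S z - S r‖ with hv
  set k := z - r with hk
  have e3 : ((6 - 4 * η) * (v / k) ^ 2 - ε) * k = (6 - 4 * η) * (v ^ 2 / k) - ε * k := by
    field_simp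
  have e4 : k * ε' ^ 2 / η = k * ε / 6 := by rw [hε'sq]; field_simp
  have e5 : ω * v ≤ η * (v ^ 2 / k) + ε / 2 * k := by
    have h1 : 0 ≤ (2 * η * (v / k) - ω) ^ 2 := sq_nonneg _
    have h2 : ω * (v / k) ≤ η * (v / k) ^ 2 + ε / 2 := by
      have : 4 * η * (ω * (v / k)) ≤ 4 * η * (η * (v / k) ^ 2 + ε / 2) := by nlinarith
      exact le_of_mul_le_mul_left this (by positivity)
    have h3 := mul_le_mul_of_nonneg_right h2 hh.le
    have h4 : ω * (v / k) * k = ω * v := by field_simp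
    have h5 : (η * (v / k) ^ 2 + ε / 2) * k = η * (v ^ 2 / k) + ε / 2 * k := by field_simp
    linarith
  have e6 : 4 / 3 * (‖matMul‖ * ‖(2 : ℝ) • toL4 (S r) + toL4 (S z)‖ *
      ‖toL4 (S z) - toL4 (S r)‖ * v) = ω * v := by rw [hωdef]; ring
  rw [e3]
  rw [e4] at hgrad
  linarith

/-- The lower Dini derivative of `K` is nonnegative. -/
lemma blowupQuantity_ge (h : ContinuousInH1st T S) (hm : IsMildSolution T S) {t : ℝ}
    (ht : t ∈ timeInterval T) : blowupQuantity (S 0) ≤ blowupQuantity (S t) := by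
  have hsub := Icc_subset_timeInterval ht
  have := image_le_of_liminf_slope_right_le_deriv_boundary (a := 0) (b := t)
    (f := fun s => -blowupQuantity (S s)) (B := fun _ => -blowupQuantity (S 0)) (B' := fun _ => 0)
    ((h.continuousOn_blowupQuantity hm).mono hsub).neg le_rfl continuousOn_const
    (fun s _ => hasDerivWithinAt_const _ _ _) (fun s hs c hc => ?_) ⟨ht.1, le_rfl⟩
  · linarith
  · refine Eventually.frequently ?_
    filter_upwards [blowupQuantity_sub_ge h hm (hsub (Set.Ico_subset_Icc_self hs)) one_pos le_rfl
      (half_pos hc)] with z hz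
    have e : slope (fun y => -blowupQuantity (S y)) s z =
        -slope (fun y => blowupQuantity (S y)) s z := by
      simp only [slope, vsub_eq_sub, smul_eq_mul]; ring
    have := sq_nonneg (‖S z - S s‖ / (z - s))
    linarith

/-- A field with `K > 0` does not vanish. -/
lemma enstrophy_pos_of_blowupQuantity_pos {U : MatL2} (hU : U ∈ L2st) (h1 : hOneSq U < ∞)
    (hpos : 0 < blowupQuantity U) : 0 < enstrophy U ∧ 0 < dirichletReal U := by
  have hne : U ≠ 0 := by
    rintro rfl
    have : cubic 0 = 0 := inner_zero_right _
    rw [blowupQuantity_eq hU h1, this, mul_zero, sub_zero] at hpos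
    have : 0 ≤ dirichletReal 0 := ENNReal.toReal_nonneg
    linarith
  refine ⟨pow_pos (norm_pos_iff.2 hne) 2, ENNReal.toReal_pos (fun h0 => hne ?_) ?_⟩
  · have := eq_zero_of_dirichlet_eq_zero h0
    rwa [← map_zero ftL2, ftL2_injective.eq_iff] at this
  · exact ((dirichlet_le_hOneSq U).trans_lt h1).ne

lemma ContinuousInH1st.continuousOn_deriv_enstrophy (h : ContinuousInH1st T S)
    (hm : IsMildSolution T S) :
    ContinuousOn (fun t => dirichletReal (S t) + blowupQuantity (S t)) (timeInterval T) :=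
  ContinuousOn.add h.continuousOn_dirichlet (h.continuousOn_blowupQuantity hm)

lemma hasDerivAt_enstrophy (h : ContinuousInH1st T S) (hm : IsMildSolution T S) {x : ℝ}
    (hx0 : 0 < x) (hx : x ∈ timeInterval T) : HasDerivAt (fun t => enstrophy (S t))
      (dirichletReal (S x) + blowupQuantity (S x)) x := by
  obtain ⟨b', hb', hxb'⟩ := exists_gt_mem_timeInterval hx
  have hsub' := Icc_subset_timeInterval hb'
  have hg := (h.continuousOn_deriv_enstrophy hm).mono hsub'
  have hnh : Set.Icc 0 b' ∈ 𝓝 x := Icc_mem_nhds hx0 hxb'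
  refine HasDerivAt.congr_of_eventuallyEq ((intervalIntegral.integral_hasDerivAt_right
    ((hg.mono (Set.Icc_subset_Icc_right hxb'.le)).intervalIntegrable_of_Icc hx0.le)
    (hg.stronglyMeasurableAtFilter_nhdsWithin measurableSet_Icc x |>.filter_mono
      (by rw [nhdsWithin_eq_nhds.2 hnh])) (hg.continuousAt hnh)).const_add (enstrophy (S 0))) ?_
  filter_upwards [hnh] with s hs
  rw [← enstrophy_sub_eq h hm le_rfl hs.1 (hsub' hs)]; ring

lemma strictAntiOn_enstrophy_rpow (h : ContinuousInH1st T S) (hm : IsMildSolution T S)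
    (hpos : 0 < blowupQuantity (S 0)) {b : ℝ} (hb : b ∈ timeInterval T) :
    StrictAntiOn (fun t => enstrophy (S t) ^ (-(1 / 2) : ℝ) +
      blowupQuantity (S 0) * enstrophy (S 0) ^ (-(3 / 2) : ℝ) / 2 * t) (Set.Icc 0 b) := by
  obtain ⟨b', hb', hbb'⟩ := exists_gt_mem_timeInterval hb
  have hsub := Icc_subset_timeInterval hb
  have hsub' := Icc_subset_timeInterval hb'
  have hEc : ContinuousOn (fun t => enstrophy (S t)) (timeInterval T) :=
    hm.continuousOn.norm.pow 2
  have hposE : ∀ t ∈ Set.Icc 0 b, 0 < enstrophy (S t) ∧ 0 < dirichletReal (S t) := fun t ht =>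
    enstrophy_pos_of_blowupQuantity_pos (h t (hsub ht)).1 (h t (hsub ht)).2.1
      (hpos.trans_le (blowupQuantity_ge h hm (hsub ht)))
  have hg : ContinuousOn (fun t => dirichletReal (S t) + blowupQuantity (S t)) (Set.Icc 0 b') :=
    (h.continuousOn_deriv_enstrophy hm).mono hsub'
  have hEq : ∀ s ∈ Set.Icc 0 b', enstrophy (S s) = enstrophy (S 0) +
      ∫ t in (0 : ℝ)..s, (dirichletReal (S t) + blowupQuantity (S t)) := fun s hs => by
    rw [← enstrophy_sub_eq h hm le_rfl hs.1 (hsub' hs)]; ring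
  have hE'' : ∀ x ∈ Set.Ioo 0 b', HasDerivAt (fun t => enstrophy (S t))
      (dirichletReal (S x) + blowupQuantity (S x)) x := fun x hx =>
    hasDerivAt_enstrophy h hm hx.1 (hsub' (Set.Ioo_subset_Icc_self hx))
  have hE' : ∀ x ∈ Set.Ico 0 b', HasDerivWithinAt (fun t => enstrophy (S t))
      (dirichletReal (S x) + blowupQuantity (S x)) (Set.Ici x) x := fun x hx => by
    have hnh : Set.Icc 0 b' ∈ 𝓝[>] x := mem_of_superset (Ioo_mem_nhdsGT hx.2) fun s hs =>
      ⟨hx.1.trans hs.1.le, hs.2.le⟩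
    have hnh' : Set.Icc 0 b' ∈ 𝓝[≥] x := mem_of_superset (Ico_mem_nhdsGE hx.2) fun s hs =>
      ⟨hx.1.trans hs.1, hs.2.le⟩
    have hx' : x ∈ Set.Icc 0 b' := Set.Ico_subset_Icc_self hx
    refine HasDerivWithinAt.congr_of_eventuallyEq ((intervalIntegral.integral_hasDerivWithinAt_right
      ((hg.mono (Set.Icc_subset_Icc_right hx.2.le)).intervalIntegrable_of_Icc hx.1)
      (s := Set.Ici x) (t := Set.Ioi x)
      ((hg.stronglyMeasurableAtFilter_nhdsWithin measurableSet_Icc x).filter_mono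
        (nhdsWithin_le_iff.2 hnh))
      ((hg x hx').mono_of_mem_nhdsWithin hnh)).const_add (enstrophy (S 0))) ?_ (hEq x hx')
    filter_upwards [hnh'] with s hs using hEq s hs
  refine strictAntiOn_of_slope_bound (E := fun t => enstrophy (S t))
    (J := fun t => dirichletReal (S t)) (K := fun t => blowupQuantity (S t)) (hEc.mono hsub)
    ((h.continuousOn_blowupQuantity hm).mono hsub) (fun x hx => hE' x ⟨hx.1, hx.2.trans hbb'⟩)
    (fun x hx => hE'' x ⟨hx.1, hx.2.trans hbb'⟩) (fun t ht => (hposE t ht).1)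
    (fun t ht => (hposE t ht).2) (fun x hx c hc => ?_) hpos
  -- `‖S(z) - S(x)‖ ≥ |E(z) - E(x)| / (‖S(z)‖ + ‖S(x)‖)` bounds the dissipation below.
  have hxI := Set.Ico_subset_Icc_self hx
  have hxT := hsub hxI
  have hEx := (hposE x hxI).1
  set D := dirichletReal (S x) + blowupQuantity (S x) with hD
  set A := D ^ 2 / (4 * enstrophy (S x)) with hA
  have hA0 : 0 ≤ A := by positivity
  have hcA : c < 6 * A := by
    refine hc.trans_eq ?_
    rw [hA]; field_simp; ring
  set g := 6 * A - c with hgdef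
  have hgpos : 0 < g := sub_pos.2 hcA
  set η := min 1 (g / (12 * (A + 1))) with hη
  have hη0 : 0 < η := lt_min one_pos (by positivity)
  have hη1 : η ≤ 1 := min_le_left _ _
  have hηA : 4 * η * A ≤ g / 3 := by
    have h1 : η ≤ g / (12 * (A + 1)) := min_le_right _ _
    rw [le_div_iff₀ (by positivity)] at h1
    nlinarith
  have hSx : 0 < ‖S x‖ := by
    by_contra h0
    have : ‖S x‖ = 0 := le_antisymm (not_lt.1 h0) (norm_nonneg _)
    rw [enstrophy, this] at hEx
    simp at hEx
  have hlimS : Tendsto S (𝓝[>] x) (𝓝 (S x)) := by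
    refine (hm.continuousOn x hxT).mono_left (nhdsWithin_le_iff.2 ?_)
    exact mem_of_superset (Ioo_mem_nhdsGT (hx.2.trans hbb')) fun s hs =>
      hsub' ⟨hx.1.trans hs.1.le, hs.2.le⟩
  have hlim : Tendsto (fun z => (6 - 4 * η) *
      (slope (fun t => enstrophy (S t)) x z / (‖S z‖ + ‖S x‖)) ^ 2 - g / 3) (𝓝[>] x)
      (𝓝 ((6 - 4 * η) * (D / (‖S x‖ + ‖S x‖)) ^ 2 - g / 3)) := by
    have h1 := (hasDerivWithinAt_iff_tendsto_slope' Set.self_notMem_Ioi).1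
      ((hE' x ⟨hx.1, hx.2.trans hbb'⟩).mono Set.Ioi_subset_Ici_self)
    exact (((h1.div (hlimS.norm.add_const _) (by positivity)).pow 2).const_mul _).sub_const _
  have hval : c < (6 - 4 * η) * (D / (‖S x‖ + ‖S x‖)) ^ 2 - g / 3 := by
    have : (D / (‖S x‖ + ‖S x‖)) ^ 2 = A := by
      rw [hA, enstrophy, ← two_mul, div_pow, mul_pow]; norm_num
    rw [this]
    nlinarith
  filter_upwards [hlim.eventually (lt_mem_nhds hval), self_mem_nhdsWithin,
    blowupQuantity_sub_ge h hm hxT hη0 hη1 (show 0 < g / 3 by positivity)] with z hz hzx hslope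
  refine (hz.trans_le ?_).trans_le hslope
  have hzx' : 0 < z - x := sub_pos.2 hzx
  have hden : 0 < ‖S z‖ + ‖S x‖ := by positivity
  have hle : |slope (fun t => enstrophy (S t)) x z / (‖S z‖ + ‖S x‖)| ≤
      |‖S z - S x‖ / (z - x)| := by
    rw [slope_def_field, abs_div, abs_div, abs_div, abs_of_pos hden, abs_of_pos hzx', abs_norm,
      div_div, mul_comm, ← div_div]
    gcongr
    rw [div_le_iff₀ hden, enstrophy, enstrophy, sq_sub_sq, abs_mul, abs_of_pos hden, mul_comm]
    gcongr
    exact abs_norm_sub_norm_le _ _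
  have := sq_le_sq.2 hle
  have h6 : 0 ≤ 6 - 4 * η := by linarith
  gcongr ?_ - _
  exact mul_le_mul_of_nonneg_left this h6

/-! ### The lower bound for the enstrophy and the bound for the existence time -/

lemma enstrophy_lower_bound (h : ContinuousInH1st T S) (hm : IsMildSolution T S)
    (hpos : 0 < blowupQuantity (S 0)) {r₀ : ℝ}
    (hr₀ : r₀ = blowupQuantity (S 0) / (2 * enstrophy (S 0))) {t : ℝ} (ht : t ∈ timeInterval T)
    (ht0 : 0 < t) : enstrophy (S 0) / (1 - r₀ * t) ^ 2 < enstrophy (S t) := by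
  have h0 : (0 : ℝ) ∈ timeInterval T := timeInterval_mono_mem ht le_rfl ht0.le
  have hE0 := (enstrophy_pos_of_blowupQuantity_pos (h 0 h0).1 (h 0 h0).2.1 hpos).1
  have hEt := (enstrophy_pos_of_blowupQuantity_pos (h t ht).1 (h t ht).2.1
    (hpos.trans_le (blowupQuantity_ge h hm ht))).1
  have hanti := strictAntiOn_enstrophy_rpow h hm hpos ht (a := 0) (b := t) ⟨le_rfl, ht0.le⟩
    ⟨ht0.le, le_rfl⟩ ht0
  have e : enstrophy (S 0) ^ (-(3 / 2) : ℝ) =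
      enstrophy (S 0) ^ (-(1 / 2) : ℝ) / enstrophy (S 0) := by
    rw [← Real.rpow_sub_one hE0.ne']; norm_num
  have hpow : ∀ x : ℝ, 0 < x → (x ^ (-(1 / 2) : ℝ)) ^ 2 = x⁻¹ := fun x hx => by
    rw [← Real.rpow_mul_natCast hx.le, ← Real.rpow_neg_one]; norm_num
  set G0 := enstrophy (S 0) ^ (-(1 / 2) : ℝ) with hG0
  set G := enstrophy (S t) ^ (-(1 / 2) : ℝ) with hG
  have hG0pos : 0 < G0 := Real.rpow_pos_of_pos hE0 _
  have hGpos : 0 < G := Real.rpow_pos_of_pos hEt _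
  have hlt : G < G0 * (1 - r₀ * t) := by
    have e2 : blowupQuantity (S 0) * (G0 / enstrophy (S 0)) / 2 * t = G0 * (r₀ * t) := by
      rw [hr₀]; field_simp
    simp only [mul_zero, add_zero, e, e2] at hanti
    linarith
  have h1 : 0 < 1 - r₀ * t := pos_of_mul_pos_right (hGpos.trans hlt) hG0pos.le
  have hsq : G ^ 2 < (G0 * (1 - r₀ * t)) ^ 2 := by gcongr
  rw [mul_pow, hpow _ hE0, hpow _ hEt, inv_mul_eq_div, inv_eq_one_div,
    div_lt_div_iff₀ hEt hE0, one_mul] at hsq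
  rw [div_lt_iff₀ (by positivity)]
  linarith

lemma existence_time_lt (hT : 0 < T) (h : ContinuousInH1st T S) (hm : IsMildSolution T S)
    (hpos : 0 < blowupQuantity (S 0)) {r₀ : ℝ}
    (hr₀ : r₀ = blowupQuantity (S 0) / (2 * enstrophy (S 0))) : T < ENNReal.ofReal (1 / r₀) := by
  have h0 : (0 : ℝ) ∈ timeInterval T := ⟨le_rfl, by simpa using hT⟩
  have hE0 := (enstrophy_pos_of_blowupQuantity_pos (h 0 h0).1 (h 0 h0).2.1 hpos).1
  obtain ⟨t₁, ht₁, ht₁0⟩ := exists_gt_mem_timeInterval h0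
  set k := blowupQuantity (S 0) * enstrophy (S 0) ^ (-(3 / 2) : ℝ) / 2 with hk
  have hkpos : 0 < k := by
    have := Real.rpow_pos_of_pos hE0 (-(3 / 2))
    positivity
  set G : ℝ → ℝ := fun t => enstrophy (S t) ^ (-(1 / 2) : ℝ) with hG
  have hG0 : G 0 = k * (1 / r₀) := by
    have e : enstrophy (S 0) ^ (-(3 / 2) : ℝ) =
        enstrophy (S 0) ^ (-(1 / 2) : ℝ) / enstrophy (S 0) := by
      rw [← Real.rpow_sub_one hE0.ne']; norm_num
    have e' : G 0 = enstrophy (S 0) ^ (-(1 / 2) : ℝ) := rfl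
    rw [hk, e, hr₀, e']
    field_simp
  -- The gap gained up to the time `t₁` persists and makes the bound for `T` strict.
  have hgap : G t₁ + k * t₁ < G 0 := by
    have := strictAntiOn_enstrophy_rpow h hm hpos ht₁ (a := 0) (b := t₁) ⟨le_rfl, ht₁0.le⟩
      ⟨ht₁0.le, le_rfl⟩ ht₁0
    have h2 : G t₁ + k * t₁ < G 0 + k * 0 := this
    rwa [mul_zero, add_zero] at h2
  have hGnn : ∀ t, 0 ≤ G t := fun t => Real.rpow_nonneg (sq_nonneg _) _
  have hle : T ≤ ENNReal.ofReal ((G t₁ + k * t₁) / k) := by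
    by_contra hlt
    push Not at hlt
    set t₂ := (G t₁ + k * t₁) / k with ht₂
    have ht₂k : k * t₂ = G t₁ + k * t₁ := by rw [ht₂]; field_simp
    have h12 : t₁ ≤ t₂ := by
      rw [ht₂, le_div_iff₀ hkpos]
      nlinarith [hGnn t₁]
    have ht₂T : t₂ ∈ timeInterval T := ⟨ht₁0.le.trans h12, hlt⟩
    obtain ⟨t₃, ht₃, h23⟩ := exists_gt_mem_timeInterval ht₂T
    have := strictAntiOn_enstrophy_rpow h hm hpos ht₃ (a := t₁) (b := t₃)
      ⟨ht₁0.le, h12.trans h23.le⟩ ⟨ht₃.1, le_rfl⟩ (h12.trans_lt h23)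
    have h4 : G t₃ + k * t₃ < G t₁ + k * t₁ := this
    nlinarith [hGnn t₃]
  refine hle.trans_lt ((ENNReal.ofReal_lt_ofReal_iff ?_).2 ?_)
  · rw [hr₀]; positivity
  · rw [div_lt_iff₀ hkpos, mul_comm (1 / r₀), ← hG0]
    exact hgap

end Flow

/-! ### Continuation of bounded mild solutions -/

lemma norm_heat_le {t : ℝ} (ht : 0 < t) (S : MatL2) : ‖heat t S‖ ≤ ‖S‖ := by
  have h1 : ∀ ξ, |heatSymbol t ξ| ≤ 1 := fun ξ => by
    rw [heatSymbol_apply ht.le, Real.abs_exp, Real.exp_le_one_iff, neg_nonpos]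
    exact mul_nonneg ht.le (freqSq_nonneg ξ)
  have h2 := norm_mulOp_le h1 (ftL2 S)
  rwa [← ftL2_heat ht, norm_ftL2, norm_ftL2, one_mul] at h2

lemma mem_timeInterval_ofReal {T t : ℝ} : t ∈ timeInterval (ENNReal.ofReal T) ↔ 0 ≤ t ∧ t < T := by
  refine and_congr_right fun h => ?_
  rw [ENNReal.ofReal_lt_ofReal_iff']
  exact ⟨fun h' => h'.1, fun h' => ⟨h', h.trans_lt h'⟩⟩

/-- The right side of Duhamel's formula. -/
def duhamelMap (S₀ : MatL2) (w : ℝ → MatL2) (t : ℝ) : MatL2 :=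
  heat t S₀ - (2 / 3 : ℝ) • ∫ τ in (0 : ℝ)..t, duhamelTerm w t τ

section Glue

variable {T T' : ℝ}

/-- The field `S` before the time `T`, followed by `u` on `[T, T']`. -/
def glue (S : ℝ → MatL2) (hT : T ≤ T') (u : C(Set.Icc T T', MatL2)) (s : ℝ) : MatL2 :=
  if s < T then S (max 0 s) else u (Set.projIcc T T' hT s)

variable {S : ℝ → MatL2} {hT : T ≤ T'} {u : C(Set.Icc T T', MatL2)}

lemma glue_of_lt {s : ℝ} (hs0 : 0 ≤ s) (hs : s < T) : glue S hT u s = S s := by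
  rw [glue, if_pos hs, max_eq_right hs0]

lemma glue_of_mem {s : ℝ} (hs : s ∈ Set.Icc T T') : glue S hT u s = u ⟨s, hs⟩ := by
  rw [glue, if_neg (not_lt.2 hs.1), Set.projIcc_of_mem]

lemma norm_glue_of_ge {s : ℝ} (hs : T ≤ s) : ‖glue S hT u s‖ ≤ ‖u‖ := by
  rw [glue, if_neg (not_lt.2 hs)]
  exact u.norm_coe_le_norm _

lemma norm_glue_of_lt {M : ℝ} (hT0 : 0 < T) (hM : ∀ t ∈ timeInterval (ENNReal.ofReal T), ‖S t‖ ≤ M)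
    {s : ℝ} (hs : s < T) : ‖glue S hT u s‖ ≤ M := by
  rw [glue, if_pos hs]
  exact hM _ (mem_timeInterval_ofReal.2 ⟨le_max_left _ _, max_lt hT0 hs⟩)

lemma norm_glue_le {M : ℝ} (hT0 : 0 < T) (hM : ∀ t ∈ timeInterval (ENNReal.ofReal T), ‖S t‖ ≤ M)
    (s : ℝ) : ‖glue S hT u s‖ ≤ max M ‖u‖ := by
  rcases lt_or_ge s T with h | h
  · exact (norm_glue_of_lt hT0 hM h).trans (le_max_left _ _)
  · exact (norm_glue_of_ge h).trans (le_max_right _ _)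

lemma continuousAt_glue (hT0 : 0 < T) (hS : ContinuousOn S (timeInterval (ENNReal.ofReal T)))
    (s : ℝ) (hs : s ≠ T) : ContinuousAt (glue S hT u) s := by
  rcases lt_or_gt_of_ne hs with h | h
  · have h1 : ContinuousOn (fun s => S (max 0 s)) (Set.Iio T) :=
      hS.comp (by fun_prop) fun s hs =>
        mem_timeInterval_ofReal.2 ⟨le_max_left _ _, max_lt hT0 hs⟩
    refine (h1.continuousAt (Iio_mem_nhds h)).congr ?_
    filter_upwards [Iio_mem_nhds h] with y hy
    rw [glue, if_pos (show y < T from hy)]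
  · have h1 : Continuous fun s => u (Set.projIcc T T' hT s) := by fun_prop
    refine h1.continuousAt.congr ?_
    filter_upwards [Ioi_mem_nhds h] with y hy
    rw [glue, if_neg (not_lt.2 (le_of_lt hy))]

lemma continuousOn_duhamelMap {M : ℝ} (hT0 : 0 < T)
    (hS : ContinuousOn S (timeInterval (ENNReal.ofReal T)))
    (hM : ∀ t ∈ timeInterval (ENNReal.ofReal T), ‖S t‖ ≤ M) (S₀ : MatL2) :
    ContinuousOn (duhamelMap S₀ (glue S hT u)) (Set.Ioc 0 T') := by
  refine ContinuousOn.sub (fun t ht => (continuousAt_heat_L2 ht.1 S₀).continuousWithinAt) ?_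
  exact ((continuousOn_duhamel (continuousAt_glue hT0 hS) (norm_glue_le hT0 hM) T').mono
    Set.Ioc_subset_Icc_self).const_smul (2 / 3 : ℝ)

lemma intervalIntegrable_glue {M : ℝ} (hT0 : 0 < T)
    (hS : ContinuousOn S (timeInterval (ENNReal.ofReal T)))
    (hM : ∀ t ∈ timeInterval (ENNReal.ofReal T), ‖S t‖ ≤ M) (t : ℝ) {c d : ℝ} (hc : 0 ≤ c)
    (hcd : c ≤ d) : IntervalIntegrable (duhamelTerm (glue S hT u) t) volume c d :=
  intervalIntegrable_duhamelTerm (continuousAt_glue hT0 hS) (norm_glue_le hT0 hM) t hc hcd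

/-- The new part `w = u` enters the integral at `τ ≤ t - T` only, and therefore with a small
factor. -/
lemma norm_duhamelMap_glue_le {M R : ℝ} (hT0 : 0 < T)
    (hS : ContinuousOn S (timeInterval (ENNReal.ofReal T)))
    (hM : ∀ t ∈ timeInterval (ENNReal.ofReal T), ‖S t‖ ≤ M) (S₀ : MatL2) (hu : ‖u‖ ≤ R) {t : ℝ}
    (ht : t ∈ Set.Icc T T') :
    ‖duhamelMap S₀ (glue S hT u) t‖ ≤ ‖S₀‖ + 8 / 3 * kappa * M ^ 2 * T' ^ (1 / 4 : ℝ) +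
      8 / 3 * kappa * R ^ 2 * (T' - T) ^ (1 / 4 : ℝ) := by
  have ht0 : 0 < t := hT0.trans_le ht.1
  have h1 : 0 ≤ t - T := sub_nonneg.2 ht.1
  have h2 : t - T ≤ t := by linarith
  have hk := kappa_nonneg
  have i1 : ‖∫ τ in (0 : ℝ)..(t - T), duhamelTerm (glue S hT u) t τ‖ ≤
      4 * (kappa * R ^ 2) * (t - T) ^ (1 / 4 : ℝ) :=
    norm_integral_le_kernel (by positivity) le_rfl h1 fun τ hτ => norm_duhamelTerm_le hτ.1
      ((norm_glue_of_ge (by linarith [hτ.2])).trans hu)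
  have i2 : ‖∫ τ in (t - T)..t, duhamelTerm (glue S hT u) t τ‖ ≤
      4 * (kappa * M ^ 2) * t ^ (1 / 4 : ℝ) :=
    norm_integral_le_kernel (by positivity) h1 h2 fun τ hτ =>
      norm_duhamelTerm_le (h1.trans_lt hτ.1) (norm_glue_of_lt hT0 hM (by linarith [hτ.1]))
  have i3 : (t - T) ^ (1 / 4 : ℝ) ≤ (T' - T) ^ (1 / 4 : ℝ) :=
    Real.rpow_le_rpow h1 (by linarith [ht.2]) (by norm_num)
  have i4 : t ^ (1 / 4 : ℝ) ≤ T' ^ (1 / 4 : ℝ) :=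
    Real.rpow_le_rpow ht0.le ht.2 (by norm_num)
  rw [duhamelMap, ← intervalIntegral.integral_add_adjacent_intervals
    (intervalIntegrable_glue hT0 hS hM t le_rfl h1) (intervalIntegrable_glue hT0 hS hM t h1 h2)]
  refine (norm_sub_le _ _).trans ?_
  rw [norm_smul, Real.norm_of_nonneg (by norm_num : (0 : ℝ) ≤ 2 / 3)]
  have i5 := norm_add_le (∫ τ in (0 : ℝ)..(t - T), duhamelTerm (glue S hT u) t τ)
    (∫ τ in (t - T)..t, duhamelTerm (glue S hT u) t τ)
  have i6 := norm_heat_le ht0 S₀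
  have i7 : 4 * (kappa * R ^ 2) * (t - T) ^ (1 / 4 : ℝ) ≤
      4 * (kappa * R ^ 2) * (T' - T) ^ (1 / 4 : ℝ) := by gcongr
  have i8 : 4 * (kappa * M ^ 2) * t ^ (1 / 4 : ℝ) ≤
      4 * (kappa * M ^ 2) * T' ^ (1 / 4 : ℝ) := by gcongr
  linarith

/-- The contributions of the common history cancel. -/
lemma norm_duhamelMap_glue_sub_le {v : C(Set.Icc T T', MatL2)} {M R : ℝ} (hT0 : 0 < T)
    (hS : ContinuousOn S (timeInterval (ENNReal.ofReal T)))
    (hM : ∀ t ∈ timeInterval (ENNReal.ofReal T), ‖S t‖ ≤ M) (S₀ : MatL2) (hu : ‖u‖ ≤ R)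
    (hv : ‖v‖ ≤ R) {t : ℝ} (ht : t ∈ Set.Icc T T') :
    ‖duhamelMap S₀ (glue S hT u) t - duhamelMap S₀ (glue S hT v) t‖ ≤
      16 / 3 * kappa * R * (T' - T) ^ (1 / 4 : ℝ) * ‖u - v‖ := by
  have h1 : 0 ≤ t - T := sub_nonneg.2 ht.1
  have h2 : t - T ≤ t := by linarith
  have hk := kappa_nonneg
  have hR : 0 ≤ R := (norm_nonneg u).trans hu
  have i1 : ‖∫ τ in (0 : ℝ)..(t - T),
      (duhamelTerm (glue S hT u) t τ - duhamelTerm (glue S hT v) t τ)‖ ≤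
      4 * (kappa * (2 * R * ‖u - v‖)) * (t - T) ^ (1 / 4 : ℝ) := by
    refine norm_integral_le_kernel (by positivity) le_rfl h1 fun τ hτ => ?_
    have hτT : T ≤ t - τ := by linarith [hτ.2]
    refine norm_duhamelTerm_sub_le hτ.1 ((norm_glue_of_ge hτT).trans hu)
      ((norm_glue_of_ge hτT).trans hv) ?_
    rw [glue, glue, if_neg (not_lt.2 hτT), if_neg (not_lt.2 hτT)]
    exact (u - v).norm_coe_le_norm _
  have i2 : ∫ τ in (t - T)..t,
      (duhamelTerm (glue S hT u) t τ - duhamelTerm (glue S hT v) t τ) = 0 := by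
    rw [intervalIntegral.integral_of_le h2]
    refine setIntegral_eq_zero_of_ae_eq_zero ?_
    filter_upwards [Measure.ae_ne volume (t - T)] with τ hne hτ
    have : t - τ < T := by linarith [hτ.1]
    rw [duhamelTerm, duhamelTerm, glue, glue, if_pos this, if_pos this, sub_self]
  have i3 : (t - T) ^ (1 / 4 : ℝ) ≤ (T' - T) ^ (1 / 4 : ℝ) :=
    Real.rpow_le_rpow h1 (by linarith [ht.2]) (by norm_num)
  have hi : ∀ v : C(Set.Icc T T', MatL2),
      IntervalIntegrable (duhamelTerm (glue S hT v) t) volume 0 t := fun v =>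
    intervalIntegrable_glue hT0 hS hM t le_rfl (h1.trans h2)
  have hd : ∀ {c d : ℝ}, 0 ≤ c → c ≤ d → IntervalIntegrable (fun τ =>
      duhamelTerm (glue S hT u) t τ - duhamelTerm (glue S hT v) t τ) volume c d := fun hc hcd =>
    (intervalIntegrable_glue hT0 hS hM t hc hcd).sub (intervalIntegrable_glue hT0 hS hM t hc hcd)
  rw [duhamelMap, duhamelMap, sub_sub_sub_cancel_left, ← smul_sub,
    ← intervalIntegral.integral_sub (hi v) (hi u), norm_smul,
    Real.norm_of_nonneg (by norm_num : (0 : ℝ) ≤ 2 / 3), ← norm_neg,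
    ← intervalIntegral.integral_neg]
  simp only [neg_sub]
  rw [← intervalIntegral.integral_add_adjacent_intervals (hd le_rfl h1) (hd h1 h2), i2, add_zero]
  calc _ ≤ 2 / 3 * (4 * (kappa * (2 * R * ‖u - v‖)) * (T' - T) ^ (1 / 4 : ℝ)) := by
        gcongr
        exact i1.trans (by gcongr)
    _ = _ := by ring

end Glue

/-- The projection commutes with the integral. -/
lemma integral_duhamelTerm_mem {w : ℝ → MatL2} {t : ℝ}
    (hi : IntervalIntegrable (duhamelTerm w t) volume 0 t) :
    ∫ τ in (0 : ℝ)..t, duhamelTerm w t τ ∈ L2st := by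
  have h1 : Pst (∫ τ in (0 : ℝ)..t, duhamelTerm w t τ) = ∫ τ in (0 : ℝ)..t, duhamelTerm w t τ := by
    rw [← Pst.intervalIntegral_comp_comm hi]
    refine intervalIntegral.integral_congr fun τ _ => ?_
    exact Submodule.starProjection_eq_self_iff.2 (Pst_mem _)
  rw [← h1]
  exact Pst_mem _

/-- Local existence restarted at the time `T`: the right side of Duhamel's formula, with the history
`S` on `[0, T)`, is a contraction on continuous functions on `[T, T + ε]`. -/
lemma exists_fixedPoint_glue {T M : ℝ} {S : ℝ → MatL2} (hT0 : 0 < T)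
    (hS : ContinuousOn S (timeInterval (ENNReal.ofReal T)))
    (hM : ∀ t ∈ timeInterval (ENNReal.ofReal T), ‖S t‖ ≤ M) (S₀ : MatL2) :
    ∃ (T' : ℝ) (hT : T < T') (u : C(Set.Icc T T', MatL2)), ∀ t, (ht : t ∈ Set.Icc T T') →
      u ⟨t, ht⟩ = duhamelMap S₀ (glue S hT.le u) t := by
  have hk := kappa_nonneg
  -- `R` exceeds by `1` the bound for the contribution of the history when `ε ≤ 1`. The
  -- choice of `d ≥ ε^{1/4}` bounds the new contribution by `1` and the Lipschitz constant by `1/2`.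
  set R := ‖S₀‖ + 8 / 3 * kappa * M ^ 2 * (T + 1) ^ (1 / 4 : ℝ) + 1 with hR
  have hR0 : 0 < R := by positivity
  set d := (8 / 3 * kappa * R ^ 2 + 32 / 3 * kappa * R + 1)⁻¹ with hd
  have hd0 : 0 < d := by positivity
  have hd1 : (8 / 3 * kappa * R ^ 2 + 32 / 3 * kappa * R + 1) * d = 1 :=
    mul_inv_cancel₀ (by positivity)
  set ε := min 1 (d ^ 4) with hε
  have hε0 : 0 < ε := lt_min one_pos (by positivity)
  have hεd : ε ^ (1 / 4 : ℝ) ≤ d := by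
    calc ε ^ (1 / 4 : ℝ) ≤ (d ^ 4) ^ (1 / 4 : ℝ) :=
          Real.rpow_le_rpow hε0.le (min_le_right _ _) (by norm_num)
      _ = d := by
          rw [← Real.rpow_natCast, ← Real.rpow_mul hd0.le]; norm_num
  have hTε : T ≤ T + ε := by linarith
  have hsub : T + ε - T = ε := by ring
  have hq1 : 8 / 3 * kappa * R ^ 2 * ε ^ (1 / 4 : ℝ) ≤ 1 := by
    calc _ ≤ 8 / 3 * kappa * R ^ 2 * d := by gcongr
      _ ≤ 1 := by
          have : 0 ≤ 32 / 3 * kappa * R * d := by positivity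
          linarith
  have hq2 : 16 / 3 * kappa * R * ε ^ (1 / 4 : ℝ) ≤ 1 / 2 := by
    calc _ ≤ 16 / 3 * kappa * R * d := by gcongr
      _ ≤ 1 / 2 := by
          have : 0 ≤ 8 / 3 * kappa * R ^ 2 * d := by positivity
          linarith
  let Φ : C(Set.Icc T (T + ε), MatL2) → C(Set.Icc T (T + ε), MatL2) := fun u =>
    ⟨(Set.Icc T (T + ε)).domRestrict (duhamelMap S₀ (glue S hTε u)),
      ((continuousOn_duhamelMap hT0 hS hM S₀).mono fun t ht =>
        ⟨hT0.trans_le ht.1, ht.2⟩).domRestrict⟩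
  have hmaps : Set.MapsTo Φ (Metric.closedBall 0 R) (Metric.closedBall 0 R) := fun u hu => by
    rw [mem_closedBall_zero_iff] at hu ⊢
    refine (ContinuousMap.norm_le _ hR0.le).2 fun t => ?_
    refine (norm_duhamelMap_glue_le hT0 hS hM S₀ hu t.2).trans ?_
    rw [hsub]
    have h3 : (T + ε) ^ (1 / 4 : ℝ) ≤ (T + 1) ^ (1 / 4 : ℝ) :=
      Real.rpow_le_rpow (by positivity) (by linarith [min_le_left 1 (d ^ 4)]) (by norm_num)
    have h4 : 8 / 3 * kappa * M ^ 2 * (T + ε) ^ (1 / 4 : ℝ) ≤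
      8 / 3 * kappa * M ^ 2 * (T + 1) ^ (1 / 4 : ℝ) := by gcongr
    linarith
  have hcontr : ContractingWith (1 / 2) (hmaps.restrict Φ _ _) := by
    refine ⟨by norm_num, LipschitzWith.of_dist_le_mul fun u v => ?_⟩
    rw [Subtype.dist_eq, Subtype.dist_eq, dist_eq_norm, dist_eq_norm]
    refine (ContinuousMap.norm_le _ (by positivity)).2 fun t => ?_
    refine (norm_duhamelMap_glue_sub_le hT0 hS hM S₀ (mem_closedBall_zero_iff.1 u.2)
      (mem_closedBall_zero_iff.1 v.2) t.2).trans ?_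
    rw [hsub]
    refine mul_le_mul_of_nonneg_right (hq2.trans_eq (by norm_num)) (norm_nonneg _)
  obtain ⟨u, -, hu, -⟩ := hcontr.exists_fixedPoint' Metric.isClosed_closedBall.isComplete hmaps
    (Metric.mem_closedBall_self hR0.le) (edist_ne_top _ _)
  refine ⟨T + ε, by linarith, u, fun t ht => ?_⟩
  exact (congrArg (fun w : C(Set.Icc T (T + ε), MatL2) => w ⟨t, ht⟩) hu).symm

/-- A mild solution that stays bounded in `L²` up to a finite time can be continued. -/
lemma not_isMaximalTime_of_bounded {T M : ℝ} {S : ℝ → MatL2} (hT0 : 0 < T)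
    (hm : IsMildSolution (ENNReal.ofReal T) S)
    (hM : ∀ t ∈ timeInterval (ENNReal.ofReal T), ‖S t‖ ≤ M) :
    ¬ IsMaximalTime (ENNReal.ofReal T) S := by
  intro hmax
  obtain ⟨T', hT, u, hu⟩ := exists_fixedPoint_glue hT0 hm.continuousOn hM (S 0)
  refine hmax ⟨ENNReal.ofReal T', glue S hT.le u,
    (ENNReal.ofReal_lt_ofReal_iff (hT0.trans hT)).2 hT, ?_, fun t ht => ?_⟩
  swap
  · rw [mem_timeInterval_ofReal] at ht
    exact glue_of_lt ht.1 ht.2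
  set w := glue S hT.le u with hw
  have hw0 : w 0 = S 0 := glue_of_lt le_rfl hT0
  have heq : ∀ t, 0 < t → t ≤ T' → w t = duhamelMap (S 0) w t := fun t ht0 htT => by
    rcases lt_or_ge t T with h | h
    · rw [hw, glue_of_lt ht0.le h, ← hw, hm.duhamel t (mem_timeInterval_ofReal.2 ⟨ht0.le, h⟩) ht0,
        duhamelMap]
      congr 2
      refine intervalIntegral.integral_congr fun τ hτ => ?_
      rw [Set.uIcc_of_le ht0.le] at hτ
      rw [duhamelTerm, heat_sqField, hw, glue_of_lt (sub_nonneg.2 hτ.2) (by linarith [hτ.1])]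
    · exact (glue_of_mem ⟨h, htT⟩).trans (hu t ⟨h, htT⟩)
  refine ⟨fun t ht => ?_, fun t ht => ?_, fun t ht ht0 => ?_⟩
  · rw [mem_timeInterval_ofReal] at ht
    refine ContinuousAt.continuousWithinAt ?_
    rcases ht.1.eq_or_lt with h | h
    · rw [← h]
      exact continuousAt_glue hT0 hm.continuousOn 0 hT0.ne
    · have hnh : Set.Ioc 0 T' ∈ 𝓝 t := Ioc_mem_nhds h ht.2
      refine ((continuousOn_duhamelMap (hT := hT.le) (u := u) hT0 hm.continuousOn hM
        (S 0)).continuousAt hnh).congr ?_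
      filter_upwards [hnh] with s hs using (heq s hs.1 hs.2).symm
  · rw [mem_timeInterval_ofReal] at ht
    rcases lt_or_ge t T with h | h
    · rw [hw, glue_of_lt ht.1 h]
      exact hm.mem_L2st t (mem_timeInterval_ofReal.2 ⟨ht.1, h⟩)
    · have ht0 : 0 < t := hT0.trans_le h
      rw [heq t ht0 ht.2.le, duhamelMap]
      refine L2st.sub_mem (heat_mem_L2st ht0 (hm.mem_L2st 0 (mem_timeInterval_ofReal.2
        ⟨le_rfl, hT0⟩))) (L2st.smul_mem _ (integral_duhamelTerm_mem ?_))
      exact intervalIntegrable_glue hT0 hm.continuousOn hM t le_rfl ht0.le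
  · rw [mem_timeInterval_ofReal] at ht
    rw [heq t ht0 ht.2.le, hw0, duhamelMap]
    congr 2
    refine intervalIntegral.integral_congr fun τ _ => ?_
    rw [duhamelTerm, heat_sqField]

/-! ### The regularity criterion in terms of the middle eigenvalue -/

/-- A constant in the Sobolev inequality `‖S‖_{L⁶}² ≤ c ‖S‖²_{Ḣ¹}`. It is made positive by adding
`1`, so that `c^a ‖λ₂⁺‖_q^p = ∞` wherever the norm is infinite. -/
def sobolevConst : ℝ≥0 := SNormLESNormFDerivOfEqConst CMat3 (volume : Measure R3) 2 ^ 2 + 1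

lemma eLpNorm_six_sq_le {S : MatL2} (hS : hOneSq S < ∞) :
    eLpNorm S 6 volume ^ 2 ≤ sobolevConst * hDotOneSq S := by
  refine (pow_le_pow_left' (eLpNorm_six_le S hS) 2).trans ?_
  rw [mul_pow, ← ENNReal.rpow_mul_natCast]
  norm_num
  gcongr
  rw [sobolevConst]
  push_cast
  exact le_self_add

/-- Hölder's inequality with the exponents `1/q`, `1 - θ` and `θ/3`, where `θ = 3/(2q)`. For `q = ∞`
the value `q.toReal = 0` gives the correct `θ = 0`. -/
lemma lintegral_mul_sq_le_interpolation {q : ℝ≥0∞} (hq : 3 / 2 < q) {g : R3 → ℝ}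
    (hg : AEStronglyMeasurable g volume) (S : MatL2) :
    ∫⁻ x, ‖g x‖ₑ * ‖S x‖ₑ ^ 2 ≤ eLpNorm g q volume *
      (‖S‖ₑ ^ 2) ^ (1 - 3 / (2 * q.toReal)) *
        (eLpNorm S 6 volume ^ 2) ^ (3 / (2 * q.toReal)) := by
  have hSm : AEMeasurable (fun x => ‖S x‖ₑ) volume := (Lp.memLp S).1.enorm
  have e2 : ∫⁻ x, ‖S x‖ₑ ^ 2 = ‖S‖ₑ ^ 2 := by rw [Lp.enorm_def, eLpNorm_two_sq]
  rcases eq_or_ne q ∞ with rfl | hq'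
  · simp only [ENNReal.toReal_top, mul_zero, div_zero, sub_zero, ENNReal.rpow_one,
      ENNReal.rpow_zero, mul_one]
    rw [← e2, ← lintegral_const_mul'' _ (hSm.pow_const 2), eLpNorm_exponent_top]
    refine lintegral_mono_ae ?_
    filter_upwards [enorm_ae_le_eLpNormEssSup g volume] with x hx
    gcongr
  · have hqr : 3 / 2 < q.toReal := by
      have := (ENNReal.toReal_lt_toReal (ENNReal.div_ne_top (by simp) (by simp)) hq').2 hq
      simpa using this
    set r := q.toReal with hr
    have hr0 : 0 < r := by linarith
    have hq0 : q ≠ 0 := (bot_le.trans_lt hq).ne'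
    have e6 : ∫⁻ x, ‖S x‖ₑ ^ 6 = eLpNorm S 6 volume ^ 6 := by
      have := eLpNorm_nnreal_pow_eq_lintegral (μ := (volume : Measure R3)) (f := S)
        (p := 6) (by norm_num)
      simpa using this.symm
    have hH := ENNReal.lintegral_prod_norm_pow_le (μ := (volume : Measure R3)) Finset.univ
      (f := ![fun x => ‖g x‖ₑ ^ r, fun x => ‖S x‖ₑ ^ 2, fun x => ‖S x‖ₑ ^ 6])
      (p := ![1 / r, 1 - 3 / (2 * r), 1 / (2 * r)]) (fun i _ => by
        fin_cases i
        · exact hg.enorm.pow_const r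
        · exact hSm.pow_const 2
        · exact hSm.pow_const 6) (by
        simp only [Fin.sum_univ_three, Matrix.cons_val_zero, Matrix.cons_val_one,
          Matrix.cons_val_two, Matrix.head_cons, Matrix.tail_cons]
        field_simp
        ring) (fun i _ => by
        fin_cases i
        · change 0 ≤ 1 / r
          positivity
        · change 0 ≤ 1 - 3 / (2 * r)
          rw [sub_nonneg, div_le_one (by positivity)]
          linarith
        · change 0 ≤ 1 / (2 * r)
          positivity)
    have hθ1 : 0 ≤ 1 - 3 / (2 * r) := by
      rw [sub_nonneg, div_le_one (by positivity)]
      linarith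
    simp only [Fin.prod_univ_three, Matrix.cons_val_zero, Matrix.cons_val_one,
      Matrix.cons_val_two, Matrix.head_cons, Matrix.tail_cons] at hH
    rw [e2, e6] at hH
    rw [eLpNorm_eq_lintegral_rpow_enorm_toReal hq0 hq']
    refine (lintegral_mono fun x => ?_).trans (hH.trans ?_)
    · rw [← ENNReal.rpow_mul, mul_one_div_cancel hr0.ne', ENNReal.rpow_one, mul_assoc,
        ← ENNReal.rpow_natCast, ← ENNReal.rpow_natCast, ← ENNReal.rpow_mul, ← ENNReal.rpow_mul,
        ← ENNReal.rpow_add_of_nonneg]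
      · refine le_of_eq ?_
        congr 2
        push_cast
        field_simp
        ring
      · positivity
      · positivity
    · refine le_of_eq ?_
      congr 1
      rw [← ENNReal.rpow_natCast, ← ENNReal.rpow_natCast, ← ENNReal.rpow_mul, ← ENNReal.rpow_mul]
      congr 1
      push_cast
      field_simp
      norm_num

lemma integrable_det {S : MatL2} (hS : S ∈ L2st) (h1 : hOneSq S < ∞) :
    Integrable fun x => (matrixAt S x).det := by
  refine ((L2.integrable_inner (𝕜 := ℝ) (sqL2 S) S).const_mul (1 / 3)).congr ?_
  filter_upwards [ae_isSymm3 hS, hS.2.1, coeFn_sqL2 h1] with x h2 h3 h4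
  rw [h4, sqField_eq, ← det_eq_inner_matMul h2 h3]
  rfl

/-- The production of enstrophy is bounded by the middle eigenvalue. The function `λ₂⁺` is replaced
by the smaller `(-2 det S)⁺ / |S|²`, whose measurability is evident. -/
lemma ofReal_integral_det_le {q : ℝ≥0∞} (hq : 3 / 2 < q) {S : MatL2} (hS : S ∈ L2st)
    (h1 : hOneSq S < ∞) :
    ENNReal.ofReal (-2 * ∫ x, (matrixAt S x).det) ≤ lambdaTwoPlusNorm q S *
      (‖S‖ₑ ^ 2) ^ (1 - 3 / (2 * q.toReal)) *
        (eLpNorm S 6 volume ^ 2) ^ (3 / (2 * q.toReal)) := by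
  set g : R3 → ℝ := fun x => max 0 (-2 * (matrixAt S x).det) / ‖S x‖ ^ 2 with hg
  have hi := (integrable_det hS h1).const_mul (-2)
  have hbound : ∀ᵐ x, -2 * (matrixAt S x).det ≤
      ‖S x‖ ^ 2 * max 0 (midEigenvalue (matrixAt S x)) := by
    filter_upwards [ae_isSymm3 hS, hS.2.1] with x h2 h3
    have := neg_det_le h2 h3
    rw [matrixAt]
    linarith
  have hgm : AEStronglyMeasurable g volume := by
    have h2 : AEMeasurable (fun x => max 0 (-2 * (matrixAt S x).det)) volume :=
      aemeasurable_const.max hi.1.aemeasurable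
    exact (h2.div ((Lp.memLp S).1.norm.aemeasurable.pow_const 2)).aestronglyMeasurable
  have hgle : eLpNorm g q volume ≤ lambdaTwoPlusNorm q S := by
    refine eLpNorm_mono_ae ?_
    filter_upwards [hbound] with x hx
    have h0 : 0 ≤ max 0 (midEigenvalue (matrixAt S x)) := le_max_left _ _
    rw [Real.norm_of_nonneg h0, Real.norm_of_nonneg (by positivity)]
    refine div_le_of_le_mul₀ (by positivity) h0 ?_
    exact max_le (by positivity) (hx.trans_eq (mul_comm _ _))
  have hint : ENNReal.ofReal (-2 * ∫ x, (matrixAt S x).det) ≤ ∫⁻ x, ‖g x‖ₑ * ‖S x‖ₑ ^ 2 := by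
    rw [← integral_const_mul]
    have hle : ∫ x, -2 * (matrixAt S x).det ≤ ∫ x, max 0 (-2 * (matrixAt S x).det) :=
      integral_mono hi (hi.pos_part.congr (Eventually.of_forall fun x => max_comm _ _))
        fun x => le_max_right _ _
    refine (ENNReal.ofReal_le_ofReal hle).trans ?_
    rw [ofReal_integral_eq_lintegral_ofReal
      (hi.pos_part.congr (Eventually.of_forall fun x => max_comm _ _))
      (Eventually.of_forall fun x => le_max_left _ _)]
    refine lintegral_mono_ae ?_
    filter_upwards [hbound] with x hx
    rw [← ofReal_norm, ← ofReal_norm, ← ENNReal.ofReal_pow (norm_nonneg _),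
      ← ENNReal.ofReal_mul (norm_nonneg _)]
    refine ENNReal.ofReal_le_ofReal ?_
    rw [Real.norm_of_nonneg (by positivity)]
    rcases eq_or_ne ‖S x‖ 0 with h0 | h0
    · rw [h0] at hx ⊢
      simpa using hx
    · rw [hg]
      simp only
      rw [div_mul_cancel₀ _ (pow_ne_zero 2 h0)]
  refine hint.trans ((lintegral_mul_sq_le_interpolation hq hgm S).trans ?_)
  gcongr

/-- `d/dt E ≤ c ‖λ₂⁺‖_q^p E` in terms of the right side of the energy equation: Young's inequality
with the exponents `1 - θ = 1/p` and `θ` absorbs the Dirichlet energy. -/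
lemma deriv_enstrophy_le {p q : ℝ≥0∞} (hq : 3 / 2 < q)
    (hp : p.toReal = 1 / (1 - 3 / (2 * q.toReal))) (hθ1 : 3 / (2 * q.toReal) < 1) {S : MatL2}
    (hS : S ∈ L2st) (h1 : hOneSq S < ∞) (hE : 0 < enstrophy S) :
    ENNReal.ofReal ((dirichletReal S + blowupQuantity S) / enstrophy S) ≤
      ENNReal.ofReal (2 * (sobolevConst : ℝ) ^ (3 / (2 * q.toReal) * p.toReal)) *
        lambdaTwoPlusNorm q S ^ p.toReal := by
  set θ := 3 / (2 * q.toReal) with hθ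
  have hθ0 : 0 ≤ θ := by positivity
  have h1θ : 0 < 1 - θ := by linarith
  set P := p.toReal with hP
  have hP0 : 0 < P := by rw [hp]; positivity
  have hPθ : P * (1 - θ) = 1 := by rw [hp]; field_simp
  have hc0 : (0 : ℝ) < sobolevConst := by
    rw [sobolevConst]; positivity
  have hdet := ofReal_integral_det_le hq hS h1
  rcases eq_or_ne (lambdaTwoPlusNorm q S) ∞ with hL | hL
  · rw [hL, ENNReal.top_rpow_of_pos hP0, ENNReal.mul_top]
    · exact le_top
    · rw [Ne, ENNReal.ofReal_eq_zero, not_le]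
      positivity
  set l := (lambdaTwoPlusNorm q S).toReal with hl
  have hl0 : 0 ≤ l := ENNReal.toReal_nonneg
  have hLl : lambdaTwoPlusNorm q S = ENNReal.ofReal l := (ENNReal.ofReal_toReal hL).symm
  have hJtop : hDotOneSq S ≠ ∞ := ((dirichlet_le_hOneSq S).trans_lt h1).ne
  have hJ0 : 0 ≤ dirichletReal S := ENNReal.toReal_nonneg
  have hJl : hDotOneSq S = ENNReal.ofReal (dirichletReal S) := (ENNReal.ofReal_toReal hJtop).symm
  have hEl : ‖S‖ₑ ^ 2 = ENNReal.ofReal (enstrophy S) := by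
    rw [enstrophy, ENNReal.ofReal_pow (norm_nonneg _), ofReal_norm]
  have hreal : -2 * ∫ x, (matrixAt S x).det ≤
      l * enstrophy S ^ (1 - θ) * (sobolevConst * dirichletReal S) ^ θ := by
    have h3 : (0 : ℝ) ≤ l * enstrophy S ^ (1 - θ) * (sobolevConst * dirichletReal S) ^ θ := by
      positivity
    refine (ENNReal.ofReal_le_ofReal_iff h3).1 (hdet.trans ?_)
    rw [hLl, hEl, ENNReal.ofReal_mul (by positivity), ENNReal.ofReal_mul (by positivity),
      ← ENNReal.ofReal_rpow_of_nonneg hE.le h1θ.le,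
      ← ENNReal.ofReal_rpow_of_nonneg (by positivity) hθ0]
    gcongr
    refine (eLpNorm_six_sq_le h1).trans_eq ?_
    rw [hJl, ENNReal.ofReal_mul (by positivity), ENNReal.ofReal_coe_nnreal]
  have hyoung : l * enstrophy S ^ (1 - θ) * (sobolevConst * dirichletReal S) ^ θ ≤
      (sobolevConst : ℝ) ^ (θ * P) * l ^ P * enstrophy S + dirichletReal S := by
    have h4 := Real.geom_mean_le_arith_mean2_weighted h1θ.le hθ0
      (show 0 ≤ (sobolevConst : ℝ) ^ (θ * P) * l ^ P * enstrophy S by positivity) hJ0 (by ring)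
    have h5 : ((sobolevConst : ℝ) ^ (θ * P) * l ^ P * enstrophy S) ^ (1 - θ) *
        dirichletReal S ^ θ = l * enstrophy S ^ (1 - θ) * (sobolevConst * dirichletReal S) ^ θ := by
      rw [Real.mul_rpow (by positivity) hE.le, Real.mul_rpow (by positivity) (by positivity),
        ← Real.rpow_mul hc0.le, ← Real.rpow_mul hl0, mul_assoc θ, hPθ, mul_one, Real.rpow_one,
        Real.mul_rpow hc0.le hJ0]
      ring
    have h6 : 0 ≤ (sobolevConst : ℝ) ^ (θ * P) * l ^ P * enstrophy S := by positivity
    have h7 : θ * dirichletReal S ≤ dirichletReal S := mul_le_of_le_one_left hJ0 hθ1.le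
    have h8 : (1 - θ) * ((sobolevConst : ℝ) ^ (θ * P) * l ^ P * enstrophy S) ≤
      (sobolevConst : ℝ) ^ (θ * P) * l ^ P * enstrophy S :=
        mul_le_of_le_one_left h6 (by linarith)
    linarith
  rw [hLl, ENNReal.ofReal_rpow_of_nonneg hl0 hP0.le, ← ENNReal.ofReal_mul (by positivity)]
  refine ENNReal.ofReal_le_ofReal ?_
  rw [div_le_iff₀ hE, blowupQuantity]
  have : (hDotOneSq S).toReal = dirichletReal S := rfl
  rw [this]
  linarith

section Criterion

variable {T : ℝ≥0∞} {S : ℝ → MatL2}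

/-- Grönwall's inequality for `log E`; the function `t ↦ ‖λ₂⁺(t)‖_q` need not be measurable. -/
lemma enstrophy_le_of_lintegral (h : ContinuousInH1st T S) (hm : IsMildSolution T S)
    (hpos : 0 < blowupQuantity (S 0)) {p q : ℝ≥0∞} (hq : 3 / 2 < q)
    (hp : p.toReal = 1 / (1 - 3 / (2 * q.toReal))) (hθ1 : 3 / (2 * q.toReal) < 1)
    (hfin : ∫⁻ t in timeInterval T, lambdaTwoPlusNorm q (S t) ^ p.toReal ≠ ∞) :
    ∃ M, ∀ t ∈ timeInterval T, enstrophy (S t) ≤ M := by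
  set B := ENNReal.ofReal (2 * (sobolevConst : ℝ) ^ (3 / (2 * q.toReal) * p.toReal)) with hB
  set I := B * ∫⁻ t in timeInterval T, lambdaTwoPlusNorm q (S t) ^ p.toReal with hI
  have hItop : I ≠ ∞ := ENNReal.mul_ne_top ENNReal.ofReal_ne_top hfin
  refine ⟨Real.exp (I.toReal + Real.log (enstrophy (S 0))), fun b hb => ?_⟩
  have hsub := Icc_subset_timeInterval hb
  have hposE : ∀ t ∈ timeInterval T, 0 < enstrophy (S t) := fun t ht =>
    (enstrophy_pos_of_blowupQuantity_pos (h t ht).1 (h t ht).2.1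
      (hpos.trans_le (blowupQuantity_ge h hm ht))).1
  have hEc : ContinuousOn (fun t => enstrophy (S t)) (Set.Icc 0 b) :=
    (hm.continuousOn.norm.pow 2).mono hsub
  have hdc : ContinuousOn (fun t => (dirichletReal (S t) + blowupQuantity (S t)) /
      enstrophy (S t)) (Set.Icc 0 b) :=
    ((h.continuousOn_deriv_enstrophy hm).mono hsub).div hEc fun t ht => (hposE t (hsub ht)).ne'
  have hii := hdc.intervalIntegrable_of_Icc (μ := volume) hb.1
  have hlog := intervalIntegral.integral_eq_sub_of_hasDerivAt_of_le hb.1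
    (hEc.log fun t ht => (hposE t (hsub ht)).ne')
    (fun t ht => (hasDerivAt_enstrophy h hm ht.1 (hsub (Set.Ioo_subset_Icc_self ht))).log
      (hposE t (hsub (Set.Ioo_subset_Icc_self ht))).ne') hii
  have hint : ∫ t in (0 : ℝ)..b, (dirichletReal (S t) + blowupQuantity (S t)) /
      enstrophy (S t) ≤ I.toReal := by
    rw [intervalIntegral.integral_of_le hb.1,
      integral_eq_lintegral_pos_part_sub_lintegral_neg_part hii.1]
    refine (sub_le_self _ ENNReal.toReal_nonneg).trans (ENNReal.toReal_mono hItop ?_)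
    calc ∫⁻ t in Set.Ioc 0 b, ENNReal.ofReal ((dirichletReal (S t) + blowupQuantity (S t)) /
          enstrophy (S t))
        ≤ ∫⁻ t in Set.Ioc 0 b, B * lambdaTwoPlusNorm q (S t) ^ p.toReal := by
          refine setLIntegral_mono' measurableSet_Ioc fun t ht => ?_
          have htT := hsub (Set.Ioc_subset_Icc_self ht)
          exact deriv_enstrophy_le hq hp hθ1 (h t htT).1 (h t htT).2.1 (hposE t htT)
      _ ≤ ∫⁻ t in timeInterval T, B * lambdaTwoPlusNorm q (S t) ^ p.toReal :=
          lintegral_mono_set (Set.Ioc_subset_Icc_self.trans hsub)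
      _ = I := lintegral_const_mul' _ _ ENNReal.ofReal_ne_top
  rw [← Real.log_le_iff_le_exp (hposE b hb)]
  linarith

lemma lintegral_lambdaTwoPlusNorm_eq_top (hT : 0 < T) (hTfin : T ≠ ∞) (h : ContinuousInH1st T S)
    (hm : IsMildSolution T S) (hpos : 0 < blowupQuantity (S 0)) (hmax : IsMaximalTime T S)
    {p q : ℝ≥0∞} (hq : 3 / 2 < q) (hpq : 2 / p + 3 / q = 2) :
    ∫⁻ t in timeInterval T, lambdaTwoPlusNorm q (S t) ^ p.toReal = ∞ := by
  by_contra hfin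
  have hq0 : q ≠ 0 := (bot_le.trans_lt hq).ne'
  -- The exponents `p = 0` and `p = ∞` are impossible: `2 / 0 = ∞`, and `p = ∞` requires `q = 3/2`.
  have hp0 : p ≠ 0 := by
    rintro rfl
    rw [ENNReal.div_zero two_ne_zero, top_add] at hpq
    exact ENNReal.top_ne_ofNat hpq
  have hθ1 : 3 / (2 * q.toReal) < 1 := by
    rcases eq_or_ne q ∞ with rfl | hq'
    · simp
    · have hqr : 3 / 2 < q.toReal := by
        have := (ENNReal.toReal_lt_toReal (ENNReal.div_ne_top (by simp) (by simp)) hq').2 hq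
        simpa using this
      rw [div_lt_one (by linarith)]
      linarith
  have hreal : 2 / p.toReal + 3 / q.toReal = 2 := by
    have := congrArg ENNReal.toReal hpq
    rw [ENNReal.toReal_add (ENNReal.div_ne_top (by simp) hp0) (ENNReal.div_ne_top (by simp) hq0),
      ENNReal.toReal_div, ENNReal.toReal_div] at this
    simpa using this
  have e3 : 3 / q.toReal = 2 * (3 / (2 * q.toReal)) := by
    rw [← div_div, ← mul_div_assoc]; norm_num
  have hp : p.toReal = 1 / (1 - 3 / (2 * q.toReal)) := by
    have h1 : 2 / p.toReal = 2 * (1 - 3 / (2 * q.toReal)) := by linarith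
    have hne : p.toReal ≠ 0 := by
      intro h0
      rw [h0, div_zero] at h1
      linarith
    rw [div_eq_iff hne] at h1
    rw [eq_div_iff (by linarith)]
    linarith
  obtain ⟨M, hM⟩ := enstrophy_le_of_lintegral h hm hpos hq hp hθ1 hfin
  have hT0 : 0 < T.toReal := ENNReal.toReal_pos hT.ne' hTfin
  have hTe : T = ENNReal.ofReal T.toReal := (ENNReal.ofReal_toReal hTfin).symm
  rw [hTe] at hm hM hmax
  exact not_isMaximalTime_of_bounded hT0 hm (M := Real.sqrt M)
    (fun t ht => Real.le_sqrt_of_sq_le (hM t ht)) hmax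

end Criterion

end StrainModel

end

open StrainModel in
theorem mainTheorem1 (T : ℝ≥0∞) (hT : 0 < T) (S : ℝ → MatL2)
    (hH1 : ContinuousInH1st T S) (hmild : IsMildSolution T S)
    (hpos : 0 < blowupQuantity (S 0))
    (r₀ : ℝ) (hr₀ : r₀ = blowupQuantity (S 0) / (2 * enstrophy (S 0))) :
    (∀ t : ℝ, 0 < t → ENNReal.ofReal t < T →
      enstrophy (S 0) / (1 - r₀ * t) ^ 2 < enstrophy (S t)) ∧
    T < ENNReal.ofReal (1 / r₀) ∧
    (IsMaximalTime T S → ∀ p q : ℝ≥0∞, 3 / 2 < q → 2 / p + 3 / q = 2 →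
      ∫⁻ t in timeInterval T, lambdaTwoPlusNorm q (S t) ^ p.toReal = ∞) := by
  have hpart : ∀ t : ℝ, 0 < t → ENNReal.ofReal t < T →
      enstrophy (S 0) / (1 - r₀ * t) ^ 2 < enstrophy (S t) := fun t ht0 htT =>
    enstrophy_lower_bound hH1 hmild hpos hr₀ ⟨ht0.le, htT⟩ ht0
  have hlt := existence_time_lt hT hH1 hmild hpos hr₀
  exact ⟨hpart, hlt, fun hmax p q hq hpq => lintegral_lambdaTwoPlusNorm_eq_top hT
    (hlt.trans_le le_top).ne hH1 hmild hpos hmax hq hpq⟩
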